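/- Let $\mathcal C^{<\infty}$ be the ring of germs at $+\infty$ of real-valued functions that, for every $n$, are of class $C^n$ on some half-line $(a,+\infty)$ (with $a$ depending on $n$); it is a differential ring with the usual derivation. A Hardy field is a subfield of $\mathcal C^{<\infty}$ closed under the derivation; it is totally ordered by $f\le g :\Leftrightarrow f(t)\le g(t)$ eventually, and $\operatorname{cf}(H)$ denotes the cofinality of this ordered set (the least cardinality of a cofinal subset). A germ $y$ is d-algebraic over $H$ if $P(y,y',\dots,y^{(n)})=0$ for some $n$ and some nonzero polynomial $P\in H[Y_0,\dots,Y_n]$. Let $x$ be the germ of the identity function, and let $H(x)$ and $H(\mathbb R)$ be the fields of germs generated over $H$ by $x$, respectively by the real constants. A Hardy field $L\supseteq\mathbb R$ is Liouville closed if it is real closed and for all $f,g\in L$ there is a nonzero $y\in L$ with $y'+fy=g$; for a Hardy field $F\supseteq\mathbb R$, $\operatorname{Li}(F)$ is the smallest Liouville closed Hardy field containing $F$ (the intersection of all of them). Theorem. Let $H$ be a Hardy field. (1) Let $E\supseteq H$ be a Hardy field all of whose elements are d-algebraic over $H$, and suppose $\exp(E(x))\subseteq E(x)$. Then $\operatorname{cf}(E)\le\operatorname{cf}(H)$,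 and if moreover $\exp(H(x))\subseteq H(x)$, then $\operatorname{cf}(E)=\operatorname{cf}(H)$. (2) If $\operatorname{cf}(H)=\aleph_0$, then $\operatorname{cf}\big(\operatorname{Li}(H(\mathbb R))\big)=\aleph_0$, and for every Hardy field $M\supseteq H$ that is maximal under inclusion among Hardy fields, the d-closure $\{f\in M: f \text{ is d-algebraic over } H\}$ of $H$ in $M$ also has cofinality $\aleph_0$. -/

import Mathlib

open Filter Topology Set

/-- Germs at `+∞` of real-valued functions. It carries Mathlib's pointwise ring structure and the
partial ordering `f ≤ g ↔ f(t) ≤ g(t)` eventually. -/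
abbrev RealGerm : Type := Germ (atTop : Filter ℝ) ℝ

namespace RealGerm

/-- The germ of the identity function. -/
def X : RealGerm := ((fun t : ℝ => t) : ℝ → ℝ)

/-- The set of germs of constant functions. -/
def constants : Set RealGerm := Set.range fun c : ℝ => ((fun _ : ℝ => c) : RealGerm)

/-- `f` is the germ of an `n` times continuously differentiable function on some `(a, +∞)`. -/
def IsCn (n : ℕ) (f : RealGerm) : Prop :=
  ∃ (a : ℝ) (φ : ℝ → ℝ), ContDiffOn ℝ n φ (Ioi a) ∧ (φ : RealGerm) = f

theorem deriv_eventuallyEq {φ ψ : ℝ → ℝ} (h : φ =ᶠ[atTop] ψ) : deriv φ =ᶠ[atTop] deriv ψ := by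
  obtain ⟨a, ha⟩ := eventually_atTop.1 h
  filter_upwards [eventually_gt_atTop a] with t ht
  apply Filter.EventuallyEq.deriv_eq
  filter_upwards [Ioi_mem_nhds ht] with s hs
  exact ha s (le_of_lt hs)

/-- The derivative of a germ (meaningful when the germ is at least of class `C¹`). -/
noncomputable def derivative : RealGerm → RealGerm :=
  Germ.map' deriv fun _ _ h => deriv_eventuallyEq h

/-- The germ of `exp ∘ f`. -/
noncomputable def exp (f : RealGerm) : RealGerm := f.map Real.exp

/-- A Hardy field: a differential subfield of the ring of germs that are of class `Cⁿ` for
every `n`. -/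
structure IsHardyField (H : Subring RealGerm) : Prop where
  isCn : ∀ f ∈ H, ∀ n, IsCn n f
  isField : IsField H
  derivative_mem : ∀ f ∈ H, derivative f ∈ H

/-- The subfield generated by `F` and `S`: the intersection of all subfields of the ring of germs
containing both. -/
def adjoin (F : Subring RealGerm) (S : Set RealGerm) : Subring RealGerm :=
  sInf {K | IsField K ∧ F ≤ K ∧ S ⊆ K}

/-- `y` is differentially algebraic over `H`: it is a zero of a nonzero differential polynomial
with coefficients in `H`; the variable with index `n` stands for the `n`-th derivative. -/
def IsDAlgebraic (H : Subring RealGerm) (y : RealGerm) : Prop :=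
  ∃ P : MvPolynomial ℕ H, P ≠ 0 ∧ MvPolynomial.aeval (fun n => derivative^[n] y) P = 0

/-- The set of `f` in `M` that are differentially algebraic over `H`. -/
def dClosure (H M : Subring RealGerm) : Set RealGerm := {f | f ∈ M ∧ IsDAlgebraic H f}

/-- Closure under exponentiation: `exp(K) ⊆ K`. -/
def ExpClosed (K : Subring RealGerm) : Prop := ∀ f ∈ K, exp f ∈ K

/-- `L` is real closed, and for all `f, g ∈ L` the equation `y' + f y = g` has a nonzero
solution in `L`. -/
def IsLiouvilleClosed (L : Subring RealGerm) : Prop :=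
  (∃ h : IsField L, @IsRealClosed L h.toField) ∧
    ∀ f ∈ L, ∀ g ∈ L, ∃ y ∈ L, y ≠ 0 ∧ derivative y + f * y = g

/-- The smallest Liouville closed Hardy field extension of a Hardy field containing the real
constants, obtained as the intersection of all of them. -/
def Li (F : Subring RealGerm) : Subring RealGerm :=
  sInf {L | IsHardyField L ∧ IsLiouvilleClosed L ∧ F ≤ L}

end RealGerm

/-! ### Germs at infinity: differentiability, units, eventual signs -/

namespace RealGerm

/-! The heart is a growth bound: every germ that is d-algebraic over `H` and lies in a maximal Hardy
field `M ⊇ H` is bounded by some iterated exponential `exp^[n] (x + h)` with `h ∈ H`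
(`isExpBounded_of_isDAlgebraic`). If `y` violates the bound, so does its logarithmic derivative `v =
y'/y`, since bounding `v` would bound `log y` by integration; moreover every power of `v` is at most
`y` (`exists_logDeriv`). Iterating `y ↦ y'/y` gives a sequence in the differential field generated
by `y`, each term exceeding all powers of the next and all exceeding `H`. Comparing leading terms,
such a sequence is algebraically independent over `H` (`algebraicIndependent_of_dominates`), which
is impossible in a differential field of finite transcendence degree.

To use the bound one returns from `K(x)` to `K`. If `K(x)` is closed under `exp`, then `K` is
cofinal in `K(x)` (`exists_le_of_mem_adjoin_X`): `K` is not made of constants, since `e^x` outgrows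
rational functions with constant coefficients; so `K` has an infinite element, hence one above `x`,
and nonzero values of polynomials in `x` over `K` are bounded below by positive elements of `K`.
With `K = E`, the pairs `(n, h)`, `h` in a cofinal subset of `H`, index a cofinal subset of `E`, so
`cf(E) ≤ ℵ₀ · cf(H) = cf(H)`. With `K = H`, the field `H` is itself cofinal in `E`.

For countable cofinality, the d-closure of `H` in `M` is a Liouville closed Hardy field containing
`x` and closed under `exp`, because `M` is closed under first order linear equations
(`mem_of_linear_of_maximal`) and is real closed. It therefore contains `Li(H(ℝ))`, and the first
part applies to both fields. -/

theorem derivative_coe (φ : ℝ → ℝ) : derivative (φ : RealGerm) = (deriv φ : ℝ → ℝ) := rfl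

theorem coe_eq_iff {φ ψ : ℝ → ℝ} : (φ : RealGerm) = ψ ↔ φ =ᶠ[atTop] ψ := Germ.coe_eq

theorem coe_le_iff {φ ψ : ℝ → ℝ} : (φ : RealGerm) ≤ ψ ↔ ∀ᶠ t in atTop, φ t ≤ ψ t := Iff.rfl

theorem coe_eq_zero_iff {φ : ℝ → ℝ} : (φ : RealGerm) = 0 ↔ ∀ᶠ t in atTop, φ t = 0 := Germ.coe_eq

theorem exists_coe (f : RealGerm) : ∃ φ : ℝ → ℝ, (φ : RealGerm) = f :=
  Germ.inductionOn f fun φ => ⟨φ, rfl⟩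

theorem isCn_coe {n : ℕ} {φ : ℝ → ℝ} :
    IsCn n (φ : RealGerm) ↔ ∃ a : ℝ, ContDiffOn ℝ n φ (Ioi a) := by
  constructor
  · rintro ⟨a, ψ, hψ, h⟩
    obtain ⟨b, hb⟩ := eventually_atTop.1 (coe_eq_iff.1 h)
    refine ⟨max a b, (hψ.mono (Ioi_subset_Ioi (le_max_left a b))).congr fun t ht => ?_⟩
    exact (hb t ((le_max_right a b).trans (le_of_lt ht))).symm
  · rintro ⟨a, h⟩
    exact ⟨a, φ, h, rfl⟩

/-- Germs that are eventually differentiable. -/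
def EvDiff (f : RealGerm) : Prop :=
  ∃ φ : ℝ → ℝ, (∀ᶠ t in atTop, DifferentiableAt ℝ φ t) ∧ (φ : RealGerm) = f

theorem eventually_eventuallyEq_nhds {φ ψ : ℝ → ℝ} (h : φ =ᶠ[atTop] ψ) :
    ∀ᶠ t in atTop, φ =ᶠ[𝓝 t] ψ := by
  obtain ⟨a, ha⟩ := eventually_atTop.1 h
  filter_upwards [eventually_gt_atTop a] with t ht
  filter_upwards [Ioi_mem_nhds ht] with s hs
  exact ha s (le_of_lt hs)

theorem evDiff_coe {φ : ℝ → ℝ} :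
    EvDiff (φ : RealGerm) ↔ ∀ᶠ t in atTop, DifferentiableAt ℝ φ t := by
  constructor
  · rintro ⟨ψ, hψ, h⟩
    filter_upwards [hψ, eventually_eventuallyEq_nhds (coe_eq_iff.1 h)] with t h1 h2
    exact h2.differentiableAt_iff.1 h1
  · intro h
    exact ⟨φ, h, rfl⟩

/-- Where a function is not differentiable `deriv` has the default value 0, so smoothness of
`derivative f` says nothing about `f` without the clause `EvDiff f`. -/
theorem isCn_succ {n : ℕ} {f : RealGerm} :
    IsCn (n + 1) f ↔ EvDiff f ∧ IsCn n (derivative f) := by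
  obtain ⟨φ, rfl⟩ := exists_coe f
  rw [derivative_coe, isCn_coe, isCn_coe, evDiff_coe]
  push_cast
  constructor
  · rintro ⟨a, ha⟩
    rw [contDiffOn_succ_iff_deriv_of_isOpen isOpen_Ioi] at ha
    refine ⟨?_, a, ha.2.2⟩
    filter_upwards [eventually_gt_atTop a] with t ht
    exact (ha.1 t ht).differentiableAt (Ioi_mem_nhds ht)
  · rintro ⟨h, a, ha⟩
    obtain ⟨b, hb⟩ := eventually_atTop.1 h
    refine ⟨max a b, ?_⟩
    rw [contDiffOn_succ_iff_deriv_of_isOpen isOpen_Ioi]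
    refine ⟨fun t ht => (hb t ((le_max_right a b).trans (le_of_lt ht))).differentiableWithinAt,
      by simp, ha.mono (Ioi_subset_Ioi (le_max_left a b))⟩

theorem IsCn.evDiff {f : RealGerm} (h : IsCn 1 f) : EvDiff f := (isCn_succ.1 h).1

theorem EvDiff.isCn_zero {f : RealGerm} (h : EvDiff f) : IsCn 0 f := by
  obtain ⟨φ, hφ, rfl⟩ := h
  obtain ⟨a, ha⟩ := eventually_atTop.1 hφ
  refine isCn_coe.2 ⟨a, ?_⟩
  simp only [Nat.cast_zero, contDiffOn_zero]
  exact fun t ht => (ha t (le_of_lt ht)).continuousAt.continuousWithinAt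

theorem IsCn.op₂ {n : ℕ} {φ ψ : ℝ → ℝ} (hf : IsCn n (φ : RealGerm)) (hg : IsCn n (ψ : RealGerm))
    {θ : ℝ → ℝ}
    (h : ∀ s : Set ℝ, ContDiffOn ℝ n φ s → ContDiffOn ℝ n ψ s → ContDiffOn ℝ n θ s) :
    IsCn n (θ : RealGerm) := by
  obtain ⟨a, ha⟩ := isCn_coe.1 hf
  obtain ⟨b, hb⟩ := isCn_coe.1 hg
  exact isCn_coe.2 ⟨max a b, h _ (ha.mono (Ioi_subset_Ioi (le_max_left a b)))
    (hb.mono (Ioi_subset_Ioi (le_max_right a b)))⟩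

theorem IsCn.add {n : ℕ} {f g : RealGerm} (hf : IsCn n f) (hg : IsCn n g) : IsCn n (f + g) := by
  obtain ⟨φ, rfl⟩ := exists_coe f
  obtain ⟨ψ, rfl⟩ := exists_coe g
  exact hf.op₂ hg (θ := φ + ψ) fun s h1 h2 => h1.add h2

theorem IsCn.mul {n : ℕ} {f g : RealGerm} (hf : IsCn n f) (hg : IsCn n g) : IsCn n (f * g) := by
  obtain ⟨φ, rfl⟩ := exists_coe f
  obtain ⟨ψ, rfl⟩ := exists_coe g
  exact hf.op₂ hg (θ := φ * ψ) fun s h1 h2 => h1.mul h2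

theorem IsCn.eq_of_mul_eq {n : ℕ} {f g z : RealGerm} (hf : IsCn n f) (hg : IsCn n g)
    (hu : IsUnit g) (h : z * g = f) : IsCn n z := by
  obtain ⟨φ, rfl⟩ := exists_coe f
  obtain ⟨ψ, rfl⟩ := exists_coe g
  obtain ⟨ζ, rfl⟩ := exists_coe z
  obtain ⟨u, hu⟩ := isUnit_iff_exists_inv.1 hu
  obtain ⟨χ, rfl⟩ := exists_coe u
  have h1 : ∀ᶠ t in atTop, ψ t * χ t = 1 := coe_eq_iff.1 hu
  have h2 : ∀ᶠ t in atTop, ζ t * ψ t = φ t := coe_eq_iff.1 h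
  obtain ⟨a, ha⟩ := isCn_coe.1 hf
  obtain ⟨b, hb⟩ := isCn_coe.1 hg
  obtain ⟨c, hc⟩ := eventually_atTop.1 (h1.and h2)
  have key : ∀ t ∈ Ioi (max (max a b) c), ψ t ≠ 0 ∧ ζ t = φ t / ψ t := by
    intro t ht
    have := hc t ((le_max_right _ _).trans (le_of_lt ht))
    have h0 : ψ t ≠ 0 := left_ne_zero_of_mul_eq_one this.1
    exact ⟨h0, by rw [eq_div_iff h0, this.2]⟩
  refine isCn_coe.2 ⟨max (max a b) c, ContDiffOn.congr (ContDiffOn.div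
    (ha.mono (Ioi_subset_Ioi ((le_max_left a b).trans (le_max_left _ _))))
    (hb.mono (Ioi_subset_Ioi ((le_max_right a b).trans (le_max_left _ _))))
    fun t ht => (key t ht).1) fun t ht => (key t ht).2⟩

theorem EvDiff.mul {f g : RealGerm} (hf : EvDiff f) (hg : EvDiff g) : EvDiff (f * g) := by
  obtain ⟨φ, hφ, rfl⟩ := hf
  obtain ⟨ψ, hψ, rfl⟩ := hg
  refine ⟨φ * ψ, ?_, rfl⟩
  filter_upwards [hφ, hψ] with t h1 h2 using h1.mul h2

theorem EvDiff.add {f g : RealGerm} (hf : EvDiff f) (hg : EvDiff g) : EvDiff (f + g) := by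
  obtain ⟨φ, hφ, rfl⟩ := hf
  obtain ⟨ψ, hψ, rfl⟩ := hg
  refine ⟨φ + ψ, ?_, rfl⟩
  filter_upwards [hφ, hψ] with t h1 h2 using h1.add h2

theorem derivative_add {f g : RealGerm} (hf : EvDiff f) (hg : EvDiff g) :
    derivative (f + g) = derivative f + derivative g := by
  obtain ⟨φ, hφ, rfl⟩ := hf
  obtain ⟨ψ, hψ, rfl⟩ := hg
  refine coe_eq_iff.2 ?_
  filter_upwards [hφ, hψ] with t h1 h2 using deriv_add h1 h2

theorem derivative_mul {f g : RealGerm} (hf : EvDiff f) (hg : EvDiff g) :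
    derivative (f * g) = derivative f * g + f * derivative g := by
  obtain ⟨φ, hφ, rfl⟩ := hf
  obtain ⟨ψ, hψ, rfl⟩ := hg
  refine coe_eq_iff.2 ?_
  filter_upwards [hφ, hψ] with t h1 h2 using deriv_mul h1 h2

theorem isUnit_coe {φ : ℝ → ℝ} : IsUnit (φ : RealGerm) ↔ ∀ᶠ t in atTop, φ t ≠ 0 := by
  constructor
  · intro h
    obtain ⟨u, hu⟩ := isUnit_iff_exists_inv.1 h
    obtain ⟨χ, rfl⟩ := exists_coe u
    have h1 : ∀ᶠ t in atTop, φ t * χ t = 1 := coe_eq_iff.1 hu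
    exact h1.mono fun t => left_ne_zero_of_mul_eq_one
  · intro h
    refine isUnit_iff_exists_inv.2 ⟨(φ⁻¹ : ℝ → ℝ), coe_eq_iff.2 ?_⟩
    filter_upwards [h] with t ht using mul_inv_cancel₀ ht

/-- A continuous function without zeros near `+∞` has an eventual sign. -/
theorem eventually_pos_or_neg {φ : ℝ → ℝ} {a : ℝ} (hc : ContinuousOn φ (Ioi a))
    (h : ∀ᶠ t in atTop, φ t ≠ 0) : (∀ᶠ t in atTop, 0 < φ t) ∨ ∀ᶠ t in atTop, φ t < 0 := by
  obtain ⟨b, hb⟩ := eventually_atTop.1 h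
  set c := max a b
  have hc' : ContinuousOn φ (Ioi c) := hc.mono (Ioi_subset_Ioi (le_max_left a b))
  have h0 : ∀ t ∈ Ioi c, φ t ≠ 0 := fun t ht => hb t ((le_max_right a b).trans (le_of_lt ht))
  by_cases hp : ∃ t ∈ Ioi c, 0 < φ t
  · left
    obtain ⟨s, hs, hs0⟩ := hp
    filter_upwards [eventually_gt_atTop c] with t ht
    by_contra hn
    obtain ⟨r, hr, hr0⟩ := isPreconnected_Ioi.intermediate_value (mem_Ioi.2 ht) hs hc'
      ⟨not_lt.1 hn, hs0.le⟩
    exact h0 r hr hr0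
  · right
    push Not at hp
    filter_upwards [eventually_gt_atTop c] with t ht
    exact lt_of_le_of_ne (hp t ht) (h0 t ht)

/-! ### Order and derivation of a Hardy field -/

namespace IsHardyField

variable {K : Subring RealGerm} (hK : IsHardyField K)
include hK

theorem evDiff {f : RealGerm} (hf : f ∈ K) : EvDiff f := (hK.isCn f hf 1).evDiff

theorem eventually_differentiableAt {φ : ℝ → ℝ} (hf : (φ : RealGerm) ∈ K) :
    ∀ᶠ t in atTop, DifferentiableAt ℝ φ t := evDiff_coe.1 (hK.evDiff hf)

theorem exists_inv {f : RealGerm} (hf : f ∈ K) (h0 : f ≠ 0) : ∃ g ∈ K, f * g = 1 := by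
  obtain ⟨g, hg⟩ := hK.isField.mul_inv_cancel (a := ⟨f, hf⟩) fun h => h0 congr(($h : RealGerm))
  exact ⟨g, g.2, congr(($hg : RealGerm))⟩

theorem isUnit {f : RealGerm} (hf : f ∈ K) (h0 : f ≠ 0) : IsUnit f := by
  obtain ⟨g, -, hg⟩ := hK.exists_inv hf h0
  exact isUnit_iff_exists_inv.2 ⟨g, hg⟩

/-- A nonzero element is invertible, so it eventually has no zeros, and continuity fixes its sign.
-/
theorem trichotomy {φ : ℝ → ℝ} (hf : (φ : RealGerm) ∈ K) :
    (∀ᶠ t in atTop, φ t = 0) ∨ (∀ᶠ t in atTop, 0 < φ t) ∨ ∀ᶠ t in atTop, φ t < 0 := by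
  by_cases h0 : (φ : RealGerm) = 0
  · exact Or.inl (coe_eq_zero_iff.1 h0)
  · right
    obtain ⟨a, ha⟩ := isCn_coe.1 (hK.isCn _ hf 0)
    exact eventually_pos_or_neg ha.continuousOn (isUnit_coe.1 (hK.isUnit hf h0))

theorem compare {φ ψ : ℝ → ℝ} (hf : (φ : RealGerm) ∈ K) (hg : (ψ : RealGerm) ∈ K) :
    (∀ᶠ t in atTop, φ t = ψ t) ∨ (∀ᶠ t in atTop, φ t < ψ t) ∨ ∀ᶠ t in atTop, ψ t < φ t := by
  rcases hK.trichotomy (φ := ψ - φ) (K.sub_mem hg hf) with h | h | h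
  · exact Or.inl (h.mono fun t ht => (sub_eq_zero.1 ht).symm)
  · exact Or.inr (Or.inl (h.mono fun t ht => sub_pos.1 ht))
  · exact Or.inr (Or.inr (h.mono fun t ht => sub_neg.1 ht))

theorem lt_or_ge {φ ψ : ℝ → ℝ} (hf : (φ : RealGerm) ∈ K) (hg : (ψ : RealGerm) ∈ K) :
    (∀ᶠ t in atTop, φ t < ψ t) ∨ ∀ᶠ t in atTop, ψ t ≤ φ t := by
  rcases hK.compare hf hg with h | h | h
  · exact Or.inr (h.mono fun t ht => ht.ge)
  · exact Or.inl h
  · exact Or.inr (h.mono fun t ht => ht.le)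

theorem le_total {f g : RealGerm} (hf : f ∈ K) (hg : g ∈ K) : f ≤ g ∨ g ≤ f := by
  obtain ⟨φ, rfl⟩ := exists_coe f
  obtain ⟨ψ, rfl⟩ := exists_coe g
  rcases hK.lt_or_ge hf hg with h | h
  · exact Or.inl (coe_le_iff.2 (h.mono fun t => le_of_lt))
  · exact Or.inr (coe_le_iff.2 h)

omit hK in
theorem coe_lt_of_eventually {φ ψ : ℝ → ℝ} (h : ∀ᶠ t in atTop, φ t < ψ t) :
    (φ : RealGerm) < ψ := by
  refine lt_of_le_not_ge (coe_le_iff.2 (h.mono fun t => le_of_lt)) fun h' => ?_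
  obtain ⟨t, h1, h2⟩ := (h.and (coe_le_iff.1 h')).exists
  exact absurd h1 (not_lt.2 h2)

theorem coe_lt_iff {φ ψ : ℝ → ℝ} (hf : (φ : RealGerm) ∈ K) (hg : (ψ : RealGerm) ∈ K) :
    (φ : RealGerm) < ψ ↔ ∀ᶠ t in atTop, φ t < ψ t := by
  refine ⟨fun h => ?_, coe_lt_of_eventually⟩
  rcases hK.lt_or_ge hf hg with h' | h'
  · exact h'
  · exact absurd (coe_le_iff.2 h') (not_le_of_gt h)

end IsHardyField

/-- The field structure of a Hardy field. -/
@[reducible] noncomputable def IsHardyField.field {K : Subring RealGerm} (hK : IsHardyField K) :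
    Field K := hK.isField.toField

/-- The linear order of a Hardy field. -/
@[reducible] noncomputable def IsHardyField.linearOrder {K : Subring RealGerm}
    (hK : IsHardyField K) : LinearOrder K :=
  { (inferInstance : PartialOrder K) with
    le_total := fun f g => hK.le_total f.2 g.2
    toDecidableLE := Classical.decRel _ }

theorem IsHardyField.isStrictOrderedRing {K : Subring RealGerm} (hK : IsHardyField K) :
    letI := hK.field
    letI := hK.linearOrder
    IsStrictOrderedRing K := by
  let _ := hK.field
  let _ := hK.linearOrder
  refine IsStrictOrderedRing.of_mul_pos ?_
  rintro ⟨f, hf⟩ ⟨g, hg⟩ h1 h2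
  obtain ⟨φ, rfl⟩ := exists_coe f
  obtain ⟨ψ, rfl⟩ := exists_coe g
  have h1' := (hK.coe_lt_iff (φ := 0) K.zero_mem hf).1 h1
  have h2' := (hK.coe_lt_iff (φ := 0) K.zero_mem hg).1 h2
  refine (hK.coe_lt_iff (φ := 0) (ψ := φ * ψ) K.zero_mem (K.mul_mem hf hg)).2 ?_
  filter_upwards [h1', h2'] with t a b using mul_pos a b

/-- The derivation of a Hardy field. -/
noncomputable def IsHardyField.derivation {K : Subring RealGerm} (hK : IsHardyField K) :
    Derivation ℤ K K :=
  Derivation.mk' (AddMonoidHom.toIntLinearMap (AddMonoidHom.mk'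
    (fun f : K => (⟨derivative f, hK.derivative_mem _ f.2⟩ : K)) fun f g =>
      Subtype.ext (derivative_add (hK.evDiff f.2) (hK.evDiff g.2)))) fun f g => by
    apply Subtype.ext
    refine (derivative_mul (hK.evDiff f.2) (hK.evDiff g.2)).trans ?_
    change _ = (f : RealGerm) * derivative g + (g : RealGerm) * derivative f
    ring

/-! ### Constructing fields of germs: quotients, unions of chains, intersections -/

theorem isField_of_forall_exists {K : Subring RealGerm}
    (h : ∀ f ∈ K, f ≠ 0 → ∃ g ∈ K, f * g = 1) : IsField K where
  exists_pair_ne := ⟨0, 1, fun h => zero_ne_one congr(($h : RealGerm))⟩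
  mul_comm := mul_comm
  mul_inv_cancel {f} hf := by
    obtain ⟨g, hg, hfg⟩ := h f f.2 fun h => hf (Subtype.ext h)
    exact ⟨⟨g, hg⟩, Subtype.ext hfg⟩

theorem exists_inv_of_isField {K : Subring RealGerm} (hK : IsField K) {f : RealGerm}
    (hf : f ∈ K) (h0 : f ≠ 0) : ∃ g ∈ K, f * g = 1 := by
  obtain ⟨g, hg⟩ := hK.mul_inv_cancel (a := ⟨f, hf⟩) fun h => h0 congr(($h : RealGerm))
  exact ⟨g, g.2, congr(($hg : RealGerm))⟩

/-- The ring of quotients of a ring of germs whose nonzero elements are units. -/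
def quotientSubring (R : Subring RealGerm) : Subring RealGerm where
  carrier := {z | ∃ a ∈ R, ∃ b ∈ R, IsUnit b ∧ z * b = a}
  mul_mem' := by
    rintro z w ⟨a, ha, b, hb, hu, h⟩ ⟨c, hc, d, hd, hv, k⟩
    exact ⟨a * c, R.mul_mem ha hc, b * d, R.mul_mem hb hd, hu.mul hv, by rw [← h, ← k]; ring⟩
  one_mem' := ⟨1, R.one_mem, 1, R.one_mem, isUnit_one, by simp⟩
  add_mem' := by
    rintro z w ⟨a, ha, b, hb, hu, h⟩ ⟨c, hc, d, hd, hv, k⟩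
    exact ⟨a * d + c * b, R.add_mem (R.mul_mem ha hd) (R.mul_mem hc hb), b * d, R.mul_mem hb hd,
      hu.mul hv, by rw [← h, ← k]; ring⟩
  zero_mem' := ⟨0, R.zero_mem, 1, R.one_mem, isUnit_one, by simp⟩
  neg_mem' := by
    rintro z ⟨a, ha, b, hb, hu, h⟩
    exact ⟨-a, R.neg_mem ha, b, hb, hu, by rw [← h]; ring⟩

theorem le_quotientSubring (R : Subring RealGerm) : R ≤ quotientSubring R :=
  fun z hz => ⟨z, hz, 1, R.one_mem, isUnit_one, by simp⟩

theorem isField_quotientSubring {R : Subring RealGerm} (hR : ∀ a ∈ R, a ≠ 0 → IsUnit a) :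
    IsField (quotientSubring R) := by
  refine isField_of_forall_exists ?_
  rintro z ⟨a, ha, b, hb, hu, h⟩ hz
  have ha0 : a ≠ 0 := by
    rintro rfl
    exact hz (hu.mul_left_eq_zero.1 h)
  obtain ⟨c, hc⟩ := isUnit_iff_exists_inv.1 (hR a ha ha0)
  refine ⟨b * c, ⟨b, hb, a, ha, hR a ha ha0, ?_⟩, ?_⟩
  · linear_combination b * hc
  · rw [← mul_assoc, h, hc]

theorem isHardyField_quotientSubring {R : Subring RealGerm} (hR : ∀ a ∈ R, a ≠ 0 → IsUnit a)
    (hC : ∀ a ∈ R, ∀ n, IsCn n a) (hd : ∀ a ∈ R, derivative a ∈ R) :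
    IsHardyField (quotientSubring R) := by
  have hcn : ∀ f ∈ quotientSubring R, ∀ n, IsCn n f := by
    rintro z ⟨a, ha, b, hb, hu, h⟩ n
    exact (hC a ha n).eq_of_mul_eq (hC b hb n) hu h
  refine ⟨hcn, isField_quotientSubring hR, ?_⟩
  intro z hz
  have hz1 := (hcn z hz 1).evDiff
  obtain ⟨a, ha, b, hb, hu, h⟩ := hz
  -- Differentiating `z * b = a` gives `z' b² = a' b - a b'` without a quotient rule.
  have key := derivative_mul hz1 (hC b hb 1).evDiff
  rw [h] at key
  refine ⟨derivative a * b - a * derivative b, R.sub_mem (R.mul_mem (hd a ha) hb)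
    (R.mul_mem ha (hd b hb)), b * b, R.mul_mem hb hb, hu.mul hu, ?_⟩
  rw [key, ← h]
  ring

/-- A Hardy field is contained in a maximal one. -/
theorem IsHardyField.exists_maximal {K : Subring RealGerm} (hK : IsHardyField K) :
    ∃ M, Maximal IsHardyField M ∧ K ≤ M := by
  obtain ⟨M, hKM, hM⟩ := zorn_le_nonempty₀ {L | IsHardyField L} (fun c hc hchain L hL => by
    have hdir : DirectedOn (· ≤ ·) c := hchain.directedOn
    have hmem : ∀ {z}, z ∈ sSup c ↔ ∃ L ∈ c, z ∈ L := Subring.mem_sSup_of_directedOn ⟨L, hL⟩ hdir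
    refine ⟨sSup c, ⟨fun f hf n => ?_, isField_of_forall_exists fun f hf h0 => ?_,
      fun f hf => ?_⟩, fun L hL => le_sSup hL⟩
    · obtain ⟨L, hL, hfL⟩ := hmem.1 hf
      exact (hc hL).isCn f hfL n
    · obtain ⟨L, hL, hfL⟩ := hmem.1 hf
      obtain ⟨g, hg, h⟩ := (hc hL).exists_inv hfL h0
      exact ⟨g, hmem.2 ⟨L, hL, hg⟩, h⟩
    · obtain ⟨L, hL, hfL⟩ := hmem.1 hf
      exact hmem.2 ⟨L, hL, (hc hL).derivative_mem f hfL⟩) K hK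
  exact ⟨M, hM, hKM⟩

/-- The intersection of a nonempty family of fields of germs is a field. -/
theorem isField_sInf {c : Set (Subring RealGerm)} (hc : ∀ L ∈ c, IsField L) (hne : c.Nonempty) :
    IsField (sInf c : Subring RealGerm) := by
  refine isField_of_forall_exists fun f hf h0 => ?_
  obtain ⟨L, hL⟩ := hne
  obtain ⟨g, -, hg⟩ := exists_inv_of_isField (hc L hL) (Subring.mem_sInf.1 hf L hL) h0
  refine ⟨g, Subring.mem_sInf.2 fun L' hL' => ?_, hg⟩
  obtain ⟨g', hg', h'⟩ := exists_inv_of_isField (hc L' hL') (Subring.mem_sInf.1 hf L' hL') h0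
  -- Inverses are unique in the ring of germs, so the inverse found in one field lies in all of
  -- them.
  have : g = g' := by linear_combination g' * hg - g * h'
  rwa [this]

end RealGerm

/-! ### Growth gaps in ordered fields force algebraic independence -/

section GrowthDomination

variable {F : Type*} [Field F] [LinearOrder F] [IsStrictOrderedRing F]

/-- `u` dominates the `F`-valued ring `A`: it is larger than all elements of `A` and than the
inverses of the nonzero ones. -/
def Dominates (A : Type*) [CommRing A] [Algebra A F] (u : F) : Prop :=
  2 ≤ u ∧ ∀ w : A, w ≠ 0 → |algebraMap A F w| ≤ u ∧ 1 ≤ |algebraMap A F w| * u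

namespace Dominates

variable {A : Type*} [CommRing A] [Algebra A F] {u : F}

theorem algebraMap_ne_zero (h : Dominates A u) {w : A} (hw : w ≠ 0) : algebraMap A F w ≠ 0 := by
  intro h0
  have := (h.2 w hw).2
  rw [h0, abs_zero, zero_mul] at this
  exact absurd this (not_le.2 one_pos)

/-- `A` need not be a field, so `w / a` is unavailable. Applied to the squares, domination gives
`|w|² ≤ u ≤ |a|² u²`. -/
theorem abs_le_abs_mul (h : Dominates A u) {w a : A} (ha : a ≠ 0) :
    |algebraMap A F w| ≤ |algebraMap A F a| * u := by
  have hu : 0 < u := lt_of_lt_of_le two_pos h.1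
  have hsq : ∀ {z : A}, z ≠ 0 → z * z ≠ 0 := fun {z} hz h0 => by
    have := congrArg (algebraMap A F) h0
    rw [map_mul, map_zero, mul_self_eq_zero] at this
    exact h.algebraMap_ne_zero hz this
  by_cases hw0 : w = 0
  · subst hw0
    rw [map_zero, abs_zero]
    positivity
  have h1 := (h.2 (w * w) (hsq hw0)).1
  have h2 := (h.2 (a * a) (hsq ha)).2
  rw [map_mul, abs_mul] at h1 h2
  refine le_of_sq_le_sq ?_ (by positivity)
  rw [sq, sq]
  calc _ ≤ u := h1
    _ ≤ (|algebraMap A F a| * |algebraMap A F a| * u) * u := le_mul_of_one_le_left hu.le h2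
    _ = _ := by ring

theorem abs_le (h : Dominates A u) (w : A) : |algebraMap A F w| ≤ u := by
  by_cases hw : w = 0
  · rw [hw, map_zero, abs_zero]
    exact le_trans zero_le_two h.1
  · exact (h.2 w hw).1

theorem natCast_le (h : Dominates A u) (n : ℕ) : (n : F) ≤ u := by
  have := h.abs_le (n : A)
  rwa [map_natCast, Nat.abs_cast] at this

open Polynomial in
-- The leading term is at least twice the sum of the others, so `2 |p(u)| ≥ l u^d ≥ l`, while `l u ≥
-- 2` by domination.
theorem one_le_abs_aeval_mul (h : Dominates A u) {p : A[X]} (hp : p ≠ 0) :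
    1 ≤ |aeval u p| * u := by
  have hu : 0 < u := lt_of_lt_of_le two_pos h.1
  have hu1 : 1 ≤ u := one_le_two.trans h.1
  set d := p.natDegree with hd
  set l := |algebraMap A F p.leadingCoeff| with hl
  have hl0 : 0 < l := abs_pos.2 (h.algebraMap_ne_zero (leadingCoeff_ne_zero.2 hp))
  have hterm : ∀ i ∈ Finset.range d,
      (2 * d : F) * |algebraMap A F (p.coeff i) * u ^ i| ≤ l * u ^ d := by
    intro i hi
    -- The factor `2 d` is absorbed into the ring element, so domination yields the sharp constant
    -- directly.
    have h1 := h.abs_le_abs_mul (w := ((2 * d : ℕ) : A) * p.coeff i) (leadingCoeff_ne_zero.2 hp)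
    rw [map_mul, map_natCast, abs_mul, Nat.abs_cast] at h1
    push_cast at h1
    calc (2 * d : F) * |algebraMap A F (p.coeff i) * u ^ i|
        = (2 * d * |algebraMap A F (p.coeff i)|) * u ^ i := by
          rw [abs_mul, abs_pow, abs_of_pos hu]; ring
      _ ≤ (l * u) * u ^ i := by gcongr
      _ = l * u ^ (i + 1) := by ring
      _ ≤ l * u ^ d := by
          have := pow_le_pow_right₀ hu1 (Nat.succ_le_of_lt (Finset.mem_range.1 hi))
          gcongr
  have hsum : 2 * |∑ i ∈ Finset.range d, algebraMap A F (p.coeff i) * u ^ i| ≤ l * u ^ d := by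
    rcases Nat.eq_zero_or_pos d with h0 | h0
    · rw [h0]
      simp [hl0.le]
    have hd0 : (0 : F) < d := Nat.cast_pos.2 h0
    have h2 : (2 * d : F) * |∑ i ∈ Finset.range d, algebraMap A F (p.coeff i) * u ^ i|
        ≤ d * (l * u ^ d) := by
      calc _ ≤ (2 * d : F) * ∑ i ∈ Finset.range d, |algebraMap A F (p.coeff i) * u ^ i| := by
            gcongr
            exact Finset.abs_sum_le_sum_abs _ _
        _ = ∑ i ∈ Finset.range d, (2 * d : F) * |algebraMap A F (p.coeff i) * u ^ i| :=
            Finset.mul_sum _ _ _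
        _ ≤ ∑ i ∈ Finset.range d, l * u ^ d := Finset.sum_le_sum hterm
        _ = d * (l * u ^ d) := by rw [Finset.sum_const, Finset.card_range, nsmul_eq_mul]
    refine le_of_mul_le_mul_left ?_ hd0
    calc _ = (2 * d : F) * |∑ i ∈ Finset.range d, algebraMap A F (p.coeff i) * u ^ i| := by ring
      _ ≤ _ := h2
  have heq : aeval u p = ∑ i ∈ Finset.range d, algebraMap A F (p.coeff i) * u ^ i
      + algebraMap A F p.leadingCoeff * u ^ d := by
    rw [aeval_eq_sum_range, Finset.sum_range_succ]
    simp only [Algebra.smul_def]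
    rfl
  have hlow : l * u ^ d ≤ 2 * |aeval u p| := by
    have h3 : l * u ^ d ≤ |aeval u p|
        + |∑ i ∈ Finset.range d, algebraMap A F (p.coeff i) * u ^ i| := by
      have h4 : algebraMap A F p.leadingCoeff * u ^ d = aeval u p
        - ∑ i ∈ Finset.range d, algebraMap A F (p.coeff i) * u ^ i := by rw [heq]; ring
      calc l * u ^ d = |algebraMap A F p.leadingCoeff * u ^ d| := by
            rw [abs_mul, abs_pow, abs_of_pos hu]
        _ ≤ _ := by rw [h4]; exact abs_sub _ _
    linarith
  have h5 := h.abs_le_abs_mul (w := 2) (leadingCoeff_ne_zero.2 hp)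
  rw [map_ofNat, abs_two, ← hl] at h5
  have h6 : l ≤ l * u ^ d := le_mul_of_one_le_right hl0.le (one_le_pow₀ hu1)
  have h7 : l * u ≤ 2 * |aeval u p| * u := by gcongr; exact h6.trans hlow
  linarith

open Polynomial in
-- Beyond `u ^ natDegree`, one factor `u` bounds the coefficients and one bounds the number of
-- terms.
theorem abs_aeval_le (h : Dominates A u) (p : A[X]) : |aeval u p| ≤ u ^ (p.natDegree + 2) := by
  have hu : 0 < u := lt_of_lt_of_le two_pos h.1
  have hu1 : 1 ≤ u := one_le_two.trans h.1
  rw [aeval_eq_sum_range]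
  calc _ ≤ ∑ i ∈ Finset.range (p.natDegree + 1), |p.coeff i • u ^ i| :=
        Finset.abs_sum_le_sum_abs _ _
    _ ≤ ∑ i ∈ Finset.range (p.natDegree + 1), u ^ (p.natDegree + 1) := by
        refine Finset.sum_le_sum fun i hi => ?_
        rw [Algebra.smul_def, abs_mul, abs_pow, abs_of_pos hu]
        have : i ≤ p.natDegree := Nat.lt_succ_iff.1 (Finset.mem_range.1 hi)
        have h8 := pow_le_pow_right₀ hu1 this
        rw [pow_succ']
        have h9 := h.abs_le (p.coeff i)
        gcongr
    _ = ((p.natDegree + 1 : ℕ) : F) * u ^ (p.natDegree + 1) := by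
        rw [Finset.sum_const, Finset.card_range, nsmul_eq_mul]
    _ ≤ u * u ^ (p.natDegree + 1) := by gcongr; exact h.natCast_le _
    _ = _ := by ring

theorem transcendental (h : Dominates A u) : Transcendental A u := by
  rintro ⟨p, hp, h0⟩
  have := h.one_le_abs_aeval_mul hp
  rw [h0, abs_zero, zero_mul] at this
  exact absurd this (not_le.2 one_pos)

end Dominates

/-- A sequence in which each element exceeds all powers of the next one, and all elements exceed
the base field, is algebraically independent. -/
theorem algebraicIndependent_of_dominates {R : Type*} [CommRing R] [Algebra R F] {y : ℕ → F}
    (h0 : ∀ i, Dominates R (y i)) (h1 : ∀ i m, y (i + 1) ^ m ≤ y i) :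
    AlgebraicIndependent R y := by
  have hpow : ∀ i j m, i < j → y j ^ m ≤ y i := by
    intro i j m hij
    obtain ⟨k, rfl⟩ := Nat.exists_eq_add_of_lt hij
    induction k generalizing m with
    | zero => exact h1 i m
    | succ k ih =>
      calc y (i + (k + 1) + 1) ^ m ≤ y (i + k + 1) := h1 (i + k + 1) m
        _ ≤ y (i + k + 1) ^ 1 := (pow_one _).ge
        _ ≤ y i := ih 1 (by lia)
  -- Indices are added in decreasing order, that is, by increasing growth. The invariant is that
  -- every `y a` still to come dominates the ring generated so far.
  have key : ∀ s : Finset ℕ, AlgebraicIndepOn R y (s : Set ℕ) ∧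
      ∀ a, (∀ x ∈ s, a < x) → Dominates (Algebra.adjoin R (y '' (s : Set ℕ))) (y a) := by
    intro s
    induction s using Finset.induction_on_min with
    | empty =>
      refine ⟨?_, fun a _ => ⟨(h0 a).1, ?_⟩⟩
      · have : IsEmpty ((∅ : Finset ℕ) : Set ℕ) := by simp
        refine algebraicIndependent_empty_type_iff.2 ?_
        refine (injective_iff_map_eq_zero _).2 fun r hr => by_contra fun hr0 => ?_
        exact (h0 0).algebraMap_ne_zero hr0 hr
      · rintro ⟨w, hw⟩ hw0
        simp only [Finset.coe_empty, image_empty, Algebra.adjoin_empty] at hw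
        obtain ⟨r, rfl⟩ := Algebra.mem_bot.1 hw
        refine (h0 a).2 r ?_
        rintro rfl
        exact hw0 (Subtype.ext (map_zero _))
    | insert b s hb ih =>
      have hdom := ih.2 b hb
      refine ⟨?_, fun a ha => ⟨(h0 a).1, ?_⟩⟩
      · rw [Finset.coe_insert]
        exact ih.1.insert hdom.transcendental
      · rintro ⟨w, hw⟩ hw0
        have hw' : w ∈ (Algebra.adjoin (Algebra.adjoin R (y '' (s : Set ℕ))) {y b}) := by
          have : w ∈ Algebra.adjoin R (y '' (s : Set ℕ) ∪ {y b}) := by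
            rw [union_singleton, ← image_insert_eq]
            simpa using hw
          rw [Algebra.adjoin_union_eq_adjoin_adjoin] at this
          exact this
        rw [Algebra.adjoin_singleton_eq_range_aeval] at hw'
        obtain ⟨p, rfl⟩ := hw'
        have hp : p ≠ 0 := by
          rintro rfl
          exact hw0 (Subtype.ext (map_zero _))
        have hab := ha b (Finset.mem_insert_self _ _)
        have hb0 := (hdom.1)
        -- A nonzero `p(y_b)` lies between `1 / y_b` and a power of `y_b` in absolute value, and
        -- `y_a` exceeds all powers of `y_b`.
        refine ⟨(hdom.abs_aeval_le p).trans (hpow a b _ hab), ?_⟩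
        refine (hdom.one_le_abs_aeval_mul hp).trans ?_
        exact mul_le_mul_of_nonneg_left (by simpa using hpow a b 1 hab) (abs_nonneg _)
  exact algebraicIndependent_of_finite_type fun t ht => by
    simpa using (key ht.toFinset).1

end GrowthDomination

/-! ### Differential fields of finite transcendence degree and the d-closure -/

section DifferentialClosure

open AlgebraicIndependent Polynomial

variable {R F : Type*} [CommRing R] [Field F] [CharZero F] [Algebra R F] [FaithfulSMul R F]
  {d : Derivation ℤ F F}

variable (R) in
/-- The algebraic closure in `F` of the field generated by `R` and `S`. -/
noncomputable def algClosureAdjoin (S : Set F) : Subalgebra (Algebra.adjoin R S) F :=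
  Subalgebra.algebraicClosure (Algebra.adjoin R S) F

omit [CharZero F] in
-- Monotonicity and the bound on transcendence degree are taken from the matroid of algebraic
-- independence.
theorem coe_algClosureAdjoin (S : Set F) :
    (algClosureAdjoin R S : Set F) = (matroid R F).closure S :=
  matroid_closure_eq.symm

omit [CharZero F] [FaithfulSMul R F] in
theorem mem_algClosureAdjoin {S : Set F} {z : F} :
    z ∈ algClosureAdjoin R S ↔ IsAlgebraic (Algebra.adjoin R S) z := Iff.rfl

omit [CharZero F] in
theorem algClosureAdjoin_mono {S T : Set F} (h : S ⊆ T) {z : F} (hz : z ∈ algClosureAdjoin R S) :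
    z ∈ algClosureAdjoin R T := by
  rw [← SetLike.mem_coe, coe_algClosureAdjoin] at hz ⊢
  exact (matroid R F).closure_subset_closure h hz

omit [CharZero F] [FaithfulSMul R F] in
theorem adjoin_subset_algClosureAdjoin {S : Set F} {z : F} (hz : z ∈ Algebra.adjoin R S) :
    z ∈ algClosureAdjoin R S :=
  (algClosureAdjoin R S).algebraMap_mem ⟨z, hz⟩

omit [CharZero F] [FaithfulSMul R F] in
theorem subset_algClosureAdjoin {S : Set F} {z : F} (hz : z ∈ S) : z ∈ algClosureAdjoin R S :=
  adjoin_subset_algClosureAdjoin (Algebra.subset_adjoin hz)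

omit [CharZero F] [FaithfulSMul R F] in
theorem inv_mem_algClosureAdjoin {S : Set F} {z : F} (hz : z ∈ algClosureAdjoin R S) :
    z⁻¹ ∈ algClosureAdjoin R S := IsAlgebraic.inv hz

omit [CharZero F] [FaithfulSMul R F] in
-- Transitivity of algebraicity, after lifting the coefficients to the closure.
theorem mem_algClosureAdjoin_of_isRoot {S : Set F} {p : F[X]} (hp : p ≠ 0)
    (hc : ∀ i, p.coeff i ∈ algClosureAdjoin R S) {z : F} (hz : p.eval z = 0) :
    z ∈ algClosureAdjoin R S := by
  have hl : p ∈ lifts (algebraMap (algClosureAdjoin R S) F) :=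
    (lifts_iff_coeff_lifts p).2 fun i => ⟨⟨_, hc i⟩, rfl⟩
  obtain ⟨q, hq⟩ := (mem_lifts p).1 hl
  have hq0 : q ≠ 0 := by
    rintro rfl
    exact hp (by rw [← hq, Polynomial.map_zero])
  have halg : IsAlgebraic (algClosureAdjoin R S) z :=
    ⟨q, hq0, by rw [← eval_map_algebraMap, hq, hz]⟩
  have : Algebra.IsAlgebraic (Algebra.adjoin R S) (algClosureAdjoin R S) :=
    inferInstanceAs (Algebra.IsAlgebraic (Algebra.adjoin R S)
      (Subalgebra.algebraicClosure (Algebra.adjoin R S) F))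
  exact halg.restrictScalars _

omit [FaithfulSMul R F] in
/-- The algebraic closure of a differential field is a differential field. -/
theorem derivation_mem_algClosureAdjoin (hR : ∀ r : R, ∃ r', d (algebraMap R F r) = algebraMap R F r')
    {S : Set F} (hS : ∀ s ∈ S, d s ∈ algClosureAdjoin R S) {z : F}
    (hz : z ∈ algClosureAdjoin R S) : d z ∈ algClosureAdjoin R S := by
  have h0 : ∀ a ∈ Algebra.adjoin R S, d a ∈ algClosureAdjoin R S := by
    intro a ha
    induction ha using Algebra.adjoin_induction with
    | mem x hx => exact hS x hx
    | algebraMap r =>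
      obtain ⟨r', hr'⟩ := hR r
      rw [hr']
      exact adjoin_subset_algClosureAdjoin (Subalgebra.algebraMap_mem _ r')
    | add x y _ _ hx hy =>
      rw [map_add]
      exact add_mem hx hy
    | mul x y hx' hy' hx hy =>
      rw [Derivation.leibniz, smul_eq_mul, smul_eq_mul]
      exact add_mem (mul_mem (adjoin_subset_algClosureAdjoin hx') hy)
        (mul_mem (adjoin_subset_algClosureAdjoin hy') hx)
  -- Chain rule: `w` is the value at `z` of `p` with differentiated coefficients, already in the
  -- closure.
  have hpoly : ∀ p : (Algebra.adjoin R S)[X], ∃ w ∈ algClosureAdjoin R S,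
      d (aeval z p) = w + aeval z (derivative p) * d z := by
    intro p
    induction p using Polynomial.induction_on' with
    | add p q hp hq =>
      obtain ⟨v, hv, hv'⟩ := hp
      obtain ⟨w, hw, hw'⟩ := hq
      refine ⟨v + w, add_mem hv hw, ?_⟩
      rw [map_add, map_add, hv', hw', map_add, map_add]
      ring
    | monomial n a =>
      refine ⟨d a * z ^ n, mul_mem (h0 a a.2) (pow_mem hz n), ?_⟩
      rw [aeval_monomial, derivative_monomial, aeval_monomial, Derivation.leibniz,
        Derivation.leibniz_pow]
      simp only [smul_eq_mul, nsmul_eq_mul, map_mul, map_natCast]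
      change (a : F) * _ + _ * d (a : F) = _ + (a : F) * _ * _ * _
      ring
  -- An annihilating polynomial of least degree has `p'(z) ≠ 0` in characteristic zero, so `0 = w +
  -- p'(z) · d z` can be solved for `d z`.
  have hne : ∃ n, ∃ p : (Algebra.adjoin R S)[X], p ≠ 0 ∧ aeval z p = 0 ∧ p.natDegree = n := by
    obtain ⟨p, hp, hp'⟩ := mem_algClosureAdjoin.1 hz
    exact ⟨_, p, hp, hp', rfl⟩
  classical
  obtain ⟨p, hp, hp0, hdeg⟩ := Nat.find_spec hne
  have hchar : CharZero (Algebra.adjoin R S) :=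
    ⟨fun m n h => Nat.cast_injective (R := F) (by simpa using congrArg (algebraMap _ F) h)⟩
  have hder : aeval z (derivative p) ≠ 0 := by
    intro h
    have hpos : p.natDegree ≠ 0 := by
      intro h1
      rw [eq_C_of_natDegree_eq_zero h1, aeval_C] at hp0
      have : p.coeff 0 = 0 := Subtype.ext hp0
      rw [eq_C_of_natDegree_eq_zero h1, this, C_0] at hp
      exact hp rfl
    have hlt := natDegree_derivative_lt hpos
    refine Nat.find_min hne (hdeg ▸ hlt) ⟨derivative p, ?_, h, rfl⟩
    intro h2
    exact hpos (derivative_eq_zero.1 h2)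
  obtain ⟨w, hw, hw'⟩ := hpoly p
  rw [hp0, map_zero] at hw'
  have hdz : d z = -w * (aeval z (derivative p))⁻¹ := by
    field_simp
    linear_combination -hw'
  rw [hdz]
  refine mul_mem (neg_mem hw) (inv_mem_algClosureAdjoin ?_)
  rw [aeval_eq_sum_range]
  refine sum_mem fun i _ => ?_
  rw [Algebra.smul_def]
  exact mul_mem (Subalgebra.algebraMap_mem _ _) (pow_mem hz i)

omit [CharZero F] in
/-- There is no infinite algebraically independent family over `R` in a field of finite
transcendence degree. -/
theorem not_algebraicIndependent_of_mem_algClosureAdjoin {S : Set F} (hS : S.Finite) {y : ℕ → F}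
    (hy : ∀ n, y n ∈ algClosureAdjoin R S) : ¬ AlgebraicIndependent R y := by
  intro h
  have := (algebraMap R F).domain_nontrivial
  have hind : (matroid R F).Indep (range y) := matroid_indep_iff.2 h.coe_range
  have hsub : range y ⊆ (matroid R F).closure S := by
    rw [← coe_algClosureAdjoin]
    rintro _ ⟨n, rfl⟩
    exact hy n
  have h1 := hind.encard_le_eRk_of_subset hsub
  rw [Matroid.eRk_closure_eq] at h1
  have h2 := h1.trans ((matroid R F).eRk_le_encard S)
  have h3 : (range y).Finite := Set.encard_lt_top_iff.1
    (h2.trans_lt (Set.encard_lt_top_iff.2 hS))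
  exact Set.infinite_range_of_injective h.injective h3

variable (R d) in
/-- `y` lies in a differential field extension of `R` inside `F` of finite transcendence degree. -/
def IsDiffFinite (y : F) : Prop :=
  ∃ S : Set F, S.Finite ∧ (∀ s ∈ S, d s ∈ algClosureAdjoin R S) ∧ y ∈ algClosureAdjoin R S

omit [CharZero F] in
-- If every term were transcendental over its predecessors, adding terms in increasing order would
-- keep each finite subfamily independent.
theorem exists_mem_algClosureAdjoin_of_not_algebraicIndependent {y : ℕ → F}
    (h : ¬ AlgebraicIndependent R y) : ∃ n, y n ∈ algClosureAdjoin R (y '' Iio n) := by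
  by_contra! hn
  apply h
  have key : ∀ s : Finset ℕ, AlgebraicIndepOn R y (s : Set ℕ) := by
    intro s
    induction s using Finset.induction_on_max with
    | empty =>
      have : IsEmpty ((∅ : Finset ℕ) : Set ℕ) := by simp
      exact algebraicIndependent_empty_type_iff.2 (FaithfulSMul.algebraMap_injective R F)
    | insert b s hb ih =>
      rw [Finset.coe_insert]
      refine ih.insert fun halg => hn b ?_
      exact algClosureAdjoin_mono (image_mono fun x hx => hb x hx) (mem_algClosureAdjoin.2 halg)
  exact algebraicIndependent_of_finite_type fun t ht => by
    simpa using key ht.toFinset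

/-- Finite transcendence degree is visibly stable under field operations, unlike the existence of a
differential equation. Conversely to the degree bound, if the `n`-th derivative is the first one
algebraic over its predecessors, then `y, …, y^(n-1)` serve as `S`. -/
theorem isDiffFinite_iff (hR : ∀ r : R, ∃ r', d (algebraMap R F r) = algebraMap R F r') {y : F} :
    IsDiffFinite R d y ↔ ¬ AlgebraicIndependent R fun n => d^[n] y := by
  constructor
  · rintro ⟨S, hS, hd, hy⟩
    refine not_algebraicIndependent_of_mem_algClosureAdjoin hS fun n => ?_
    induction n with
    | zero => exact hy
    | succ n ih =>
      rw [Function.iterate_succ_apply']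
      exact derivation_mem_algClosureAdjoin hR hd ih
  · intro h
    obtain ⟨n, hn⟩ := exists_mem_algClosureAdjoin_of_not_algebraicIndependent h
    refine ⟨(fun n => d^[n] y) '' Iio n, (finite_Iio n).image _, ?_, ?_⟩
    · rintro _ ⟨m, hm, rfl⟩
      simp only
      rw [← Function.iterate_succ_apply' d m y]
      rcases Nat.lt_or_ge (m + 1) n with h1 | h1
      · exact subset_algClosureAdjoin ⟨m + 1, h1, rfl⟩
      · have : m + 1 = n := le_antisymm (Nat.succ_le_of_lt hm) h1
        rw [Nat.succ_eq_add_one, this]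
        exact hn
    -- For `n = 0` the set `S` is empty and `y` is itself algebraic over `R`.
    · rcases Nat.eq_zero_or_pos n with h1 | h1
      · subst h1
        exact hn
      · exact subset_algClosureAdjoin ⟨0, h1, rfl⟩

omit [CharZero F] in
theorem exists_common_algClosureAdjoin {s : Set F} (hs : s.Finite)
    (h : ∀ y ∈ s, IsDiffFinite R d y) : ∃ S : Set F, S.Finite ∧
      (∀ s ∈ S, d s ∈ algClosureAdjoin R S) ∧ ∀ y ∈ s, y ∈ algClosureAdjoin R S := by
  induction s, hs using Set.Finite.induction_on with
  | empty => exact ⟨∅, finite_empty, by simp, by simp⟩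
  | @insert a s _ _ ih =>
    obtain ⟨S, hS, hd, hy⟩ := ih fun y hy => h y (mem_insert_of_mem _ hy)
    obtain ⟨T, hT, hd', hy'⟩ := h a (mem_insert _ _)
    refine ⟨S ∪ T, hS.union hT, ?_, ?_⟩
    · rintro x (hx | hx)
      · exact algClosureAdjoin_mono subset_union_left (hd x hx)
      · exact algClosureAdjoin_mono subset_union_right (hd' x hx)
    · rintro x (rfl | hx)
      · exact algClosureAdjoin_mono subset_union_right hy'
      · exact algClosureAdjoin_mono subset_union_left (hy x hx)

variable (R d) in
/-- The differential algebraic closure of `R` in `F`. -/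
def diffClosure : Subring F where
  carrier := {y | IsDiffFinite R d y}
  mul_mem' {a b} ha hb := by
    obtain ⟨S, hS, hd, h⟩ := exists_common_algClosureAdjoin (s := {a, b}) (by simp)
      (by rintro y (rfl | rfl) <;> assumption)
    exact ⟨S, hS, hd, mul_mem (h a (by simp)) (h b (by simp))⟩
  add_mem' {a b} ha hb := by
    obtain ⟨S, hS, hd, h⟩ := exists_common_algClosureAdjoin (s := {a, b}) (by simp)
      (by rintro y (rfl | rfl) <;> assumption)
    exact ⟨S, hS, hd, add_mem (h a (by simp)) (h b (by simp))⟩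
  one_mem' := ⟨∅, finite_empty, by simp, one_mem _⟩
  zero_mem' := ⟨∅, finite_empty, by simp, zero_mem _⟩
  neg_mem' := by
    rintro a ⟨S, hS, hd, h⟩
    exact ⟨S, hS, hd, neg_mem h⟩

omit [CharZero F] in
theorem algebraMap_mem_diffClosure (r : R) : algebraMap R F r ∈ diffClosure R d :=
  ⟨∅, finite_empty, by simp, adjoin_subset_algClosureAdjoin (Subalgebra.algebraMap_mem _ r)⟩

omit [CharZero F] in
theorem inv_mem_diffClosure {y : F} (hy : y ∈ diffClosure R d) : y⁻¹ ∈ diffClosure R d := by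
  obtain ⟨S, hS, hd, h⟩ := hy
  exact ⟨S, hS, hd, inv_mem_algClosureAdjoin h⟩

theorem derivation_mem_diffClosure
    (hR : ∀ r : R, ∃ r', d (algebraMap R F r) = algebraMap R F r') {y : F}
    (hy : y ∈ diffClosure R d) : d y ∈ diffClosure R d := by
  obtain ⟨S, hS, hd, h⟩ := hy
  exact ⟨S, hS, hd, derivation_mem_algClosureAdjoin hR hd h⟩

omit [CharZero F] in
theorem mem_diffClosure_of_isRoot {p : F[X]} (hp : p ≠ 0)
    (hc : ∀ i, p.coeff i ∈ diffClosure R d) {z : F} (hz : p.eval z = 0) :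
    z ∈ diffClosure R d := by
  obtain ⟨S, hS, hd, h⟩ := exists_common_algClosureAdjoin
    (s := p.coeff '' (p.support : Set ℕ)) (p.support.finite_toSet.image _)
    (by rintro _ ⟨i, -, rfl⟩; exact hc i)
  refine ⟨S, hS, hd, mem_algClosureAdjoin_of_isRoot hp (fun i => ?_) hz⟩
  by_cases hi : i ∈ p.support
  · exact h _ ⟨i, hi, rfl⟩
  · rw [notMem_support_iff.1 hi]
    exact zero_mem _

omit [CharZero F] in
-- Adjoining `y` costs at most one in transcendence degree, and `y' = g - f y` introduces nothing
-- further.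
theorem mem_diffClosure_of_linear {f g y : F} (hf : f ∈ diffClosure R d)
    (hg : g ∈ diffClosure R d) (h : d y + f * y = g) : y ∈ diffClosure R d := by
  obtain ⟨S, hS, hd, hfg⟩ := exists_common_algClosureAdjoin (s := {f, g}) (by simp)
    (by rintro y (rfl | rfl) <;> assumption)
  have hy : y ∈ algClosureAdjoin R (insert y S) := subset_algClosureAdjoin (mem_insert _ _)
  refine ⟨insert y S, hS.insert y, ?_, hy⟩
  rintro x (rfl | hx)
  · rw [eq_sub_of_add_eq h]
    exact sub_mem (algClosureAdjoin_mono (subset_insert _ _) (hfg g (by simp)))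
      (mul_mem (algClosureAdjoin_mono (subset_insert _ _) (hfg f (by simp))) hy)
  · exact algClosureAdjoin_mono (subset_insert _ _) (hd x hx)

end DifferentialClosure

/-! ### Real roots of polynomials depending on a parameter -/

section PolynomialFamilies

open Polynomial

variable {P : ℝ → ℝ[X]} {d : ℕ} {t₀ : ℝ}

theorem continuousAt_eval_family (hc : ∀ i, ContinuousAt (fun t => (P t).coeff i) t₀)
    (hd : ∀ᶠ t in 𝓝 t₀, (P t).natDegree = d) (s₀ : ℝ) :
    ContinuousAt (fun z : ℝ × ℝ => (P z.1).eval z.2) (t₀, s₀) := by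
  have h1 : (fun z : ℝ × ℝ => (P z.1).eval z.2) =ᶠ[𝓝 (t₀, s₀)]
      fun z => ∑ i ∈ Finset.range (d + 1), (P z.1).coeff i * z.2 ^ i := by
    have : ∀ᶠ z : ℝ × ℝ in 𝓝 (t₀, s₀), (P z.1).natDegree = d :=
      (continuous_fst.tendsto (t₀, s₀)).eventually hd
    filter_upwards [this] with z hz
    rw [eval_eq_sum_range, hz]
  refine ContinuousAt.congr ?_ h1.symm
  refine tendsto_finsetSum _ fun i _ => ?_
  have h2 : ContinuousAt (fun z : ℝ × ℝ => (P z.1).coeff i) (t₀, s₀) :=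
    ContinuousAt.comp (f := Prod.fst) (g := fun t => (P t).coeff i) (hc i) continuousAt_fst
  exact h2.mul (continuousAt_snd.pow i)

theorem continuousAt_eval_family_left (hc : ∀ i, ContinuousAt (fun t => (P t).coeff i) t₀)
    (hd : ∀ᶠ t in 𝓝 t₀, (P t).natDegree = d) (s : ℝ) :
    ContinuousAt (fun t => (P t).eval s) t₀ :=
  ContinuousAt.comp (f := fun t => (t, s)) (g := fun z : ℝ × ℝ => (P z.1).eval z.2)
    (continuousAt_eval_family hc hd s) (by fun_prop)

/-- A Cauchy type root bound: when `|s| > 1`, divide the equation by the power of `|s|` one below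
the degree. It confines the roots of nearby polynomials to a common compact interval. -/
theorem abs_le_of_monic_of_eval_eq_zero {p : ℝ[X]} (hp : p.Monic) {s : ℝ} (hs : p.eval s = 0) :
    |s| ≤ 1 + ∑ i ∈ Finset.range p.natDegree, |p.coeff i| := by
  have hnn : 0 ≤ ∑ i ∈ Finset.range p.natDegree, |p.coeff i| :=
    Finset.sum_nonneg fun i _ => abs_nonneg _
  rcases le_or_gt |s| 1 with h1 | h1
  · linarith
  have hpos : 0 < p.natDegree := by
    by_contra h0
    rw [hp.natDegree_eq_zero.1 (Nat.le_zero.1 (not_lt.1 h0)), eval_one] at hs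
    exact one_ne_zero hs
  obtain ⟨n, hn⟩ : ∃ n, p.natDegree = n + 1 := ⟨p.natDegree - 1, by lia⟩
  have h2 : s ^ p.natDegree = -∑ i ∈ Finset.range p.natDegree, p.coeff i * s ^ i := by
    rw [eval_eq_sum_range, Finset.sum_range_succ, hp.coeff_natDegree] at hs
    linarith
  have h3 : |s| ^ n * |s| ≤ |s| ^ n * ∑ i ∈ Finset.range p.natDegree, |p.coeff i| := by
    calc |s| ^ n * |s| = |s ^ p.natDegree| := by rw [abs_pow, hn, pow_succ]
      _ ≤ ∑ i ∈ Finset.range p.natDegree, |p.coeff i * s ^ i| := by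
          rw [h2, abs_neg]
          exact Finset.abs_sum_le_sum_abs _ _
      _ ≤ ∑ i ∈ Finset.range p.natDegree, |s| ^ n * |p.coeff i| := by
          refine Finset.sum_le_sum fun i hi => ?_
          rw [abs_mul, abs_pow, mul_comm]
          have : |s| ^ i ≤ |s| ^ n := pow_le_pow_right₀ h1.le (by
            have := Finset.mem_range.1 hi
            lia)
          gcongr
      _ = _ := (Finset.mul_sum _ _ _).symm
  have h4 := le_of_mul_le_mul_left h3 (by positivity)
  linarith

/-- Absence of roots in a closed set is an open condition on a family of monic polynomials. -/
theorem eventually_forall_eval_ne_zero (hc : ∀ i, ContinuousAt (fun t => (P t).coeff i) t₀)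
    (hd : ∀ᶠ t in 𝓝 t₀, (P t).natDegree = d) (hm : ∀ᶠ t in 𝓝 t₀, (P t).Monic) {T : Set ℝ}
    (hT : IsClosed T) (h : ∀ s ∈ T, (P t₀).eval s ≠ 0) :
    ∀ᶠ t in 𝓝 t₀, ∀ s ∈ T, (P t).eval s ≠ 0 := by
  have hB : ContinuousAt (fun t => 1 + ∑ i ∈ Finset.range d, |(P t).coeff i|) t₀ :=
    continuousAt_const.add (tendsto_finsetSum _ fun i _ => (hc i).abs)
  -- The extra 1 leaves room for the root bound to vary near `t₀`, so only the compact part of `T`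
  -- matters.
  set b := 1 + ∑ i ∈ Finset.range d, |(P t₀).coeff i| + 1 with hb
  have hB' : ∀ᶠ t in 𝓝 t₀, 1 + ∑ i ∈ Finset.range d, |(P t).coeff i| < b :=
    hB.eventually_lt continuousAt_const (by rw [hb]; linarith)
  have hcomp : IsCompact (T ∩ Icc (-b) b) := isCompact_Icc.inter_left hT
  have h1 : ∀ᶠ t in 𝓝 t₀, ∀ s ∈ T ∩ Icc (-b) b, (P t).eval s ≠ 0 := by
    refine hcomp.eventually_forall_of_forall_eventually fun s hs => ?_
    exact (continuousAt_eval_family hc hd s).eventually_ne (h s hs.1)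
  filter_upwards [h1, hB', hd, hm] with t h1 h2 h3 h4 s hs h0
  have h5 := abs_le_of_monic_of_eval_eq_zero h4 h0
  rw [h3] at h5
  exact h1 s ⟨hs, abs_le.1 (h5.trans h2.le)⟩ h0

/-- A simple root persists under small perturbations. -/
theorem eventually_exists_eval_eq_zero (hc : ∀ i, ContinuousAt (fun t => (P t).coeff i) t₀)
    (hd : ∀ᶠ t in 𝓝 t₀, (P t).natDegree = d) {s₀ : ℝ} (h0 : (P t₀).eval s₀ = 0)
    (h1 : (P t₀).derivative.eval s₀ ≠ 0) {ε : ℝ} (hε : 0 < ε) :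
    ∀ᶠ t in 𝓝 t₀, ∃ s ∈ Ioo (s₀ - ε) (s₀ + ε), (P t).eval s = 0 := by
  set c := (P t₀).derivative.eval s₀ with hcdef
  have hslope := hasDerivAt_iff_tendsto_slope.1 ((P t₀).hasDerivAt s₀)
  -- Multiplying by the derivative value `c` makes the sign change at the simple root always from
  -- negative to positive.
  have hpos : ∀ᶠ s in 𝓝[≠] s₀, 0 < slope (fun x => (P t₀).eval x) s₀ s * c :=
    (hslope.mul_const c).eventually (eventually_gt_nhds (mul_self_pos.2 h1))
  have hval : ∀ s, s ≠ s₀ → (P t₀).eval s * c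
      = (s - s₀) * (slope (fun x => (P t₀).eval x) s₀ s * c) := by
    intro s hs
    rw [slope_def_field, h0]
    have : s - s₀ ≠ 0 := sub_ne_zero.2 hs
    field_simp
    ring
  have hleft : ∀ᶠ s in 𝓝[<] s₀, (P t₀).eval s * c < 0 := by
    filter_upwards [hpos.filter_mono (nhdsWithin_mono _ fun x hx => ne_of_lt hx),
      self_mem_nhdsWithin] with s h2 h3
    rw [hval s (ne_of_lt h3)]
    exact mul_neg_of_neg_of_pos (sub_neg.2 h3) h2
  have hright : ∀ᶠ s in 𝓝[>] s₀, 0 < (P t₀).eval s * c := by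
    filter_upwards [hpos.filter_mono (nhdsWithin_mono _ fun x hx => ne_of_gt hx),
      self_mem_nhdsWithin] with s h2 h3
    rw [hval s (ne_of_gt h3)]
    exact mul_pos (sub_pos.2 h3) h2
  obtain ⟨s₁, hs₁, hs₁'⟩ := (hleft.and (Ioo_mem_nhdsLT (sub_lt_self s₀ hε))).exists
  obtain ⟨s₂, hs₂, hs₂'⟩ := (hright.and (Ioo_mem_nhdsGT (lt_add_of_pos_right s₀ hε))).exists
  have e1 : ∀ᶠ t in 𝓝 t₀, (P t).eval s₁ * c < 0 :=
    ((continuousAt_eval_family_left hc hd s₁).mul continuousAt_const).eventually_lt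
      continuousAt_const hs₁
  have e2 : ∀ᶠ t in 𝓝 t₀, 0 < (P t).eval s₂ * c :=
    continuousAt_const.eventually_lt
      ((continuousAt_eval_family_left hc hd s₂).mul continuousAt_const) hs₂
  filter_upwards [e1, e2] with t h2 h3
  have hle : s₁ ≤ s₂ := (hs₁'.2.trans hs₂'.1).le
  obtain ⟨s, hs, hs0⟩ := intermediate_value_Ioo hle
    (f := fun s => (P t).eval s * c) (by fun_prop) ⟨h2, h3⟩
  refine ⟨s, ⟨hs₁'.1.trans hs.1, hs.2.trans hs₂'.2⟩, ?_⟩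
  exact (mul_eq_zero.1 hs0).resolve_right h1

/-- In a family of monic real polynomials with simple real roots, either no member has a real root
or a continuous root function exists. -/
theorem forall_eval_ne_zero_or_exists_root {a : ℝ}
    (hc : ∀ t > a, ∀ i, ContinuousAt (fun t => (P t).coeff i) t)
    (hd : ∀ t > a, (P t).natDegree = d) (hm : ∀ t > a, (P t).Monic)
    (hs : ∀ t > a, ∀ s, (P t).eval s = 0 → (P t).derivative.eval s ≠ 0) :
    (∀ t > a, ∀ s, (P t).eval s ≠ 0) ∨
      ∃ y : ℝ → ℝ, ∀ t > a, ContinuousAt y t ∧ (P t).eval (y t) = 0 := by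
  have hd' : ∀ t > a, ∀ᶠ t in 𝓝 t, (P t).natDegree = d := fun t ht => by
    filter_upwards [Ioi_mem_nhds ht] with t ht using hd t ht
  have hm' : ∀ t > a, ∀ᶠ t in 𝓝 t, (P t).Monic := fun t ht => by
    filter_upwards [Ioi_mem_nhds ht] with t ht using hm t ht
  -- Having a real root and having none are both open conditions, so connectedness of the half-line
  -- selects one of them.
  set U : Set ℝ := {t | a < t ∧ ∃ s, (P t).eval s = 0}
  set V : Set ℝ := {t | a < t ∧ ∀ s, (P t).eval s ≠ 0}
  have hU : IsOpen U := by
    rw [isOpen_iff_mem_nhds]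
    rintro t ⟨ht, s, h0⟩
    filter_upwards [Ioi_mem_nhds ht,
      eventually_exists_eval_eq_zero (hc t ht) (hd' t ht) h0 (hs t ht s h0) one_pos] with r h1 h2
    obtain ⟨s', -, hs'⟩ := h2
    exact ⟨h1, s', hs'⟩
  have hV : IsOpen V := by
    rw [isOpen_iff_mem_nhds]
    rintro t ⟨ht, h0⟩
    filter_upwards [Ioi_mem_nhds ht, eventually_forall_eval_ne_zero (hc t ht) (hd' t ht)
      (hm' t ht) isClosed_univ fun s _ => h0 s] with r h1 h2
    exact ⟨h1, fun s => h2 s (mem_univ s)⟩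
  have hcover : Ioi a ⊆ U ∪ V := by
    intro t ht
    by_cases h : ∃ s, (P t).eval s = 0
    · exact Or.inl ⟨ht, h⟩
    · exact Or.inr ⟨ht, not_exists.1 h⟩
  have hdisj : Ioi a ∩ (U ∩ V) = ∅ := by
    refine eq_empty_of_forall_notMem ?_
    rintro t ⟨-, ⟨-, s, hs⟩, -, h⟩
    exact h s hs
  rcases isPreconnected_iff_subset_of_disjoint.1 isPreconnected_Ioi U V hU hV hcover hdisj
    with h | h
  · right
    -- The least root is continuous: it persists as a nearby root, and no root can appear at or
    -- below `y t - ε`.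
    have hmin : ∀ t, ∃ y, a < t → (P t).eval y = 0 ∧ ∀ s, (P t).eval s = 0 → y ≤ s := by
      intro t
      by_cases ht : a < t
      · have hfin : {s | (P t).eval s = 0}.Finite := by
          refine (P t).roots.toFinset.finite_toSet.subset fun s h0 => ?_
          simp only [Finset.mem_coe, Multiset.mem_toFinset]
          exact (mem_roots (hm t ht).ne_zero).2 h0
        obtain ⟨y, hy, hy'⟩ := exists_min_image _ id hfin (h ht).2
        exact ⟨y, fun _ => ⟨hy, hy'⟩⟩
      · exact ⟨0, fun h => absurd h ht⟩
    choose y hy using hmin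
    refine ⟨y, fun t ht => ⟨?_, (hy t ht).1⟩⟩
    rw [Metric.continuousAt_iff']
    intro ε hε
    have h0 := (hy t ht).1
    have e1 := eventually_exists_eval_eq_zero (hc t ht) (hd' t ht) h0 (hs t ht _ h0) hε
    have e2 := eventually_forall_eval_ne_zero (hc t ht) (hd' t ht) (hm' t ht)
      (isClosed_Iic (a := y t - ε)) fun s hs h1 => by
        have h2 := (hy t ht).2 s h1
        have h3 : s ≤ y t - ε := hs
        linarith
    filter_upwards [e1, e2, Ioi_mem_nhds ht] with r h1 h2 h3
    obtain ⟨s, hs, hs0⟩ := h1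
    rw [Real.dist_eq, abs_sub_lt_iff]
    have h4 := (hy r h3).2 s hs0
    have h5 : ¬ y r ≤ y t - ε := fun h6 => h2 _ h6 (hy r h3).1
    constructor <;> linarith [hs.2]
  · exact Or.inl fun t ht => (h ht).2

/-- Since `f t₀ = 0`, the slope of the product is the slope of `f` times `g t`; continuity of `g`
suffices. -/
theorem hasDerivAt_mul_of_eq_zero {f g : ℝ → ℝ} {f' : ℝ} (hf : HasDerivAt f f' t₀)
    (h0 : f t₀ = 0) (hg : ContinuousAt g t₀) :
    HasDerivAt (fun t => f t * g t) (f' * g t₀) t₀ := by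
  rw [hasDerivAt_iff_tendsto_slope] at hf ⊢
  have := hf.mul (hg.tendsto.mono_left (nhdsWithin_le_nhds (s := {t₀}ᶜ)))
  refine this.congr fun t => ?_
  rw [slope_def_field, slope_def_field, h0]
  ring

/-- A continuous root function is differentiable at simple roots. -/
theorem differentiableAt_root (hc : ∀ i, DifferentiableAt ℝ (fun t => (P t).coeff i) t₀)
    (hd : ∀ᶠ t in 𝓝 t₀, (P t).natDegree = d) {y : ℝ → ℝ} (hy : ContinuousAt y t₀)
    (h0 : ∀ᶠ t in 𝓝 t₀, (P t).eval (y t) = 0) (h1 : (P t₀).derivative.eval (y t₀) ≠ 0) :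
    DifferentiableAt ℝ y t₀ := by
  -- `Q t` is the divided difference of `P t` between `y t` and `y t₀`. It is continuous, equals the
  -- derivative of `P t₀` at `y t₀` when `t = t₀`, and gives `y t = y t₀ - (P t)(y t₀) / Q t`.
  set Q : ℝ → ℝ := fun t => ∑ i ∈ Finset.range (d + 1), (P t).coeff i *
    ∑ j ∈ Finset.range i, y t ^ j * y t₀ ^ (i - 1 - j) with hQ
  have hQc : ContinuousAt Q t₀ := by
    refine tendsto_finsetSum _ fun i _ => (hc i).continuousAt.mul ?_
    exact tendsto_finsetSum _ fun j _ => (hy.pow j).mul continuousAt_const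
  have hQ0 : Q t₀ = (P t₀).derivative.eval (y t₀) := by
    rw [derivative_eval, sum_over_range' _ (by simp) (d + 1)
      (by rw [hd.self_of_nhds]; exact Nat.lt_succ_self d)]
    refine Finset.sum_congr rfl fun i _ => ?_
    rw [mul_assoc]
    congr 1
    rw [Finset.sum_congr rfl (g := fun _ => y t₀ ^ (i - 1)), Finset.sum_const, Finset.card_range,
      nsmul_eq_mul]
    intro j hj
    rw [← pow_add]
    congr 1
    have := Finset.mem_range.1 hj
    lia
  have hQne : ∀ᶠ t in 𝓝 t₀, Q t ≠ 0 := hQc.eventually_ne (hQ0 ▸ h1)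
  have hN : DifferentiableAt ℝ (fun t => (P t).eval (y t₀)) t₀ := by
    have : (fun t => (P t).eval (y t₀)) =ᶠ[𝓝 t₀]
        fun t => ∑ i ∈ Finset.range (d + 1), (P t).coeff i * y t₀ ^ i := by
      filter_upwards [hd] with t ht
      rw [eval_eq_sum_range, ht]
    rw [this.differentiableAt_iff]
    exact DifferentiableAt.fun_sum fun i _ => (hc i).mul_const _
  have key : y =ᶠ[𝓝 t₀] fun t => y t₀ - (P t).eval (y t₀) * (Q t)⁻¹ := by
    filter_upwards [h0, hd, hQne] with t h2 h3 h4
    have h5 : (P t).eval (y t) - (P t).eval (y t₀) = Q t * (y t - y t₀) := by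
      rw [eval_eq_sum_range, eval_eq_sum_range, h3, hQ, Finset.sum_mul, ← Finset.sum_sub_distrib]
      refine Finset.sum_congr rfl fun i _ => ?_
      rw [mul_assoc, (Commute.all _ _).geom_sum₂_mul]
      ring
    rw [h2] at h5
    field_simp
    linarith
  rw [key.differentiableAt_iff]
  refine DifferentiableAt.sub (differentiableAt_const _) ?_
  exact (hasDerivAt_mul_of_eq_zero hN.hasDerivAt h0.self_of_nhds
    (hQc.inv₀ (hQ0 ▸ h1))).differentiableAt

end PolynomialFamilies

/-! ### Polynomials over a Hardy field and the extension criterion -/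

namespace RealGerm

open Polynomial

/-- The coefficientwise map sending a germ of functions to a germ of constant polynomials. -/
noncomputable def constPolyHom : RealGerm →+* Germ (atTop : Filter ℝ) ℝ[X] where
  toFun f := f.map C
  map_one' := congrArg (Germ.ofFun (l := atTop)) (funext fun _ : ℝ => C_1)
  map_zero' := congrArg (Germ.ofFun (l := atTop)) (funext fun _ : ℝ => C_0)
  map_add' f g := Germ.inductionOn₂ f g fun _ _ =>
    congrArg (Germ.ofFun (l := atTop)) (funext fun _ => C_add)
  map_mul' f g := Germ.inductionOn₂ f g fun _ _ =>
    congrArg (Germ.ofFun (l := atTop)) (funext fun _ => C_mul)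

/-- The ring homomorphism from polynomials over a ring of germs to germs of functions with
polynomial values. -/
noncomputable def polyGermHom (M : Subring RealGerm) : M[X] →+* Germ (atTop : Filter ℝ) ℝ[X] :=
  eval₂RingHom (constPolyHom.comp M.subtype) ((fun _ : ℝ => (Polynomial.X : ℝ[X])) : ℝ → ℝ[X])

theorem polyGermHom_monomial {M : Subring RealGerm} (n : ℕ) (a : M) {φ : ℝ → ℝ}
    (h : (φ : RealGerm) = a) :
    polyGermHom M (monomial n a) = ((fun t => monomial n (φ t)) : ℝ → ℝ[X]) := by
  rw [polyGermHom, coe_eval₂RingHom, eval₂_monomial]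
  have h1 : (constPolyHom.comp M.subtype) a = ((fun t => C (φ t) : ℝ → ℝ[X]) :
      Germ (atTop : Filter ℝ) ℝ[X]) := by
    rw [RingHom.comp_apply, Subring.subtype_apply, ← h]
    rfl
  rw [h1, ← Germ.coe_pow, ← Germ.coe_mul]
  congr 1
  ext1 t
  exact C_mul_X_pow_eq_monomial

theorem polyGermHom_derivative {M : Subring RealGerm} (p : M[X]) :
    polyGermHom M (Polynomial.derivative p) = (polyGermHom M p).map fun q => Polynomial.derivative q := by
  induction p using Polynomial.induction_on' with
  | add p q hp hq =>
    rw [map_add, map_add, map_add, hp, hq]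
    refine Germ.inductionOn₂ (polyGermHom M p) (polyGermHom M q) fun φ ψ => ?_
    exact congrArg (Germ.ofFun (l := atTop)) (funext fun _ => (Polynomial.derivative_add ..).symm)
  | monomial n a =>
    obtain ⟨φ, hφ⟩ := exists_coe (a : RealGerm)
    rw [Polynomial.derivative_monomial, polyGermHom_monomial n a hφ,
      polyGermHom_monomial (φ := φ * fun _ => (n : ℝ)) (n - 1) (a * (n : M)) (by
        rw [Germ.coe_mul, hφ]
        rfl)]
    exact congrArg (Germ.ofFun (l := atTop)) (funext fun t => (derivative_monomial ..).symm)

theorem derivative_const (c : ℝ) : derivative ((fun _ => c : ℝ → ℝ) : RealGerm) = 0 :=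
  coe_eq_iff.2 (Eventually.of_forall fun t => deriv_const t c)

theorem derivative_zero : derivative 0 = 0 := derivative_const 0

theorem derivative_one : derivative 1 = 0 := derivative_const 1

theorem coe_sum {ι : Type*} (s : Finset ι) (φ : ι → ℝ → ℝ) :
    ((fun t => ∑ i ∈ s, φ i t : ℝ → ℝ) : RealGerm) = ∑ i ∈ s, (φ i : RealGerm) := by
  have := map_sum (Germ.coeRingHom (R := ℝ) (atTop : Filter ℝ)) φ s
  simp only [Germ.coe_coeRingHom] at this
  refine Eq.trans ?_ this
  congr 1
  ext t
  simp

/-- A polynomial over a ring of germs is represented by a family of real polynomials. -/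
theorem exists_family {M : Subring RealGerm} (p : M[X]) : ∃ P : ℝ → ℝ[X],
    polyGermHom M p = P ∧ (∀ t, (P t).natDegree ≤ p.natDegree) ∧
    (∀ i, ((fun t => (P t).coeff i : ℝ → ℝ) : RealGerm) = p.coeff i) ∧
    ∀ φ : ℝ → ℝ, aeval (φ : RealGerm) p = (fun t => (P t).eval (φ t) : ℝ → ℝ) := by
  choose c hc using fun i => exists_coe (p.coeff i : RealGerm)
  refine ⟨fun t => ∑ i ∈ Finset.range (p.natDegree + 1), monomial i (c i t), ?_, ?_, ?_, ?_⟩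
  · conv_lhs => rw [p.as_sum_range, map_sum]
    rw [Finset.sum_congr rfl fun i _ => polyGermHom_monomial i (p.coeff i) (hc i)]
    have := map_sum (Germ.coeRingHom (R := ℝ[X]) (atTop : Filter ℝ))
      (fun i t => monomial i (c i t)) (Finset.range (p.natDegree + 1))
    simp only [Germ.coe_coeRingHom] at this
    refine this.symm.trans ?_
    congr 1
    ext1 t
    simp
  · intro t
    refine natDegree_sum_le_of_forall_le _ _ fun i hi => ?_
    exact (natDegree_monomial_le _).trans (Nat.lt_succ_iff.1 (Finset.mem_range.1 hi))
  · intro i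
    by_cases hi : i ≤ p.natDegree
    · rw [← hc i]
      congr 1
      ext t
      simp [coeff_monomial, Nat.lt_succ_iff.2 hi]
    · rw [coeff_eq_zero_of_natDegree_lt (not_le.1 hi)]
      change _ = ((0 : ℝ → ℝ) : RealGerm)
      congr 1
      ext t
      have : ¬ i < p.natDegree + 1 := fun h => hi (Nat.lt_succ_iff.1 h)
      simp [coeff_monomial, this]
  · intro φ
    rw [aeval_eq_sum_range]
    simp only [eval_finsetSum, eval_monomial]
    rw [coe_sum]
    refine Finset.sum_congr rfl fun i _ => ?_
    rw [Algebra.smul_def]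
    change (p.coeff i : RealGerm) * _ = _
    rw [← hc i]
    rfl

theorem IsCn.aeval {M : Subring RealGerm} {n : ℕ} (hM : ∀ a ∈ M, IsCn n a) {y : RealGerm}
    (hy : IsCn n y) (p : M[X]) : IsCn n (aeval y p) := by
  have hpow : ∀ k, IsCn n (y ^ k) := by
    intro k
    induction k with
    | zero =>
      rw [pow_zero]
      exact hM 1 M.one_mem
    | succ k ih =>
      rw [pow_succ]
      exact ih.mul hy
  induction p using Polynomial.induction_on' with
  | add p q hp hq =>
    rw [map_add]
    exact hp.add hq
  | monomial k a =>
    rw [aeval_monomial]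
    exact (hM a a.2).mul (hpow k)

namespace IsHardyField

variable {M : Subring RealGerm} (hM : IsHardyField M)
include hM

theorem evDiff_pow {y : RealGerm} (hy : EvDiff y) (n : ℕ) : EvDiff (y ^ n) := by
  induction n with
  | zero =>
    rw [pow_zero]
    exact hM.evDiff M.one_mem
  | succ n ih =>
    rw [pow_succ]
    exact ih.mul hy

theorem evDiff_aeval {y : RealGerm} (hy : EvDiff y) (p : M[X]) : EvDiff (aeval y p) := by
  induction p using Polynomial.induction_on' with
  | add p q hp hq =>
    rw [map_add]
    exact hp.add hq
  | monomial k a =>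
    rw [aeval_monomial]
    exact (hM.evDiff a.2).mul (hM.evDiff_pow hy k)

theorem derivative_pow {y : RealGerm} (hy : EvDiff y) (n : ℕ) :
    derivative (y ^ n) = n * y ^ (n - 1) * derivative y := by
  induction n with
  | zero =>
    rw [pow_zero, derivative_one]
    simp
  | succ n ih =>
    rw [pow_succ, derivative_mul (hM.evDiff_pow hy n) hy, ih]
    rcases n with _ | n
    · simp
    · simp only [Nat.add_sub_cancel, Nat.cast_add, Nat.cast_one]
      ring

/-- The chain rule for polynomials over a Hardy field. -/
theorem derivative_aeval {y : RealGerm} (hy : EvDiff y) (p : M[X]) : ∃ q : M[X],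
    (∀ i, q.coeff i = hM.derivation (p.coeff i)) ∧
    RealGerm.derivative (aeval y p) = aeval y q + aeval y (Polynomial.derivative p) * RealGerm.derivative y := by
  induction p using Polynomial.induction_on' with
  | add p q hp hq =>
    obtain ⟨v, hv, hv'⟩ := hp
    obtain ⟨w, hw, hw'⟩ := hq
    refine ⟨v + w, fun i => by rw [coeff_add, coeff_add, map_add, hv, hw], ?_⟩
    rw [map_add, derivative_add (hM.evDiff_aeval hy p) (hM.evDiff_aeval hy q), hv', hw', map_add,
      map_add, map_add]
    ring
  | monomial n a =>
    refine ⟨monomial n (hM.derivation a), fun i => ?_, ?_⟩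
    · rw [coeff_monomial, coeff_monomial]
      split_ifs
      · rfl
      · rw [map_zero]
    · have hval : algebraMap M RealGerm a = a := rfl
      rw [aeval_monomial, hval, derivative_mul (hM.evDiff a.2) (hM.evDiff_pow hy n),
        hM.derivative_pow hy, derivative_monomial, aeval_monomial, aeval_monomial, map_mul,
        map_natCast]
      change _ = RealGerm.derivative a * y ^ n + (a : RealGerm) * _ * _ * _
      ring

/-- Extension criterion for Hardy fields. -/
theorem exists_extension {y : RealGerm} (hy : EvDiff y) (hd : ∃ p : M[X], aeval y p = derivative y)
    (hu : ∀ p : M[X], aeval y p ≠ 0 → IsUnit (aeval y p)) :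
    ∃ N, IsHardyField N ∧ M ≤ N ∧ y ∈ N := by
  -- The extension is the ring of quotients of `M[y]`.
  set R : Subring RealGerm := (aeval y : M[X] →ₐ[M] RealGerm).range.toSubring with hR
  have hmem : ∀ {z}, z ∈ R ↔ ∃ p : M[X], aeval y p = z := Iff.rfl
  -- Bootstrapping: `y'` is a polynomial in `y`, so it is as smooth as `y`, which gains `y` one
  -- order.
  have hCn : ∀ n, IsCn n y := by
    intro n
    induction n with
    | zero => exact hy.isCn_zero
    | succ n ih =>
      obtain ⟨p, hp⟩ := hd
      rw [isCn_succ, ← hp]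
      exact ⟨hy, ih.aeval (fun a ha => hM.isCn a ha n) p⟩
  refine ⟨quotientSubring R, isHardyField_quotientSubring ?_ ?_ ?_, ?_, ?_⟩
  · rintro _ ⟨p, rfl⟩ h0
    exact hu p h0
  · rintro _ ⟨p, rfl⟩ n
    exact (hCn n).aeval (fun a ha => hM.isCn a ha n) p
  · rintro _ ⟨p, rfl⟩
    obtain ⟨q, -, hq⟩ := hM.derivative_aeval hy p
    obtain ⟨r, hr⟩ := hd
    refine ⟨q + Polynomial.derivative p * r, ?_⟩
    change aeval y _ = RealGerm.derivative (aeval y p)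
    rw [hq, ← hr, map_add, map_mul]
  · refine le_trans (fun a ha => ?_) (le_quotientSubring R)
    exact ⟨C ⟨a, ha⟩, aeval_C ..⟩
  · exact le_quotientSubring R ⟨Polynomial.X, aeval_X y⟩

theorem exists_aeval_mul_eq_one_of_irreducible {p q : M[X]} (hp : Irreducible p) (hpq : ¬ p ∣ q)
    {y : RealGerm} (h0 : aeval y p = 0) : ∃ b : M[X], aeval y b * aeval y q = 1 := by
  let _ := hM.field
  obtain ⟨a, b, hab⟩ := hp.coprime_iff_not_dvd.2 hpq
  refine ⟨b, ?_⟩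
  have := congrArg (aeval y) hab
  rwa [map_add, map_mul, map_mul, h0, mul_zero, zero_add, map_one] at this

omit hM in
theorem charZero (M : Subring RealGerm) : CharZero M :=
  ⟨fun m n h => by
    have h1 : ((m : M) : RealGerm) = ((n : M) : RealGerm) := congrArg _ h
    have h2 : ((fun _ => (m : ℝ) : ℝ → ℝ) : RealGerm) = (fun _ => (n : ℝ) : ℝ → ℝ) := by
      simpa using h1
    obtain ⟨t, ht⟩ := (coe_eq_iff.1 h2).exists
    exact Nat.cast_injective ht⟩

theorem separable_of_irreducible {p : M[X]} (hp : Irreducible p) : p.Separable := by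
  let _ := hM.field
  have := charZero M
  exact hp.separable

theorem exists_aeval_mul_derivative_eq_one {p : M[X]} (hp : Irreducible p)
    {y : RealGerm} (h0 : aeval y p = 0) : ∃ b : M[X], aeval y b * aeval y (Polynomial.derivative p) = 1 := by
  obtain ⟨a, b, hab⟩ := hM.separable_of_irreducible hp
  refine ⟨b, ?_⟩
  have := congrArg (aeval y) hab
  rwa [map_add, map_mul, map_mul, h0, mul_zero, zero_add, map_one] at this

end IsHardyField

/-! ### Maximal Hardy fields: algebraic roots and linear differential equations -/

theorem mem_of_maximal {M : Subring RealGerm} (hM : Maximal IsHardyField M) {y : RealGerm}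
    (h : ∃ N, IsHardyField N ∧ M ≤ N ∧ y ∈ N) : y ∈ M := by
  obtain ⟨N, hN, hMN, hy⟩ := h
  exact hM.2 hN hMN hy

/-- Differentiable roots of irreducible polynomials lie in a maximal Hardy field. -/
theorem mem_of_isRoot_of_maximal {M : Subring RealGerm} (hM : Maximal IsHardyField M) {p : M[X]}
    (hp : Irreducible p) {y : RealGerm} (hy : EvDiff y) (h0 : aeval y p = 0) : y ∈ M := by
  refine mem_of_maximal hM (hM.1.exists_extension hy ?_ ?_)
  · obtain ⟨q, -, hq⟩ := hM.1.derivative_aeval hy p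
    obtain ⟨b, hb⟩ := hM.1.exists_aeval_mul_derivative_eq_one hp h0
    rw [h0] at hq
    rw [derivative_zero] at hq
    -- Differentiating `p(y) = 0` gives `q(y) + p'(y) y' = 0`, and `b(y)` is the inverse of `p'(y)`.
    refine ⟨-(b * q), ?_⟩
    rw [map_neg, map_mul]
    linear_combination aeval y b * hq + derivative y * hb
  · intro q hq
    by_cases hpq : p ∣ q
    · obtain ⟨r, rfl⟩ := hpq
      rw [map_mul, h0, zero_mul] at hq
      exact absurd rfl hq
    · obtain ⟨b, hb⟩ := hM.1.exists_aeval_mul_eq_one_of_irreducible hp hpq h0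
      exact IsUnit.of_mul_eq_one_right _ hb

/-- Irreducibility makes the real roots simple at all large `t`. Then either there are none, and
`p(y)` is a unit for every germ `y`, or a continuous root function exists, which is differentiable
and hence in `M`. -/
theorem eventually_eval_ne_zero_or_exists_root {M : Subring RealGerm}
    (hM : Maximal IsHardyField M) {p : M[X]} (hp : Irreducible p) (hm : p.Monic) :
    (∀ y : RealGerm, IsUnit (aeval y p)) ∨ ∃ y ∈ M, aeval y p = 0 := by
  obtain ⟨P, hP, hdeg, hcoeff, hev⟩ := exists_family p
  set d := p.natDegree with hd
  have hcd : ∀ i, ∀ᶠ t in atTop, DifferentiableAt ℝ (fun t => (P t).coeff i) t := fun i =>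
    hM.1.eventually_differentiableAt (by rw [hcoeff i]; exact (p.coeff i).2)
  have hcd' : ∀ᶠ t in atTop, ∀ i ∈ Finset.range (d + 1),
      DifferentiableAt ℝ (fun t => (P t).coeff i) t :=
    (eventually_all_finset _).2 fun i _ => hcd i
  have hlead : ∀ᶠ t in atTop, (P t).coeff d = 1 := by
    refine coe_eq_iff.1 ((hcoeff d).trans ?_)
    rw [hd, hm.coeff_natDegree]
    rfl
  have hsep : ∀ᶠ t in atTop, ∀ s, (P t).eval s = 0 → (P t).derivative.eval s ≠ 0 := by
    obtain ⟨a, b, hab⟩ := hM.1.separable_of_irreducible hp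
    obtain ⟨A, hA, -⟩ := exists_family a
    obtain ⟨B, hB, -⟩ := exists_family b
    -- The Bézout identity `a p + b p' = 1` over `M` becomes one between real polynomials at each
    -- large `t`, excluding multiple roots.
    have h1 := congrArg (polyGermHom M) hab
    rw [map_add, map_mul, map_mul, polyGermHom_derivative, hP, hA, hB, map_one] at h1
    have h2 : ∀ᶠ t in atTop, A t * P t + B t * Polynomial.derivative (P t) = 1 := Germ.coe_eq.1 h1
    filter_upwards [h2] with t ht s hs hs'
    have := congrArg (eval s) ht
    rw [eval_add, eval_mul, eval_mul, hs, hs', eval_one] at this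
    simp at this
  obtain ⟨a, ha⟩ := eventually_atTop.1 (hcd'.and (hlead.and hsep))
  have hdiff : ∀ t > a, ∀ i, DifferentiableAt ℝ (fun t => (P t).coeff i) t := by
    intro t ht i
    by_cases hi : i < d + 1
    · exact (ha t ht.le).1 i (Finset.mem_range.2 hi)
    · have : (fun t => (P t).coeff i) = fun _ => 0 := by
        ext t
        exact coeff_eq_zero_of_natDegree_lt (lt_of_le_of_lt (hdeg t) (by lia))
      rw [this]
      exact differentiableAt_const _
  have hdeg' : ∀ t > a, (P t).natDegree = d := fun t ht =>
    le_antisymm (hdeg t) (le_natDegree_of_ne_zero (by rw [(ha t ht.le).2.1]; exact one_ne_zero))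
  have hmon : ∀ t > a, (P t).Monic := fun t ht => by
    rw [Monic, leadingCoeff, hdeg' t ht, (ha t ht.le).2.1]
  rcases forall_eval_ne_zero_or_exists_root (fun t ht i => (hdiff t ht i).continuousAt) hdeg' hmon
    (fun t ht => (ha t ht.le).2.2) with h | ⟨y, hy⟩
  · left
    intro y
    obtain ⟨φ, rfl⟩ := exists_coe y
    rw [hev φ, isUnit_coe]
    filter_upwards [eventually_gt_atTop a] with t ht using h t ht _
  · right
    have h0 : aeval (y : RealGerm) p = 0 := by
      rw [hev, coe_eq_zero_iff]
      filter_upwards [eventually_gt_atTop a] with t ht using (hy t ht).2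
    refine ⟨y, mem_of_isRoot_of_maximal hM hp (evDiff_coe.2 ?_) h0, h0⟩
    filter_upwards [eventually_gt_atTop a] with t ht
    refine differentiableAt_root (d := d) (hdiff t ht) ?_ (hy t ht).1 ?_
      ((ha t ht.le).2.2 _ (hy t ht).2)
    · filter_upwards [Ioi_mem_nhds ht] with s hs using hdeg' s hs
    · filter_upwards [Ioi_mem_nhds ht] with s hs using (hy s hs).2

/-- A continuous function on a half-line has an antiderivative near `+∞`. -/
theorem exists_antiderivative {f : ℝ → ℝ} {a : ℝ} (hf : ContinuousOn f (Ioi a)) :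
    ∃ F : ℝ → ℝ, ∀ t > a + 1, HasDerivAt F (f t) t := by
  refine ⟨fun t => ∫ s in (a + 1)..t, f s, fun t ht => ?_⟩
  refine intervalIntegral.integral_hasDerivAt_right ?_ ?_
    (hf.continuousAt (Ioi_mem_nhds (by linarith)))
  · refine (hf.mono fun s hs => ?_).intervalIntegrable
    rw [uIcc_of_le ht.le] at hs
    exact lt_of_lt_of_le (lt_add_one a) hs.1
  · exact hf.stronglyMeasurableAtFilter isOpen_Ioi t (by
      have : a < t := by linarith
      exact this)

/-- A strictly increasing function has at most one zero. -/
theorem eventually_ne_of_deriv_pos {G : ℝ → ℝ} {b : ℝ} (hG : ∀ t > b, 0 < deriv G t) :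
    ∀ᶠ t in atTop, G t ≠ 0 := by
  have hmono : StrictMonoOn G (Ioi b) := by
    refine strictMonoOn_of_deriv_pos (convex_Ioi b) (fun t ht => ?_) fun t ht => ?_
    · exact (differentiableAt_of_deriv_ne_zero (hG t ht).ne').continuousAt.continuousWithinAt
    · rw [interior_Ioi] at ht
      exact hG t ht
  by_cases h : ∃ t > b, G t = 0
  · obtain ⟨t, ht, h0⟩ := h
    filter_upwards [eventually_gt_atTop t] with s hs
    have := hmono ht (lt_trans ht hs : b < s) hs
    rw [h0] at this
    exact this.ne'
  · push Not at h
    filter_upwards [eventually_gt_atTop b] with t ht using h t ht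

theorem eq_of_deriv_eq_zero {G : ℝ → ℝ} {b : ℝ} (hG : ∀ t > b, HasDerivAt G 0 t) {s t : ℝ}
    (hs : b < s) (ht : b < t) : G s = G t :=
  isOpen_Ioi.is_const_of_deriv_eq_zero isPreconnected_Ioi
    (fun r hr => (hG r hr).differentiableAt.differentiableWithinAt)
    (fun r hr => (hG r hr).deriv) hs ht

/-- A germ solving a first order linear differential equation over a Hardy field is zero or
nowhere zero. -/
theorem IsHardyField.eq_zero_or_isUnit_of_linear {M : Subring RealGerm} (hM : IsHardyField M)
    {f k u : RealGerm} (hf : f ∈ M) (hk : k ∈ M) (hu : EvDiff u) (h : derivative u + f * u = k) :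
    u = 0 ∨ IsUnit u := by
  obtain ⟨f, rfl⟩ := exists_coe f
  obtain ⟨k, rfl⟩ := exists_coe k
  obtain ⟨u, hu, rfl⟩ := hu
  obtain ⟨a, ha⟩ := isCn_coe.1 (hM.isCn _ hf 0)
  obtain ⟨F, hF⟩ := exists_antiderivative ha.continuousOn
  have h' : ∀ᶠ t in atTop, deriv u t + f t * u t = k t := coe_eq_iff.1 h
  -- With the integrating factor, `G' = k exp F` has the eventual sign of `k`, and `G` has the same
  -- zeros as `u`.
  set G : ℝ → ℝ := fun t => u t * Real.exp (F t) with hG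
  have hGd : ∀ᶠ t in atTop, HasDerivAt G (k t * Real.exp (F t)) t := by
    filter_upwards [h', hu, eventually_gt_atTop (a + 1)] with t h1 h2 h3
    convert! h2.hasDerivAt.mul ((hF t h3).exp) using 1
    rw [← h1]
    ring
  rw [coe_eq_zero_iff, isUnit_coe]
  have hG0 : ∀ t, G t = 0 ↔ u t = 0 := fun t => by
    simp [hG, Real.exp_ne_zero]
  rcases hM.trichotomy hk with h0 | h0 | h0
  · obtain ⟨b, hb⟩ := eventually_atTop.1 (hGd.and h0)
    have hb' : ∀ t > b, HasDerivAt G 0 t := fun t ht => by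
      have := (hb t ht.le).1
      rwa [(hb t ht.le).2, zero_mul] at this
    by_cases hz : G (b + 1) = 0
    · left
      filter_upwards [eventually_gt_atTop b] with t ht
      rw [← hG0, eq_of_deriv_eq_zero hb' ht (lt_add_one b), hz]
    · right
      filter_upwards [eventually_gt_atTop b] with t ht
      rw [Ne, ← hG0, eq_of_deriv_eq_zero hb' ht (lt_add_one b)]
      exact hz
  · right
    obtain ⟨b, hb⟩ := eventually_atTop.1 (hGd.and h0)
    refine (eventually_ne_of_deriv_pos (G := G) (b := b) fun t ht => ?_).mono fun t ht h =>
      ht ((hG0 t).2 h)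
    rw [(hb t ht.le).1.deriv]
    exact mul_pos (hb t ht.le).2 (Real.exp_pos _)
  · right
    obtain ⟨b, hb⟩ := eventually_atTop.1 (hGd.and h0)
    refine (eventually_ne_of_deriv_pos (G := -G) (b := b) fun t ht => ?_).mono fun t ht h =>
      ht (by rw [Pi.neg_apply, (hG0 t).2 h, neg_zero])
    rw [(hb t ht.le).1.neg.deriv]
    exact neg_pos.2 (mul_neg_of_neg_of_pos (hb t ht.le).2 (Real.exp_pos _))

theorem exists_monic_irreducible_eq {M : Subring RealGerm} (hM : IsHardyField M) {p : M[X]}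
    (hp : Irreducible p) : ∃ (c : M) (q : M[X]), IsUnit c ∧ q.Monic ∧ Irreducible q ∧
      p = C c * q := by
  let _ := hM.field
  have hl : p.leadingCoeff ≠ 0 := leadingCoeff_ne_zero.2 hp.ne_zero
  have hu : IsUnit p.leadingCoeff := isUnit_iff_ne_zero.2 hl
  have heq : p = C p.leadingCoeff * (p * C p.leadingCoeff⁻¹) := by
    rw [mul_comm p, ← mul_assoc, ← C_mul]
    have : p.leadingCoeff * p.leadingCoeff⁻¹ = 1 := mul_inv_cancel₀ hl
    rw [this, C_1, one_mul]
  refine ⟨_, _, hu, monic_mul_leadingCoeff_inv hp.ne_zero, ?_, heq⟩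
  rw [heq] at hp
  exact (irreducible_isUnit_mul (hu.map C)).1 hp

theorem isUnit_aeval_of_isUnit {M : Subring RealGerm} {p : M[X]} (hp : IsUnit p) (y : RealGerm) :
    IsUnit (aeval y p) := hp.map (aeval y)

/-- Maximal Hardy fields contain all solutions of first order linear differential equations over
them. -/
theorem mem_of_linear_of_maximal {M : Subring RealGerm} (hM : Maximal IsHardyField M)
    {f g y : RealGerm} (hf : f ∈ M) (hg : g ∈ M) (hy : EvDiff y) (h : derivative y + f * y = g) :
    y ∈ M := by
  refine mem_of_maximal hM (hM.1.exists_extension hy ⟨C ⟨g, hg⟩ - C ⟨f, hf⟩ * Polynomial.X, ?_⟩ ?_)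
  · rw [map_sub, map_mul, aeval_C, aeval_C, aeval_X, eq_sub_of_add_eq h]
    rfl
  intro p
  let _ := hM.1.field
  suffices hsuff : aeval y p = 0 ∨ IsUnit (aeval y p) from fun h0 => hsuff.resolve_left h0
  -- It suffices to treat irreducible factors. One without real roots takes unit values; one with a
  -- root in `M` is linear.
  induction p using WfDvdMonoid.induction_on_irreducible with
  | zero => exact Or.inl (map_zero _)
  | unit p hp => exact Or.inr (isUnit_aeval_of_isUnit hp y)
  | mul q p _ hp ih =>
    rw [map_mul]
    have key : aeval y p = 0 ∨ IsUnit (aeval y p) := by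
      obtain ⟨c, r, hc, hr, hri, rfl⟩ := exists_monic_irreducible_eq hM.1 hp
      have hcu : IsUnit (aeval y (C c)) := isUnit_aeval_of_isUnit (hc.map C) y
      rw [map_mul]
      rcases eventually_eval_ne_zero_or_exists_root hM hri hr with h1 | ⟨z, hz, h1⟩
      · exact Or.inr (hcu.mul (h1 y))
      · have hroot : r.IsRoot ⟨z, hz⟩ := by
          have h2 := aeval_algebraMap_apply RealGerm (⟨z, hz⟩ : M) r
          have h3 : ((aeval (⟨z, hz⟩ : M) r : M) : RealGerm) = 0 := h2.symm.trans h1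
          rw [IsRoot, ← coe_aeval_eq_eval]
          exact Subtype.ext h3
        obtain ⟨s, hs⟩ := dvd_iff_isRoot.2 hroot
        have hsu : IsUnit s := (hri.isUnit_or_isUnit hs).resolve_left (not_isUnit_X_sub_C _)
        -- `y - z` solves an equation with the same coefficient `f` and right-hand side in `M`.
        have hlin : y - z = 0 ∨ IsUnit (y - z) := by
          have hze := hM.1.evDiff hz
          have hne : EvDiff (-z) := hM.1.evDiff (M.neg_mem hz)
          refine hM.1.eq_zero_or_isUnit_of_linear hf
            (k := g + (derivative (-z) + f * (-z))) ?_ ?_ ?_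
          · exact M.add_mem hg (M.add_mem (hM.1.derivative_mem _ (M.neg_mem hz))
              (M.mul_mem hf (M.neg_mem hz)))
          · rw [sub_eq_add_neg]
            exact hy.add hne
          · rw [sub_eq_add_neg, derivative_add hy hne, ← h]
            ring
        have hsplit : aeval y r = (y - z) * aeval y s := by
          rw [hs, map_mul, map_sub, aeval_X, aeval_C]
          rfl
        rw [hsplit]
        rcases hlin with h2 | h2
        · left
          rw [h2, zero_mul, mul_zero]
        · right
          exact hcu.mul (h2.mul (isUnit_aeval_of_isUnit hsu y))
    rcases key with h1 | h1
    · left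
      rw [h1, zero_mul]
    rcases ih with h2 | h2
    · left
      rw [h2, mul_zero]
    · exact Or.inr (h1.mul h2)

theorem const_mem_of_maximal {M : Subring RealGerm} (hM : Maximal IsHardyField M) (c : ℝ) :
    ((fun _ => c : ℝ → ℝ) : RealGerm) ∈ M :=
  mem_of_linear_of_maximal hM M.zero_mem M.zero_mem
    (evDiff_coe.2 (Eventually.of_forall fun _ => differentiableAt_const _))
    (by rw [derivative_const, zero_mul, zero_add])

theorem derivative_X : derivative X = 1 :=
  coe_eq_iff.2 (Eventually.of_forall fun t => deriv_id t)

theorem evDiff_X : EvDiff X := evDiff_coe.2 (Eventually.of_forall fun _ => differentiableAt_id)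

theorem X_mem_of_maximal {M : Subring RealGerm} (hM : Maximal IsHardyField M) : X ∈ M :=
  mem_of_linear_of_maximal hM M.zero_mem M.one_mem evDiff_X
    (by rw [derivative_X, zero_mul, add_zero])

theorem EvDiff.exp {f : RealGerm} (hf : EvDiff f) : EvDiff (exp f) := by
  obtain ⟨φ, hφ, rfl⟩ := hf
  exact evDiff_coe.2 (hφ.mono fun t ht => ht.exp)

theorem derivative_exp {f : RealGerm} (hf : EvDiff f) :
    derivative (exp f) = derivative f * exp f := by
  obtain ⟨φ, hφ, rfl⟩ := hf
  refine coe_eq_iff.2 (hφ.mono fun t ht => ?_)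
  exact ht.hasDerivAt.exp.deriv.trans (mul_comm _ _)

theorem expClosed_of_maximal {M : Subring RealGerm} (hM : Maximal IsHardyField M) :
    ExpClosed M := fun f hf =>
  mem_of_linear_of_maximal hM (M.neg_mem (hM.1.derivative_mem f hf)) M.zero_mem
    (hM.1.evDiff hf).exp (by rw [derivative_exp (hM.1.evDiff hf)]; ring)

theorem log_mem_of_maximal {M : Subring RealGerm} (hM : Maximal IsHardyField M) {φ : ℝ → ℝ}
    (hφ : (φ : RealGerm) ∈ M) (hpos : ∀ᶠ t in atTop, 0 < φ t) :
    ((fun t => Real.log (φ t) : ℝ → ℝ) : RealGerm) ∈ M := by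
  have hd := hM.1.eventually_differentiableAt hφ
  have h0 : (φ : RealGerm) ≠ 0 := fun h => by
    obtain ⟨t, h1, h2⟩ := (hpos.and (coe_eq_zero_iff.1 h)).exists
    exact h1.ne' h2
  obtain ⟨g, hg, hinv⟩ := hM.1.exists_inv hφ h0
  obtain ⟨ψ, rfl⟩ := exists_coe g
  refine mem_of_linear_of_maximal hM M.zero_mem (M.mul_mem (hM.1.derivative_mem _ hφ) hg)
    (evDiff_coe.2 ?_) ?_
  · filter_upwards [hd, hpos] with t h1 h2 using h1.log h2.ne'
  · rw [zero_mul, add_zero]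
    have hinv' : ∀ᶠ t in atTop, φ t * ψ t = 1 := coe_eq_iff.1 hinv
    refine coe_eq_iff.2 ?_
    filter_upwards [hd, hpos, hinv'] with t h1 h2 h3
    rw [deriv.log h1 h2.ne']
    change deriv φ t / φ t = deriv φ t * ψ t
    rw [div_eq_iff h2.ne', mul_assoc, mul_comm (ψ t), h3, mul_one]

/-- Variation of constants: `y = exp(-F) (G + c)` with `F' = f` and `G' = exp(F) g`. -/
theorem exists_linear_of_maximal {M : Subring RealGerm} (hM : Maximal IsHardyField M)
    {f g : RealGerm} (hf : f ∈ M) (hg : g ∈ M) :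
    ∃ y ∈ M, y ≠ 0 ∧ derivative y + f * y = g := by
  obtain ⟨φ, hφ⟩ := exists_coe f
  obtain ⟨γ, hγ⟩ := exists_coe g
  obtain ⟨a, ha⟩ := isCn_coe.1 (hM.1.isCn _ (hφ ▸ hf) 0)
  obtain ⟨b, hb⟩ := isCn_coe.1 (hM.1.isCn _ (hγ ▸ hg) 0)
  obtain ⟨F, hF⟩ := exists_antiderivative ha.continuousOn
  obtain ⟨G, hG⟩ := exists_antiderivative (f := fun t => Real.exp (F t) * γ t) (a := max (a + 1) b)
    (fun t ht => by
      have h1 : a + 1 < t := (le_max_left _ _).trans_lt ht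
      have h2 : b < t := (le_max_right _ _).trans_lt ht
      exact ((hF t h1).continuousAt.rexp.mul
        (hb.continuousOn.continuousAt (Ioi_mem_nhds h2))).continuousWithinAt)
  have key : ∀ c : ℝ, ∀ᶠ t in atTop, HasDerivAt (fun t => Real.exp (-F t) * (G t + c))
      (γ t - φ t * (Real.exp (-F t) * (G t + c))) t := by
    intro c
    filter_upwards [eventually_gt_atTop (max (a + 1) b + 1)] with t ht
    have h1 : a + 1 < t := (le_max_left _ b).trans_lt ((lt_add_one _).trans ht)
    have h2 : Real.exp (-F t) * (Real.exp (F t) * γ t) = γ t := by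
      rw [← mul_assoc, ← Real.exp_add]
      simp
    convert! (hF t h1).neg.exp.mul ((hG t ht).add_const c) using 1
    rw [Pi.neg_apply, h2]
    ring
  have hsol : ∀ c : ℝ, ((fun t => Real.exp (-F t) * (G t + c) : ℝ → ℝ) : RealGerm) ∈ M ∧
      derivative ((fun t => Real.exp (-F t) * (G t + c) : ℝ → ℝ) : RealGerm) + f *
        ((fun t => Real.exp (-F t) * (G t + c) : ℝ → ℝ) : RealGerm) = g := by
    intro c
    have h1 : derivative ((fun t => Real.exp (-F t) * (G t + c) : ℝ → ℝ) : RealGerm) + f *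
        ((fun t => Real.exp (-F t) * (G t + c) : ℝ → ℝ) : RealGerm) = g := by
      rw [← hφ, ← hγ]
      refine coe_eq_iff.2 ((key c).mono fun t ht => ?_)
      change deriv _ t + φ t * (Real.exp (-F t) * (G t + c)) = γ t
      rw [ht.deriv]
      ring
    exact ⟨mem_of_linear_of_maximal hM hf hg
      (evDiff_coe.2 ((key c).mono fun t ht => ht.differentiableAt)) h1, h1⟩
  -- The free constant secures a nonzero solution: if `c = 0` gives the zero germ, `c = 1` does not.
  by_cases h0 : ((fun t => Real.exp (-F t) * (G t + 0) : ℝ → ℝ) : RealGerm) = 0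
  · refine ⟨_, (hsol 1).1, fun h1 => ?_, (hsol 1).2⟩
    obtain ⟨t, h2, h3⟩ := ((coe_eq_zero_iff.1 h0).and (coe_eq_zero_iff.1 h1)).exists
    simp only [mul_eq_zero, Real.exp_ne_zero, false_or] at h2 h3
    linarith
  · exact ⟨_, (hsol 0).1, h0, (hsol 0).2⟩

/-! ### Maximal Hardy fields: odd degree roots and square roots -/

theorem exists_eval_eq_zero_of_odd_of_monic {p : ℝ[X]} (hm : p.Monic) (hp : Odd p.natDegree) :
    ∃ s, p.eval s = 0 := by
  have hdeg : 0 < p.degree := natDegree_pos_iff_degree_pos.1 hp.pos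
  have h1 : Tendsto (fun s => p.eval s) atTop atTop :=
    p.tendsto_atTop_of_leadingCoeff_nonneg hdeg (by rw [hm.leadingCoeff]; exact zero_le_one)
  have h2 : Tendsto (fun s => (p.comp (-Polynomial.X)).eval s) atTop atBot := by
    refine Polynomial.tendsto_atBot_of_leadingCoeff_nonpos _ ?_ ?_
    · rw [← natDegree_pos_iff_degree_pos, natDegree_comp, natDegree_neg, natDegree_X, mul_one]
      exact hp.pos
    · rw [leadingCoeff_comp (by simp), hm.leadingCoeff, leadingCoeff_neg, leadingCoeff_X,
        hp.neg_one_pow]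
      norm_num
  obtain ⟨s₁, h1⟩ := (h1.eventually_ge_atTop 0).exists
  obtain ⟨s₂, h2⟩ := (h2.eventually_le_atBot 0).exists
  rw [eval_comp] at h2
  exact mem_range_of_exists_le_of_exists_ge (f := fun s => p.eval s) p.continuous ⟨_, h2⟩ ⟨s₁, h1⟩

theorem exists_irreducible_odd_dvd {k : Type*} [Field k] (p : k[X]) (hp : Odd p.natDegree) :
    ∃ q, Irreducible q ∧ Odd q.natDegree ∧ q ∣ p := by
  induction hn : p.natDegree using Nat.strong_induction_on generalizing p with
  | _ n ih =>
    subst hn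
    have hp0 : p ≠ 0 := by
      rintro rfl
      simp at hp
    by_cases hirr : Irreducible p
    · exact ⟨p, hirr, hp, dvd_rfl⟩
    have hnu : ¬ IsUnit p := fun h => by
      rw [natDegree_eq_zero_of_isUnit h] at hp
      simp at hp
    obtain ⟨a, b, hab, ha, hb⟩ : ∃ a b, p = a * b ∧ ¬ IsUnit a ∧ ¬ IsUnit b := by
      rw [irreducible_iff] at hirr
      push Not at hirr
      obtain ⟨a, b, h1, h2, h3⟩ := hirr hnu
      exact ⟨a, b, h1, h2, h3⟩
    have ha0 : a ≠ 0 := left_ne_zero_of_mul (hab ▸ hp0)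
    have hb0 : b ≠ 0 := right_ne_zero_of_mul (hab ▸ hp0)
    have hdeg : p.natDegree = a.natDegree + b.natDegree := by rw [hab, natDegree_mul ha0 hb0]
    have ha1 : 0 < a.natDegree := Nat.pos_of_ne_zero fun h =>
      ha (isUnit_iff_degree_eq_zero.2 (by rw [degree_eq_natDegree ha0, h]; rfl))
    have hb1 : 0 < b.natDegree := Nat.pos_of_ne_zero fun h =>
      hb (isUnit_iff_degree_eq_zero.2 (by rw [degree_eq_natDegree hb0, h]; rfl))
    rcases Nat.even_or_odd a.natDegree with he | ho
    · have ho : Odd b.natDegree := by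
        rw [hdeg] at hp
        exact (Nat.odd_add'.1 hp).2 he
      obtain ⟨q, h1, h2, h3⟩ := ih b.natDegree (by lia) b ho rfl
      exact ⟨q, h1, h2, h3.trans (hab ▸ dvd_mul_left b a)⟩
    · obtain ⟨q, h1, h2, h3⟩ := ih a.natDegree (by lia) a ho rfl
      exact ⟨q, h1, h2, h3.trans (hab ▸ dvd_mul_right a b)⟩

/-- For a monic irreducible factor of odd degree, choosing a real root at each large `t`, with no
continuity required, yields a germ at which its value is not a unit. This rules out the rootless
alternative. -/
theorem exists_isRoot_of_maximal {M : Subring RealGerm} (hM : Maximal IsHardyField M) {p : M[X]}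
    (hp : Odd p.natDegree) : ∃ x, p.IsRoot x := by
  let _ := hM.1.field
  obtain ⟨q, hq, hodd, hqp⟩ := exists_irreducible_odd_dvd p hp
  obtain ⟨c, r, hc, hr, hri, rfl⟩ := exists_monic_irreducible_eq hM.1 hq
  have hdeg : (C c * r).natDegree = r.natDegree := natDegree_C_mul hc.ne_zero
  rw [hdeg] at hodd
  rcases eventually_eval_ne_zero_or_exists_root hM hri hr with h | ⟨z, hz, h1⟩
  · exfalso
    obtain ⟨P, -, hPd, hPc, hPe⟩ := exists_family r
    have hroot : ∀ t, ∃ s, (P t).coeff r.natDegree = 1 → (P t).eval s = 0 := by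
      intro t
      by_cases h1 : (P t).coeff r.natDegree = 1
      · have hd : (P t).natDegree = r.natDegree :=
          le_antisymm (hPd t) (le_natDegree_of_ne_zero (by rw [h1]; exact one_ne_zero))
        obtain ⟨s, hs⟩ := exists_eval_eq_zero_of_odd_of_monic (p := P t)
          (by rw [Monic, leadingCoeff, hd, h1]) (by rwa [hd])
        exact ⟨s, fun _ => hs⟩
      · exact ⟨0, fun h2 => absurd h2 h1⟩
    choose s hs using hroot
    have hu := h (s : RealGerm)
    rw [hPe s, isUnit_coe] at hu
    have hlead : ∀ᶠ t in atTop, (P t).coeff r.natDegree = 1 := by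
      refine coe_eq_iff.1 ((hPc _).trans ?_)
      rw [hr.coeff_natDegree]
      rfl
    obtain ⟨t, h2, h3⟩ := (hu.and hlead).exists
    exact h2 (hs t h3)
  · have hroot : r.IsRoot ⟨z, hz⟩ := by
      have h2 := aeval_algebraMap_apply RealGerm (⟨z, hz⟩ : M) r
      have h3 : ((aeval (⟨z, hz⟩ : M) r : M) : RealGerm) = 0 := h2.symm.trans h1
      rw [IsRoot, ← coe_aeval_eq_eval]
      exact Subtype.ext h3
    exact ⟨_, hroot.dvd ((dvd_mul_left r (C c)).trans hqp)⟩

/-- For positive `f` the root is `exp(½ log f)`. -/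
theorem exists_sqrt_of_maximal {M : Subring RealGerm} (hM : Maximal IsHardyField M)
    {f : RealGerm} (hf : f ∈ M) (h0 : 0 ≤ f) : ∃ g ∈ M, f = g * g := by
  obtain ⟨φ, rfl⟩ := exists_coe f
  rcases hM.1.trichotomy hf with h | h | h
  · exact ⟨0, M.zero_mem, by rw [mul_zero, coe_eq_zero_iff.2 h]⟩
  · have hl := log_mem_of_maximal hM hf h
    have hc := const_mem_of_maximal hM (1 / 2)
    refine ⟨_, expClosed_of_maximal hM _ (M.mul_mem hc hl), coe_eq_iff.2 ?_⟩
    filter_upwards [h] with t ht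
    change φ t = Real.exp (1 / 2 * Real.log (φ t)) * Real.exp (1 / 2 * Real.log (φ t))
    rw [← Real.exp_add, ← add_mul]
    norm_num
    rw [Real.exp_log ht]
  · have h1 : ∀ᶠ t in atTop, 0 ≤ φ t := h0
    obtain ⟨t, h2, h3⟩ := (h1.and h).exists
    exact absurd h3 (not_lt.2 h2)

/-! ### Iterated exponential bounds and logarithmic derivatives -/

theorem eventually_monotone {f : ℝ → ℝ} (hd : ∀ᶠ t in atTop, DifferentiableAt ℝ f t)
    (h : ∀ᶠ t in atTop, 0 ≤ deriv f t) : ∃ b, MonotoneOn f (Ioi b) := by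
  obtain ⟨b, hb⟩ := eventually_atTop.1 (hd.and h)
  refine ⟨b, monotoneOn_of_deriv_nonneg (convex_Ioi b) ?_ ?_ ?_⟩
  · exact fun t ht => (hb t (le_of_lt ht)).1.continuousAt.continuousWithinAt
  · exact fun t ht => (hb t (interior_subset ht).le).1.differentiableWithinAt
  · exact fun t ht => (hb t (interior_subset ht).le).2

/-- A function with eventually nonnegative derivative is eventually bounded below. -/
theorem exists_le_of_deriv_nonneg {f : ℝ → ℝ} (hd : ∀ᶠ t in atTop, DifferentiableAt ℝ f t)
    (h : ∀ᶠ t in atTop, 0 ≤ deriv f t) : ∃ c, ∀ᶠ t in atTop, c ≤ f t := by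
  obtain ⟨b, hb⟩ := eventually_monotone hd h
  refine ⟨f (b + 1), ?_⟩
  filter_upwards [eventually_ge_atTop (b + 1)] with t ht
  exact hb (lt_add_one b) (lt_of_lt_of_le (lt_add_one b) ht) ht

theorem exp_le_exp {f g : RealGerm} (h : f ≤ g) : exp f ≤ exp g := by
  obtain ⟨φ, rfl⟩ := exists_coe f
  obtain ⟨ψ, rfl⟩ := exists_coe g
  exact (coe_le_iff.1 h).mono fun t ht => Real.exp_le_exp.2 ht

theorem iterate_exp_le_iterate_exp {f g : RealGerm} (h : f ≤ g) (n : ℕ) :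
    exp^[n] f ≤ exp^[n] g := by
  induction n with
  | zero => exact h
  | succ n ih =>
    rw [Function.iterate_succ_apply', Function.iterate_succ_apply']
    exact exp_le_exp ih

theorem le_exp (f : RealGerm) : f ≤ exp f := by
  obtain ⟨φ, rfl⟩ := exists_coe f
  exact Eventually.of_forall fun t => by
    have := Real.add_one_le_exp (φ t)
    change φ t ≤ Real.exp (φ t)
    linarith

theorem le_iterate_exp (f : RealGerm) (n : ℕ) : f ≤ exp^[n] f := by
  induction n with
  | zero => exact le_rfl
  | succ n ih =>
    rw [Function.iterate_succ_apply']
    exact ih.trans (le_exp _)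

theorem ExpClosed.iterate_mem {K : Subring RealGerm} (hK : ExpClosed K) {f : RealGerm}
    (hf : f ∈ K) (n : ℕ) : exp^[n] f ∈ K := by
  induction n with
  | zero => exact hf
  | succ n ih =>
    rw [Function.iterate_succ_apply']
    exact hK _ ih

/-- `f` is bounded by an iterated exponential of an element of `H`. -/
def IsExpBounded (H : Subring RealGerm) (f : RealGerm) : Prop :=
  ∃ n : ℕ, ∃ h ∈ H, 0 ≤ h ∧ f ≤ exp^[n] (X + h)

section Maximal

variable {M H : Subring RealGerm} (hM : Maximal IsHardyField M) (hHM : H ≤ M)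
include hM

/-- Positive infinite elements of a Hardy field have positive derivative. -/
theorem eventually_deriv_pos_of_maximal {g : ℝ → ℝ} (hg : (g : RealGerm) ∈ M)
    (hinf : ∀ c, ∀ᶠ t in atTop, c < g t) : ∀ᶠ t in atTop, 0 < deriv g t := by
  have hd := hM.1.eventually_differentiableAt hg
  by_contra hn
  have h1 : ∀ᶠ t in atTop, deriv g t ≤ 0 := by
    rcases hM.1.trichotomy (hM.1.derivative_mem _ hg) with h | h | h
    · exact h.mono fun t ht => ht.le
    · exact absurd h hn
    · exact h.mono fun t ht => ht.le
  obtain ⟨c, hc⟩ := exists_le_of_deriv_nonneg (f := -g) (hd.mono fun t ht => ht.neg) (by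
    filter_upwards [h1] with t h2
    rw [deriv.neg]
    exact neg_nonneg.2 h2)
  obtain ⟨t, h2, h3⟩ := (hc.and (hinf (-c))).exists
  rw [Pi.neg_apply] at h2
  linarith

include hHM in
/-- If the logarithmic derivative of `y` is exponentially bounded, then so is `y`. -/
theorem isExpBounded_of_logDeriv {y v : ℝ → ℝ} (hy : (y : RealGerm) ∈ M)
    (hpos : ∀ᶠ t in atTop, 0 < y t) (hv : ∀ᶠ t in atTop, deriv y t = v t * y t)
    (hb : IsExpBounded H v) : IsExpBounded H y := by
  obtain ⟨n, h, hh, h0, hle⟩ := hb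
  have hgM : exp^[n] (X + h) ∈ M :=
    (expClosed_of_maximal hM).iterate_mem (M.add_mem (X_mem_of_maximal hM) (hHM hh)) n
  have hXg : X ≤ exp^[n] (X + h) := (le_add_of_nonneg_right h0).trans (le_iterate_exp _ n)
  obtain ⟨g, hg⟩ := exists_coe (exp^[n] (X + h))
  rw [← hg] at hgM hXg hle
  have hle' : ∀ᶠ t in atTop, v t ≤ g t := hle
  have hXg' : ∀ᶠ t in atTop, t ≤ g t := hXg
  have hgd := hM.1.eventually_differentiableAt hgM
  have hyd := hM.1.eventually_differentiableAt hy
  have hg' := eventually_deriv_pos_of_maximal hM hgM fun c => by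
    filter_upwards [hXg', eventually_gt_atTop c] with t h1 h2 using lt_of_lt_of_le h2 h1
  -- As `(t g)' = g + t g' ≥ v = (log y)'`, the difference `t g - log y` is bounded below.
  have hder : ∀ᶠ t in atTop, HasDerivAt (fun t => t * g t - Real.log (y t))
      (1 * g t + t * deriv g t - deriv y t / y t) t := by
    filter_upwards [hgd, hyd, hpos] with t h1 h2 h3
    exact ((hasDerivAt_id t).mul h1.hasDerivAt).sub (h2.hasDerivAt.log h3.ne')
  obtain ⟨c, hc⟩ := exists_le_of_deriv_nonneg (hder.mono fun t ht => ht.differentiableAt) (by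
    filter_upwards [hder, hle', hg', hv, hpos, eventually_ge_atTop 0] with t h1 h2 h3 h4 h5 h6
    rw [h1.deriv, h4, mul_div_cancel_right₀ _ h5.ne']
    have := mul_nonneg h6 h3.le
    linarith)
  -- Here `log y ≤ t g - c ≤ g² + g`, and `exp(exp g) ≥ g⁴/8 ≥ g² + g` once `g ≥ 16`. Two
  -- exponentials bound `log y`, and a third bounds `y`.
  refine ⟨n + 3, h, hh, h0, ?_⟩
  rw [add_comm n 3, Function.iterate_add_apply, ← hg]
  change ∀ᶠ t in atTop, y t ≤ Real.exp (Real.exp (Real.exp (g t)))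
  filter_upwards [hc, hpos, hXg', eventually_ge_atTop (16 + |c|)] with t h1 h2 h3 h4
  rw [← Real.exp_log h2]
  refine Real.exp_le_exp.2 ?_
  have hc' := neg_abs_le c
  have hc0 := abs_nonneg c
  have hg16 : 16 + |c| ≤ g t := h4.trans h3
  have e1 : (g t) ^ 2 / 2 ≤ Real.exp (g t) := by
    have := Real.quadratic_le_exp_of_nonneg (x := g t) (by linarith)
    nlinarith
  have e2 : (Real.exp (g t)) ^ 2 / 2 ≤ Real.exp (Real.exp (g t)) := by
    have h5 := Real.quadratic_le_exp_of_nonneg (Real.exp_pos (g t)).le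
    have h6 := Real.exp_pos (g t)
    linarith
  have e3 : t * g t ≤ g t * g t := by
    have : 0 ≤ g t := by linarith
    gcongr
  have e4 : Real.log (y t) ≤ g t ^ 2 + g t := by nlinarith
  have e5 : g t ^ 2 + g t ≤ ((g t) ^ 2 / 2) ^ 2 / 2 := by
    have : 16 ≤ g t := by linarith
    have h7 : g t ≤ g t ^ 2 := by nlinarith
    have h8 : 16 ≤ g t ^ 2 := by nlinarith
    nlinarith
  have e6 : ((g t) ^ 2 / 2) ^ 2 / 2 ≤ (Real.exp (g t)) ^ 2 / 2 := by gcongr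
  linarith

/-- Powers of the logarithmic derivative of a fast growing element are smaller than it. -/
theorem logDeriv_pow_le {y v : ℝ → ℝ} (hy : (y : RealGerm) ∈ M) (hvM : (v : RealGerm) ∈ M)
    (hX : ∀ᶠ t in atTop, t ≤ y t) (hv : ∀ᶠ t in atTop, deriv y t = v t * y t) (m : ℕ) :
    ∀ᶠ t in atTop, v t ^ m ≤ y t := by
  have hpow : ((fun t => v t ^ m : ℝ → ℝ) : RealGerm) ∈ M := M.pow_mem hvM m
  rcases hM.1.lt_or_ge hy hpow with hlt | hge
  swap
  · exact hge
  exfalso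
  have hyd := hM.1.eventually_differentiableAt hy
  have hy' := eventually_deriv_pos_of_maximal hM hy fun c => by
    filter_upwards [hX, eventually_gt_atTop c] with t h1 h2 using lt_of_lt_of_le h2 h1
  have hm : (m : ℝ) ≠ 0 := by
    rintro hm
    rw [Nat.cast_eq_zero] at hm
    subst hm
    obtain ⟨t, h1, h2, h3⟩ := (hlt.and (hX.and (eventually_ge_atTop 1))).exists
    rw [pow_zero] at h1
    linarith
  have hm0 : (0 : ℝ) < m := lt_of_le_of_ne (Nat.cast_nonneg m) hm.symm
  have hpos : ∀ᶠ t in atTop, 0 < y t := by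
    filter_upwards [hX, eventually_gt_atTop 0] with t h1 h2 using lt_of_lt_of_le h2 h1
  -- If `y < v^m`, then `v = y'/y` exceeds `y^(1/m)`, so `-m y^(-1/m)` has derivative at least 1. It
  -- would tend to infinity although it is negative.
  have hder : ∀ᶠ t in atTop,
      HasDerivAt (fun t => -(m * Real.exp (-(Real.log (y t) / m))) - t)
        (Real.exp (-(Real.log (y t) / m)) * v t - 1) t := by
    filter_upwards [hyd, hpos, hv] with t h1 h2 h3
    have h4 := (((h1.hasDerivAt.log h2.ne').div_const (m : ℝ)).fun_neg.exp.const_mul (m : ℝ)).fun_neg.sub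
      (hasDerivAt_id t)
    convert! h4 using 1
    rw [h3]
    have := h2.ne'
    field_simp
  obtain ⟨c, hc⟩ := exists_le_of_deriv_nonneg (hder.mono fun t ht => ht.differentiableAt) (by
    filter_upwards [hder, hlt, hy', hv, hpos] with t h1 h2 h3 h4 h5
    rw [h1.deriv]
    have hv0 : 0 < v t := by
      rw [h4] at h3
      exact pos_of_mul_pos_left h3 h5.le
    have h6 : Real.exp (Real.log (y t) / m) < v t := by
      refine lt_of_pow_lt_pow_left₀ m hv0.le ?_
      rw [← Real.exp_nat_mul, mul_div_cancel₀ _ hm, Real.exp_log h5]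
      exact h2
    have h7 : Real.exp (-(Real.log (y t) / m)) * Real.exp (Real.log (y t) / m) = 1 := by
      rw [← Real.exp_add]
      simp
    have h8 := mul_le_mul_of_nonneg_left h6.le (Real.exp_pos (-(Real.log (y t) / m))).le
    linarith)
  obtain ⟨t, h1, h2⟩ := (hc.and (eventually_gt_atTop (-c))).exists
  have h3 : 0 < m * Real.exp (-(Real.log (y t) / m)) := by positivity
  linarith

end Maximal

/-! ### Differential algebraicity implies an exponential bound -/

/-- The algebra structure of an extension of rings of germs. -/
@[reducible] noncomputable def extensionAlgebra {H M : Subring RealGerm} (hHM : H ≤ M) :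
    Algebra H M := (Subring.inclusion hHM).toAlgebra

/-- The inclusion of `M` into the germs is an injective `H`-algebra map commuting with derivation,
so the relation can be read in the field `M`. -/
theorem isDAlgebraic_iff {H M : Subring RealGerm} (hM : IsHardyField M) (hHM : H ≤ M)
    {y : RealGerm} (hy : y ∈ M) :
    letI := extensionAlgebra hHM
    IsDAlgebraic H y ↔ ¬ AlgebraicIndependent H fun n => hM.derivation^[n] ⟨y, hy⟩ := by
  let _ := extensionAlgebra hHM
  let f : M →ₐ[H] RealGerm := { M.subtype with commutes' := fun _ => rfl }
  have hf : Function.Injective f := Subtype.val_injective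
  have hit : ∀ n, f (hM.derivation^[n] ⟨y, hy⟩) = derivative^[n] y := by
    intro n
    induction n with
    | zero => rfl
    | succ n ih =>
      rw [Function.iterate_succ_apply', Function.iterate_succ_apply', ← ih]
      rfl
  rw [← f.algebraicIndependent_iff hf, algebraicIndependent_iff]
  have : (⇑f ∘ fun n => hM.derivation^[n] ⟨y, hy⟩) = fun n => derivative^[n] y := funext hit
  rw [this, IsDAlgebraic]
  push Not
  exact ⟨fun ⟨P, h1, h2⟩ => ⟨P, h2, h1⟩, fun ⟨P, h1, h2⟩ => ⟨P, h2, h1⟩⟩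

theorem faithfulSMul_extension {H M : Subring RealGerm} (hHM : H ≤ M) :
    letI := extensionAlgebra hHM
    FaithfulSMul H M := by
  let _ := extensionAlgebra hHM
  exact (faithfulSMul_iff_algebraMap_injective H M).2 (Subring.inclusion_injective hHM)

theorem derivation_algebraMap {H M : Subring RealGerm} (hH : IsHardyField H)
    (hM : IsHardyField M) (hHM : H ≤ M) (r : H) :
    letI := extensionAlgebra hHM
    ∃ r', hM.derivation (algebraMap H M r) = algebraMap H M r' :=
  ⟨hH.derivation r, rfl⟩

theorem isDAlgebraic_iff_isDiffFinite {H M : Subring RealGerm} (hH : IsHardyField H)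
    (hM : IsHardyField M) (hHM : H ≤ M) {y : RealGerm} (hy : y ∈ M) :
    letI := hM.field
    letI := extensionAlgebra hHM
    IsDAlgebraic H y ↔ IsDiffFinite H hM.derivation ⟨y, hy⟩ := by
  let _ := hM.field
  let _ := extensionAlgebra hHM
  have := IsHardyField.charZero M
  have := faithfulSMul_extension hHM
  rw [isDAlgebraic_iff hM hHM hy, isDiffFinite_iff (derivation_algebraMap hH hM hHM)]

theorem le_of_not_isExpBounded {M H : Subring RealGerm} (hM : Maximal IsHardyField M)
    (hHM : H ≤ M) {y h : RealGerm} (hy : y ∈ M) (hb : ¬ IsExpBounded H y) (hh : h ∈ H)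
    (h0 : 0 ≤ h) : X + h ≤ y := by
  rcases hM.1.le_total (M.add_mem (X_mem_of_maximal hM) (hHM hh)) hy with h1 | h1
  · exact h1
  · exact absurd ⟨0, h, hh, h0, h1⟩ hb

theorem X_nonneg : 0 ≤ X := by
  change ∀ᶠ t in atTop, (0 : ℝ) ≤ t
  exact eventually_ge_atTop 0

/-- With `v = y'/y`, this is the step to be iterated: `v` grows far more slowly than `y` but still
escapes every exponential bound over `H`. -/
theorem exists_logDeriv {M H : Subring RealGerm} (hM : Maximal IsHardyField M) (hHM : H ≤ M)
    {y : RealGerm} (hy : y ∈ M) (hb : ¬ IsExpBounded H y) :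
    ∃ v ∈ M, derivative y = v * y ∧ ¬ IsExpBounded H v ∧ ∀ m, v ^ m ≤ y := by
  have hXy : X ≤ y := by
    have := le_of_not_isExpBounded hM hHM hy hb H.zero_mem le_rfl
    rwa [add_zero] at this
  obtain ⟨φ, rfl⟩ := exists_coe y
  have hX' : ∀ᶠ t in atTop, t ≤ φ t := hXy
  have hpos : ∀ᶠ t in atTop, 0 < φ t := by
    filter_upwards [hX', eventually_gt_atTop 0] with t h1 h2 using lt_of_lt_of_le h2 h1
  have hne : (φ : RealGerm) ≠ 0 := fun h => by
    obtain ⟨t, h1, h2⟩ := (hpos.and (coe_eq_zero_iff.1 h)).exists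
    exact h1.ne' h2
  obtain ⟨w, hw, hinv⟩ := hM.1.exists_inv hy hne
  have hvM := M.mul_mem (hM.1.derivative_mem _ hy) hw
  have hv : derivative (φ : RealGerm) = derivative (φ : RealGerm) * w * φ := by
    linear_combination -derivative (φ : RealGerm) * hinv
  refine ⟨_, hvM, hv, ?_⟩
  obtain ⟨ν, hν⟩ := exists_coe (derivative (φ : RealGerm) * w)
  rw [← hν] at hv hvM ⊢
  have hv' : ∀ᶠ t in atTop, deriv φ t = ν t * φ t := coe_eq_iff.1 hv
  exact ⟨fun h => hb (isExpBounded_of_logDeriv hM hHM hy hpos hv' h),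
    fun m => logDeriv_pow_le hM hy hvM hX' hv' m⟩

/-- Differentially algebraic elements are bounded by iterated exponentials. -/
theorem isExpBounded_of_isDAlgebraic {M H : Subring RealGerm} (hM : Maximal IsHardyField M)
    (hH : IsHardyField H) (hHM : H ≤ M) {y : RealGerm} (hy : y ∈ M) (hd : IsDAlgebraic H y) :
    IsExpBounded H y := by
  by_contra hb
  let _ := hM.1.field
  let _ := hM.1.linearOrder
  have := hM.1.isStrictOrderedRing
  let _ := extensionAlgebra hHM
  have := IsHardyField.charZero M
  have := faithfulSMul_extension hHM
  choose L hL using fun z : {z : M // ¬ IsExpBounded H z} =>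
    exists_logDeriv hM hHM z.1.2 z.2
  let step : {z : M // ¬ IsExpBounded H z} → {z : M // ¬ IsExpBounded H z} := fun z =>
    ⟨⟨L z, (hL z).1⟩, (hL z).2.2.1⟩
  -- The sequence starts with `y` and replaces each term by its logarithmic derivative.
  let u : ℕ → {z : M // ¬ IsExpBounded H z} := fun n => step^[n] ⟨⟨y, hy⟩, hb⟩
  have hstep : ∀ n, u (n + 1) = step (u n) := fun n => Function.iterate_succ_apply' _ _ _
  have hder : ∀ n, hM.1.derivation (u n).1 = (u (n + 1)).1 * (u n).1 := fun n => by
    rw [hstep]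
    exact Subtype.ext (hL (u n)).2.1
  have hle : ∀ n (h : RealGerm), h ∈ H → 0 ≤ h → X + h ≤ ((u n).1 : RealGerm) := fun n h hh h0 =>
    le_of_not_isExpBounded hM hHM (u n).1.2 (u n).2 hh h0
  have htwo : ∀ n, (2 : M) ≤ (u n).1 := fun n => by
    have h1 : (2 : RealGerm) ≤ X := by
      change ∀ᶠ t in atTop, (2 : ℝ) ≤ t
      exact eventually_ge_atTop 2
    have h2 := hle n 0 H.zero_mem le_rfl
    rw [add_zero] at h2
    exact h1.trans h2
  have habs : ∀ n (w : H), |algebraMap H M w| ≤ (u n).1 := by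
    intro n w
    have key : ∀ w : H, 0 ≤ algebraMap H M w → algebraMap H M w ≤ (u n).1 := by
      intro w h0
      have h1 : (w : RealGerm) ≤ X + w := le_add_of_nonneg_left X_nonneg
      exact h1.trans (hle n w w.2 h0)
    rcases le_total 0 (algebraMap H M w) with h0 | h0
    · rw [abs_of_nonneg h0]
      exact key w h0
    · rw [abs_of_nonpos h0, ← map_neg]
      exact key (-w) (by rw [map_neg]; exact neg_nonneg.2 h0)
  -- The lower bound for `|w|` is the upper bound for its inverse, available since `H` is a field.
  have hdom : ∀ n, Dominates H (u n).1 := by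
    refine fun n => ⟨htwo n, fun w hw => ⟨habs n w, ?_⟩⟩
    obtain ⟨v, hv⟩ := hH.isField.mul_inv_cancel hw
    have h1 : |algebraMap H M w| * |algebraMap H M v| = 1 := by
      rw [← abs_mul, ← map_mul, hv, map_one, abs_one]
    calc (1 : M) = |algebraMap H M w| * |algebraMap H M v| := h1.symm
      _ ≤ _ := mul_le_mul_of_nonneg_left (habs n v) (abs_nonneg _)
  have hind : AlgebraicIndependent H fun n => (u n).1 := by
    refine algebraicIndependent_of_dominates hdom fun n m => ?_
    rw [hstep]
    exact (hL (u n)).2.2.2 m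
  -- The closure of `S` is a differential field containing `y`, hence all the quotients `u (n + 1) =
  -- (u n)' / u n`; its transcendence degree is finite.
  obtain ⟨S, hS, hSd, hyS⟩ := (isDAlgebraic_iff_isDiffFinite hH hM.1 hHM hy).1 hd
  refine not_algebraicIndependent_of_mem_algClosureAdjoin hS (y := fun n => (u n).1)
    (fun n => ?_) hind
  induction n with
  | zero => exact hyS
  | succ n ih =>
    have h0 : (u n).1 ≠ 0 := (lt_of_lt_of_le two_pos (htwo n)).ne'
    have h1 : (u (n + 1)).1 = hM.1.derivation (u n).1 * (u n).1⁻¹ := by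
      rw [hder, mul_assoc, mul_inv_cancel₀ h0, mul_one]
    change (u (n + 1)).1 ∈ _
    rw [h1]
    exact mul_mem (derivation_mem_algClosureAdjoin (derivation_algebraMap hH hM.1 hHM) hSd ih)
      (inv_mem_algClosureAdjoin ih)

/-! ### Adjoining the identity: when `K` is cofinal in `K(x)` -/

section Maximal

variable {M K : Subring RealGerm} (hM : Maximal IsHardyField M) (hK : IsHardyField K) (hKM : K ≤ M)
include hM hK hKM

/-- A Hardy field without infinite elements consists of constants. -/
theorem exists_infinite_or_forall_const :
    (∃ φ : ℝ → ℝ, (φ : RealGerm) ∈ K ∧ ∀ c, ∀ᶠ t in atTop, c < φ t) ∨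
      ∀ f ∈ K, ∃ c : ℝ, f = (fun _ => c : ℝ → ℝ) := by
  by_contra! hn
  obtain ⟨hn, f, hf, hfc⟩ := hn
  have hbd : ∀ φ : ℝ → ℝ, (φ : RealGerm) ∈ K → ∃ c, ∀ᶠ t in atTop, φ t ≤ c := by
    intro φ hφ
    obtain ⟨c, hc⟩ := hn φ hφ
    refine ⟨c, ?_⟩
    rcases hM.1.lt_or_ge (const_mem_of_maximal hM c) (hKM hφ) with h | h
    · obtain ⟨t, h1, h2⟩ := (hc.and_eventually h).exists
      exact absurd h2 (not_lt.2 h1)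
    · exact h
  -- If `φ' > 0`, its inverse lies in `K` and is bounded by some `c`. Then `φ' ≥ 1/c` and `φ` grows
  -- at least linearly, contrary to boundedness.
  have hpos : ∀ φ : ℝ → ℝ, (φ : RealGerm) ∈ K → ¬ ∀ᶠ t in atTop, 0 < deriv φ t := by
    intro φ hφ hp
    have hφd := hK.eventually_differentiableAt hφ
    have h0 : derivative (φ : RealGerm) ≠ 0 := fun h => by
      obtain ⟨t, h1, h2⟩ := (hp.and (coe_eq_zero_iff.1 h)).exists
      exact h1.ne' h2
    obtain ⟨g, hg, hinv⟩ := hK.exists_inv (hK.derivative_mem _ hφ) h0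
    obtain ⟨γ, rfl⟩ := exists_coe g
    have hinv' : ∀ᶠ t in atTop, deriv φ t * γ t = 1 := coe_eq_iff.1 hinv
    obtain ⟨c, hc⟩ := hbd γ hg
    obtain ⟨e, he⟩ := hbd φ hφ
    have hc0 : 0 < c := by
      obtain ⟨t, h1, h2, h3⟩ := (hc.and (hp.and hinv')).exists
      have : 0 < γ t := pos_of_mul_pos_right (by rw [h3]; exact one_pos) h2.le
      linarith
    have hder : ∀ᶠ t in atTop, HasDerivAt (fun t => φ t - t * c⁻¹) (deriv φ t - 1 * c⁻¹) t := by
      filter_upwards [hφd] with t h1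
      exact h1.hasDerivAt.sub ((hasDerivAt_id t).mul_const _)
    obtain ⟨b, hb⟩ := exists_le_of_deriv_nonneg (hder.mono fun t ht => ht.differentiableAt) (by
      filter_upwards [hder, hp, hinv', hc] with t h1 h2 h3 h4
      rw [h1.deriv, one_mul, sub_nonneg, inv_le_iff_one_le_mul₀ hc0, ← h3]
      gcongr)
    obtain ⟨t, h1, h2, h3⟩ := (hb.and (he.and (eventually_gt_atTop (c * (e - b))))).exists
    have h4 : e - b < t * c⁻¹ := by
      rw [← div_eq_mul_inv, lt_div_iff₀ hc0]
      linarith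
    linarith
  obtain ⟨φ, rfl⟩ := exists_coe f
  rcases hK.trichotomy (hK.derivative_mem _ hf) with h | h | h
  · obtain ⟨b, hb⟩ := eventually_atTop.1 ((hK.eventually_differentiableAt hf).and h)
    have hb' : ∀ t > b, HasDerivAt φ 0 t := fun t ht => by
      rw [← (hb t ht.le).2]
      exact (hb t ht.le).1.hasDerivAt
    refine hfc (φ (b + 1)) (coe_eq_iff.2 ?_)
    filter_upwards [eventually_gt_atTop b] with t ht
    exact eq_of_deriv_eq_zero hb' ht (lt_add_one b)
  · exact hpos φ hf h
  · refine hpos (-φ) (K.neg_mem hf) (h.mono fun t ht => ?_)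
    rw [deriv.neg]
    exact neg_pos.2 ht

/-- A Hardy field with an infinite element has an element above the identity. -/
theorem exists_X_le {φ : ℝ → ℝ} (hφ : (φ : RealGerm) ∈ K) (hinf : ∀ c, ∀ᶠ t in atTop, c < φ t) :
    ∃ g ∈ K, X ≤ g := by
  have hXM := X_mem_of_maximal hM
  have hφd := hK.eventually_differentiableAt hφ
  rcases hM.1.lt_or_ge (ψ := fun t => t) (M.mul_mem (hKM hφ) (hKM hφ) :
    ((fun t => φ t * φ t : ℝ → ℝ) : RealGerm) ∈ M) hXM with hlt | hge
  swap
  · exact ⟨_, K.mul_mem hφ hφ, hge⟩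
  have hp := eventually_deriv_pos_of_maximal hM (hKM hφ) hinf
  have h0 : derivative (φ : RealGerm) ≠ 0 := fun h => by
    obtain ⟨t, h1, h2⟩ := (hp.and (coe_eq_zero_iff.1 h)).exists
    exact h1.ne' h2
  obtain ⟨g, hg, hinv⟩ := hK.exists_inv (hK.derivative_mem _ hφ) h0
  obtain ⟨γ, rfl⟩ := exists_coe g
  have hinv' : ∀ᶠ t in atTop, deriv φ t * γ t = 1 := coe_eq_iff.1 hinv
  -- The witness is `φ / φ'`. If it were below `t`, then `φ'/φ > 1/t` would make `φ` at least a
  -- positive multiple of `t`, contradicting `φ² < t` with `φ` infinite.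
  refine ⟨_, K.mul_mem hφ hg, ?_⟩
  rcases hM.1.lt_or_ge (ψ := fun t => t) (M.mul_mem (hKM hφ) (hKM hg) :
    ((fun t => φ t * γ t : ℝ → ℝ) : RealGerm) ∈ M) hXM with hlt' | hge
  swap
  · exact hge
  exfalso
  have hder : ∀ᶠ t in atTop, HasDerivAt (fun t => Real.log (φ t) - Real.log t)
      (deriv φ t / φ t - 1 / t) t := by
    filter_upwards [hφd, hinf 0, eventually_gt_atTop 0] with t h1 h2 h3
    exact (h1.hasDerivAt.log h2.ne').sub ((hasDerivAt_id t).log h3.ne')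
  obtain ⟨b, hb⟩ := exists_le_of_deriv_nonneg (hder.mono fun t ht => ht.differentiableAt) (by
    filter_upwards [hder, hp, hinv', hlt', hinf 0, eventually_gt_atTop 0] with t h1 h2 h3 h4 h5 h6
    rw [h1.deriv, sub_nonneg, div_le_div_iff₀ h6 h5, one_mul]
    calc φ t = deriv φ t * (φ t * γ t) := by linear_combination -φ t * h3
      _ ≤ deriv φ t * t := by gcongr)
  obtain ⟨t, h1, h2, h3, h4, h5⟩ := (hb.and (hlt.and ((hinf 0).and
    ((hinf (Real.exp (-b))).and (eventually_gt_atTop 0))))).exists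
  have h6 : Real.log (φ t * φ t) < Real.log t := Real.log_lt_log (by positivity) h2
  rw [Real.log_mul h3.ne' h3.ne'] at h6
  have h7 : -b < Real.log (φ t) := (Real.lt_log_iff_exp_lt h3).2 h4
  linarith

omit hK hKM in
/-- A function smaller than the square of an infinitesimal `k` cannot have derivative above `k`. -/
theorem false_of_lt_sq_of_le_deriv {f k : ℝ → ℝ} (hf : (f : RealGerm) ∈ M)
    (hk : (k : RealGerm) ∈ M) (hpos : ∀ᶠ t in atTop, 0 < k t)
    (hzero : ∀ ε > 0, ∀ᶠ t in atTop, k t < ε) (hlt : ∀ᶠ t in atTop, |f t| < k t * k t)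
    (hder : ∀ᶠ t in atTop, k t ≤ deriv f t) : False := by
  have hfd := hM.1.eventually_differentiableAt hf
  have hkd := hM.1.eventually_differentiableAt hk
  -- A positive function cannot keep a slope below `-1/2`. Hence `(f + k²)' ≥ k + 2 k k' ≥ 0`,
  -- whereas `f + k²` is positive and tends to 0.
  have hslope : ∀ᶠ t in atTop, -(1 / 2) ≤ deriv k t := by
    rcases hM.1.lt_or_ge (hM.1.derivative_mem _ hk) (const_mem_of_maximal hM (-(1 / 2)))
      with h | h
    swap
    · exact h
    exfalso
    have hd : ∀ᶠ t in atTop, HasDerivAt (fun t => -k t - t * (1 / 2)) (-deriv k t - 1 * (1 / 2)) t := by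
      filter_upwards [hkd] with t h1
      exact h1.hasDerivAt.fun_neg.sub ((hasDerivAt_id t).mul_const _)
    obtain ⟨b, hb⟩ := exists_le_of_deriv_nonneg (hd.mono fun t ht => ht.differentiableAt) (by
      filter_upwards [hd, h] with t h1 h2
      rw [h1.deriv]
      linarith)
    obtain ⟨t, h1, h2, h3⟩ := (hb.and (hpos.and (eventually_gt_atTop (-2 * b)))).exists
    linarith
  have hd : ∀ᶠ t in atTop, HasDerivAt (fun t => f t + k t * k t)
      (deriv f t + (deriv k t * k t + k t * deriv k t)) t := by
    filter_upwards [hfd, hkd] with t h1 h2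
    exact h1.hasDerivAt.add (h2.hasDerivAt.mul h2.hasDerivAt)
  obtain ⟨b, hb⟩ := eventually_monotone (hd.mono fun t ht => ht.differentiableAt) (by
    filter_upwards [hd, hder, hpos, hslope] with t h1 h2 h3 h4
    rw [h1.deriv]
    nlinarith)
  obtain ⟨s, h1, h2⟩ := (hlt.and (eventually_gt_atTop b)).exists
  have h3 : 0 < f s + k s * k s := by
    have := neg_abs_le (f s)
    linarith
  set ε := f s + k s * k s with hε
  obtain ⟨t, h4, h5, h6, h7, h8⟩ := (hlt.and ((hzero 1 one_pos).and
    ((hzero (ε / 2) (by positivity)).and (hpos.and (eventually_gt_atTop s))))).exists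
  have h9 : ε ≤ f t + k t * k t := hb h2 (h2.trans h8) h8.le
  have h10 := le_abs_self (f t)
  have h11 : k t * k t ≤ k t := mul_le_of_le_one_left h7.le h5.le
  linarith

omit hM hK hKM in
-- Differentiating the coefficients kills the leading 1, so the derivative of a monic expression in
-- `x` has lower degree; this drives the induction below.
theorem derivative_coeff_natDegree_of_monic {p : K[X]} (hK : IsHardyField K) (hp : p.Monic) {q : K[X]}
    (hq : ∀ i, q.coeff i = hK.derivation (p.coeff i)) {i : ℕ} (hi : p.natDegree ≤ i) :
    q.coeff i = 0 := by
  rw [hq]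
  rcases hi.eq_or_lt with h | h
  · rw [← h, hp.coeff_natDegree, hK.derivation.map_one_eq_zero]
  · rw [coeff_eq_zero_of_natDegree_lt h, map_zero]

/-- Nonzero polynomial expressions in the identity over a Hardy field with an infinite element
are not infinitely small over that field. -/
theorem exists_pos_le_abs_aeval_X {φ : ℝ → ℝ} (hφ : (φ : RealGerm) ∈ K)
    (hinf : ∀ c, ∀ᶠ t in atTop, c < φ t) (p : K[X]) (hp : aeval X p ≠ 0) :
    ∃ k : ℝ → ℝ, (k : RealGerm) ∈ K ∧ (∀ᶠ t in atTop, 0 < k t) ∧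
      ∀ f : ℝ → ℝ, (f : RealGerm) = aeval X p → ∀ᶠ t in atTop, k t ≤ |f t| := by
  induction hn : p.natDegree using Nat.strong_induction_on generalizing p with
  | _ n ih =>
    subst hn
    have haevalM : ∀ q : K[X], aeval X q ∈ M := by
      intro q
      rw [aeval_eq_sum_range]
      refine M.sum_mem fun i _ => ?_
      rw [Algebra.smul_def]
      exact M.mul_mem (hKM (q.coeff i).2) (M.pow_mem (X_mem_of_maximal hM) i)
    have hinv_inf : ∀ ψ : ℝ → ℝ, (ψ : RealGerm) ∈ K → (∀ᶠ t in atTop, 0 < ψ t) →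
        ((fun t => (ψ t)⁻¹ : ℝ → ℝ) : RealGerm) ∈ K := by
      intro ψ hψ hpos
      have h0 : (ψ : RealGerm) ≠ 0 := fun h => by
        obtain ⟨t, h1, h2⟩ := (hpos.and (coe_eq_zero_iff.1 h)).exists
        exact h1.ne' h2
      obtain ⟨g, hg, hinv⟩ := hK.exists_inv hψ h0
      obtain ⟨γ, rfl⟩ := exists_coe g
      have hinv' : ∀ᶠ t in atTop, ψ t * γ t = 1 := coe_eq_iff.1 hinv
      convert! hg using 1
      exact coe_eq_iff.2 (hinv'.mono fun t ht => inv_eq_of_mul_eq_one_right ht)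
    have hmonic : ∀ p' : K[X], p'.Monic → aeval X p' ≠ 0 → p'.natDegree = p.natDegree →
        ∃ k : ℝ → ℝ, (k : RealGerm) ∈ K ∧ (∀ᶠ t in atTop, 0 < k t) ∧
          ∀ f : ℝ → ℝ, (f : RealGerm) = aeval X p' → ∀ᶠ t in atTop, k t ≤ |f t| := by
      clear hp
      intro p' hmon hp hpd
      rw [← hpd] at ih
      clear hpd
      obtain ⟨f, hf⟩ := exists_coe (aeval X p')
      have hfM : (f : RealGerm) ∈ M := hf ▸ haevalM p'
      -- Otherwise `f` is smaller in absolute value than every positive element of `K`.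
      by_contra! hcon
      have hsmall : ∀ k : ℝ → ℝ, (k : RealGerm) ∈ K → (∀ᶠ t in atTop, 0 < k t) →
          ∀ᶠ t in atTop, |f t| < k t := by
        intro k hk hpos
        obtain ⟨f', hf', hlt⟩ := hcon k hk hpos
        have hff' : ∀ᶠ t in atTop, f' t = f t := coe_eq_iff.1 (hf'.trans hf.symm)
        rcases hM.1.lt_or_ge hfM (hKM hk) with h1 | h1
        swap
        · exfalso
          refine hlt ?_
          filter_upwards [hff', h1] with t h2 h3
          rw [h2]
          exact not_lt.2 (h3.trans (le_abs_self _))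
        rcases hM.1.lt_or_ge (φ := fun t => - f t) (M.neg_mem hfM) (hKM hk) with h1' | h1'
        swap
        · exfalso
          refine hlt ?_
          filter_upwards [hff', h1'] with t h2 h3
          rw [h2]
          exact not_lt.2 (h3.trans (neg_le_abs _))
        filter_upwards [h1, h1'] with t h2 h3
        exact abs_lt.2 ⟨by linarith, h2⟩
      obtain ⟨q, hq, hder⟩ := hK.derivative_aeval evDiff_X p'
      rw [derivative_X, mul_one, ← map_add, ← hf] at hder
      have hfd := hM.1.eventually_differentiableAt hfM
      -- If `f' = 0`, then `f` is a nonzero constant, which is not below the infinitesimal `1/φ`.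
      by_cases hz : aeval X (q + Polynomial.derivative p') = 0
      · rw [hz] at hder
        have hder' : ∀ᶠ t in atTop, deriv f t = 0 := coe_eq_zero_iff.1 hder
        obtain ⟨b, hb⟩ := eventually_atTop.1 (hfd.and hder')
        have hb' : ∀ t > b, HasDerivAt f 0 t := fun t ht => by
          rw [← (hb t ht.le).2]
          exact (hb t ht.le).1.hasDerivAt
        have hc : ∀ᶠ t in atTop, f t = f (b + 1) := by
          filter_upwards [eventually_gt_atTop b] with t ht
          exact eq_of_deriv_eq_zero hb' ht (lt_add_one b)
        have hc0 : f (b + 1) ≠ 0 := fun h => hp (by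
          rw [← hf, coe_eq_zero_iff]
          exact hc.mono fun t ht => ht.trans h)
        obtain ⟨t, h1, h2, h3, h4⟩ := (hc.and ((hsmall _ (hinv_inf φ hφ (hinf 0))
          ((hinf 0).mono fun t ht => inv_pos.2 ht)).and
          ((hinf |f (b + 1)|⁻¹).and (hinf 0)))).exists
        rw [h1] at h2
        have := (inv_lt_comm₀ (abs_pos.2 hc0) h4).1 h3
        exact lt_asymm h2 this
      · have hdeg0 : p'.natDegree ≠ 0 := by
          intro h0
          apply hz
          have hp1 := hmon.natDegree_eq_zero.1 h0
          have hq0 : q = 0 := by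
            ext1 i
            rw [derivative_coeff_natDegree_of_monic hK hmon hq (by rw [h0]; exact Nat.zero_le i),
              coeff_zero]
          rw [hq0, hp1, Polynomial.derivative_one, add_zero, map_zero]
        have hdeg : (q + Polynomial.derivative p').natDegree < p'.natDegree := by
          refine lt_of_le_of_lt (natDegree_add_le _ _) (max_lt ?_ (natDegree_derivative_lt hdeg0))
          by_contra! hle
          have hq0 : q = 0 := leadingCoeff_eq_zero.1
            (derivative_coeff_natDegree_of_monic hK hmon hq hle)
          rw [hq0, natDegree_zero] at hle
          exact hdeg0 (Nat.le_zero.1 hle)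
        obtain ⟨k, hk, hkpos, hkle⟩ := ih _ hdeg _ hz rfl
        have hkle' := hkle (deriv f) hder
        -- By induction `|f'| ≥ k`. The element `1/(1/k + φ)` of `K` is at most `k` and
        -- infinitesimal, and `|f|` is below its square.
        have hsum : ((fun t => (k t)⁻¹ + φ t : ℝ → ℝ) : RealGerm) ∈ K :=
          K.add_mem (hinv_inf k hk hkpos) hφ
        have hsum0 : ∀ᶠ t in atTop, 0 < (k t)⁻¹ + φ t := by
          filter_upwards [hkpos, hinf 0] with t h1 h2
          positivity
        have hκ := hinv_inf _ hsum hsum0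
        have hκpos : ∀ᶠ t in atTop, 0 < ((k t)⁻¹ + φ t)⁻¹ := hsum0.mono fun t ht => inv_pos.2 ht
        have hκzero : ∀ ε > 0, ∀ᶠ t in atTop, ((k t)⁻¹ + φ t)⁻¹ < ε := by
          intro ε hε
          filter_upwards [hkpos, hinf ε⁻¹, hsum0] with t h1 h2 h3
          rw [inv_lt_comm₀ h3 hε]
          have := inv_pos.2 h1
          linarith
        have hκlek : ∀ᶠ t in atTop, ((k t)⁻¹ + φ t)⁻¹ ≤ k t := by
          filter_upwards [hkpos, hinf 0, hsum0] with t h1 h2 h3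
          rw [inv_le_comm₀ h3 h1]
          linarith
        have hκlt := hsmall (fun t => ((k t)⁻¹ + φ t)⁻¹ * ((k t)⁻¹ + φ t)⁻¹)
          (K.mul_mem hκ hκ) (hκpos.mono fun t ht => mul_pos ht ht)
        rcases hM.1.trichotomy (hM.1.derivative_mem _ hfM) with h | h | h
        · exact hz (hder.symm.trans (coe_eq_zero_iff.2 h))
        · refine false_of_lt_sq_of_le_deriv hM hfM (hKM hκ) hκpos hκzero hκlt ?_
          filter_upwards [h, hκlek, hkle'] with t h1 h2 h3
          rw [abs_of_pos h1] at h3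
          exact h2.trans h3
        · refine false_of_lt_sq_of_le_deriv hM (f := -f) (M.neg_mem hfM) (hKM hκ) hκpos hκzero ?_ ?_
          · filter_upwards [hκlt] with t h1
            rwa [Pi.neg_apply, abs_neg]
          · filter_upwards [h, hκlek, hkle'] with t h1 h2 h3
            rw [deriv.neg]
            rw [abs_of_neg h1] at h3
            exact h2.trans h3
    let _ := hK.field
    have hp0 : p ≠ 0 := by
      rintro rfl
      exact hp (map_zero _)
    have hl : p.leadingCoeff ≠ 0 := leadingCoeff_ne_zero.2 hp0
    have hli : p.leadingCoeff * p.leadingCoeff⁻¹ = 1 := mul_inv_cancel₀ hl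
    have heq : p = C p.leadingCoeff * (p * C p.leadingCoeff⁻¹) := by
      rw [mul_comm p, ← mul_assoc, ← C_mul, hli, C_1, one_mul]
    have hq0 : aeval X (p * C p.leadingCoeff⁻¹) ≠ 0 := fun h => hp (by
      rw [heq, map_mul, h, mul_zero])
    obtain ⟨k, hk, hkpos, hkle⟩ := hmonic _ (monic_mul_leadingCoeff_inv hp0) hq0
      (natDegree_mul_leadingCoeff_inv p hp0)
    obtain ⟨l, hlc⟩ := exists_coe (p.leadingCoeff : RealGerm)
    obtain ⟨g, hg⟩ := exists_coe (aeval X (p * C p.leadingCoeff⁻¹))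
    have hlK : (l : RealGerm) ∈ K := hlc ▸ p.leadingCoeff.2
    have hfl : ∀ f : ℝ → ℝ, (f : RealGerm) = aeval X p → ∀ᶠ t in atTop, f t = l t * g t := by
      intro f hf
      refine coe_eq_iff.1 (hf.trans ?_)
      conv_lhs => rw [heq, map_mul, aeval_C, ← hg]
      change (p.leadingCoeff : RealGerm) * _ = _
      rw [← hlc]
      rfl
    rcases hK.trichotomy hlK with h | h | h
    · refine absurd (Subtype.ext ?_) hl
      exact hlc.symm.trans (coe_eq_zero_iff.2 h)
    · refine ⟨fun t => l t * k t, K.mul_mem hlK hk, ?_, fun f hf => ?_⟩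
      · filter_upwards [h, hkpos] with t h1 h2 using mul_pos h1 h2
      · filter_upwards [h, hkle g hg, hfl f hf] with t h1 h2 h3
        rw [h3, abs_mul, abs_of_pos h1]
        gcongr
    · refine ⟨fun t => -l t * k t, K.mul_mem (K.neg_mem hlK) hk, ?_, fun f hf => ?_⟩
      · filter_upwards [h, hkpos] with t h1 h2 using mul_pos (neg_pos.2 h1) h2
      · filter_upwards [h, hkle g hg, hfl f hf] with t h1 h2 h3
        rw [h3, abs_mul, abs_of_neg h1]
        have := neg_pos.2 h1
        gcongr

end Maximal

/-! ### Bounding elements of `K(x)` by elements of `K` -/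

theorem subset_adjoin (F : Subring RealGerm) (S : Set RealGerm) : S ⊆ adjoin F S :=
  fun _ hs => Subring.mem_sInf.2 fun _ hK => hK.2.2 hs

theorem le_adjoin (F : Subring RealGerm) (S : Set RealGerm) : F ≤ adjoin F S :=
  fun _ hs => Subring.mem_sInf.2 fun _ hK => hK.2.1 hs

theorem adjoin_le {F K : Subring RealGerm} {S : Set RealGerm} (hK : IsField K) (hF : F ≤ K)
    (hS : S ⊆ K) : adjoin F S ≤ K := sInf_le ⟨hK, hF, hS⟩

section Maximal

variable {M K : Subring RealGerm} (hM : Maximal IsHardyField M) (hK : IsHardyField K) (hKM : K ≤ M)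
include hM hKM

theorem aeval_X_mem (q : K[X]) : aeval X q ∈ M := by
  rw [aeval_eq_sum_range]
  refine M.sum_mem fun i _ => ?_
  rw [Algebra.smul_def]
  exact M.mul_mem (hKM (q.coeff i).2) (M.pow_mem (X_mem_of_maximal hM) i)

theorem exists_of_mem_adjoin_X {z : RealGerm} (hz : z ∈ adjoin K {X}) :
    ∃ p q : K[X], aeval X q ≠ 0 ∧ z * aeval X q = aeval X p := by
  set R : Subring RealGerm := (aeval X : K[X] →ₐ[K] RealGerm).range.toSubring with hR
  have hle : adjoin K {X} ≤ quotientSubring R := by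
    refine adjoin_le (isField_quotientSubring ?_) ?_ ?_
    · rintro _ ⟨p, rfl⟩ h0
      exact hM.1.isUnit (aeval_X_mem hM hKM p) h0
    · refine le_trans (fun a ha => ?_) (le_quotientSubring R)
      exact ⟨C ⟨a, ha⟩, aeval_C ..⟩
    · rw [singleton_subset_iff]
      exact le_quotientSubring R ⟨Polynomial.X, aeval_X _⟩
  obtain ⟨_, ⟨p, rfl⟩, _, ⟨q, rfl⟩, hu, h⟩ := hle hz
  exact ⟨p, q, hu.ne_zero, h⟩

include hK

omit hM hKM in
/-- Polynomial expressions in the identity are bounded over a Hardy field having an element above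
the identity. -/
theorem exists_aeval_X_le {g : RealGerm} (hg : g ∈ K) (hXg : X ≤ g) (p : K[X]) :
    ∃ k ∈ K, 0 ≤ k ∧ -k ≤ aeval X p ∧ aeval X p ≤ k := by
  have hC : ∀ a ∈ K, ∃ k ∈ K, 0 ≤ k ∧ -k ≤ a ∧ a ≤ k := by
    intro a ha
    rcases hK.le_total K.zero_mem ha with h | h
    · exact ⟨a, ha, h, (neg_nonpos.2 h).trans h, le_rfl⟩
    · exact ⟨-a, K.neg_mem ha, neg_nonneg.2 h, (neg_neg a).le, h.trans (neg_nonneg.2 h)⟩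
  induction p using Polynomial.induction_on with
  | C a =>
    rw [aeval_C]
    exact hC a a.2
  | add p q hp hq =>
    obtain ⟨k, hk, h1, h2, h3⟩ := hp
    obtain ⟨l, hl, h4, h5, h6⟩ := hq
    refine ⟨k + l, K.add_mem hk hl, add_nonneg h1 h4, ?_, ?_⟩
    · rw [map_add, neg_add]
      exact add_le_add h2 h5
    · rw [map_add]
      exact add_le_add h3 h6
  | monomial n a ih =>
    obtain ⟨k, hk, h1, h2, h3⟩ := ih
    refine ⟨k * g, K.mul_mem hk hg, mul_nonneg h1 (X_nonneg.trans hXg), ?_, ?_⟩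
    all_goals rw [pow_succ, ← mul_assoc, map_mul, aeval_X]
    · have h4 : -k * X ≤ aeval X (C a * Polynomial.X ^ n) * X :=
        mul_le_mul_of_nonneg_right h2 X_nonneg
      have h5 : k * X ≤ k * g := mul_le_mul_of_nonneg_left hXg h1
      refine le_trans ?_ h4
      rw [neg_mul]
      exact neg_le_neg h5
    · exact mul_le_mul h3 hXg X_nonneg h1

/-- If `K(x)` is closed under exponentiation, then `K` is not a field of constants. -/
theorem not_expClosed_of_forall_const (hc : ∀ f ∈ K, ∃ c : ℝ, f = (fun _ => c : ℝ → ℝ)) :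
    ¬ ExpClosed (adjoin K {X}) := by
  intro hexp
  have hXa : X ∈ adjoin K {X} := subset_adjoin K {X} rfl
  obtain ⟨p, q, hq, hpq⟩ := exists_of_mem_adjoin_X hM hKM (hexp X hXa)
  let _ := hM.1.field
  let _ := hM.1.linearOrder
  have := hM.1.isStrictOrderedRing
  let _ := extensionAlgebra hKM
  have hXM := X_mem_of_maximal hM
  let x : M := ⟨X, hXM⟩
  have habs : ∀ w : K, |algebraMap K M w| ≤ x := by
    intro w
    obtain ⟨c, hc⟩ := hc w w.2
    refine abs_le'.2 ⟨?_, ?_⟩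
    · change (w : RealGerm) ≤ X
      rw [hc]
      exact eventually_ge_atTop c
    · change -(w : RealGerm) ≤ X
      rw [hc]
      exact eventually_ge_atTop (-c)
  have hdom : Dominates K x := by
    refine ⟨?_, fun w hw => ⟨habs w, ?_⟩⟩
    · change ∀ᶠ t in atTop, (2 : ℝ) ≤ t
      exact eventually_ge_atTop 2
    obtain ⟨v, hv⟩ := hK.isField.mul_inv_cancel hw
    have h1 : |algebraMap K M w| * |algebraMap K M v| = 1 := by
      rw [← abs_mul, ← map_mul, hv, map_one, abs_one]
    calc (1 : M) = |algebraMap K M w| * |algebraMap K M v| := h1.symm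
      _ ≤ _ := mul_le_mul_of_nonneg_left (habs v) (abs_nonneg _)
  let f : M →ₐ[K] RealGerm := { M.subtype with commutes' := fun _ => rfl }
  have hcoe : ∀ r : K[X], ((aeval x r : M) : RealGerm) = aeval X r := fun r =>
    (aeval_algHom_apply f x r).symm
  have hq0 : q ≠ 0 := by
    rintro rfl
    exact hq (map_zero _)
  have h1 := hdom.one_le_abs_aeval_mul hq0
  have h2 := hdom.abs_aeval_le p
  let e : M := ⟨exp X, expClosed_of_maximal hM X hXM⟩
  have he : e * aeval x q = aeval x p := Subtype.ext (by
    rw [Subring.coe_mul, hcoe, hcoe]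
    exact hpq)
  have he0 : 0 ≤ e := by
    change ∀ᶠ t in atTop, 0 ≤ Real.exp t
    exact Eventually.of_forall fun t => (Real.exp_pos t).le
  have hx0 : 0 ≤ x := le_trans zero_le_two hdom.1
  -- The identity dominates a field of constants: `|q(x)| ≥ 1/x`, and `|p(x)|` is at most a power of
  -- `x`.
  have h3 : e ≤ x ^ (p.natDegree + 3) := by
    calc e ≤ e * (|aeval x q| * x) := le_mul_of_one_le_right he0 h1
      _ = |e * aeval x q| * x := by rw [abs_mul, abs_of_nonneg he0, mul_assoc]
      _ ≤ x ^ (p.natDegree + 2) * x := by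
        rw [he]
        exact mul_le_mul_of_nonneg_right h2 hx0
      _ = _ := (pow_succ _ _).symm
  have h4 : ∀ᶠ t in atTop, Real.exp t ≤ t ^ (p.natDegree + 3) := h3
  have h5 := (Real.tendsto_exp_div_pow_atTop (p.natDegree + 3)).eventually_gt_atTop 1
  obtain ⟨t, h6, h7, h8⟩ := (h4.and (h5.and (eventually_gt_atTop 0))).exists
  rw [lt_div_iff₀ (by positivity), one_mul] at h7
  exact absurd h6 (not_le.2 h7)

/-- If `K(x)` is closed under exponentiation, then `K` is cofinal in `K(x)`. -/
theorem exists_le_of_mem_adjoin_X (hexp : ExpClosed (adjoin K {X})) {z : RealGerm}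
    (hz : z ∈ adjoin K {X}) : ∃ k ∈ K, z ≤ k := by
  rcases exists_infinite_or_forall_const hM hK hKM with ⟨φ, hφ, hinf⟩ | hc
  swap
  · exact absurd hexp (not_expClosed_of_forall_const hM hK hKM hc)
  obtain ⟨g, hg, hXg⟩ := exists_X_le hM hK hKM hφ hinf
  obtain ⟨p, q, hq, hpq⟩ := exists_of_mem_adjoin_X hM hKM hz
  obtain ⟨k, hk, hkpos, hkle⟩ := exists_pos_le_abs_aeval_X hM hK hKM hφ hinf q hq
  obtain ⟨l, hl, -, hl1, hl2⟩ := exists_aeval_X_le hK hg hXg p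
  have hk0 : (k : RealGerm) ≠ 0 := fun h => by
    obtain ⟨t, h1, h2⟩ := (hkpos.and (coe_eq_zero_iff.1 h)).exists
    exact h1.ne' h2
  obtain ⟨j, hj, hkj⟩ := hK.exists_inv hk hk0
  -- For `z = p(x)/q(x)` with `|p(x)| ≤ l` and `|q(x)| ≥ k`, the bound is `l / k`.
  refine ⟨l * j, K.mul_mem hl hj, ?_⟩
  obtain ⟨ζ, rfl⟩ := exists_coe z
  obtain ⟨a, ha⟩ := exists_coe (aeval X p)
  obtain ⟨b, hb⟩ := exists_coe (aeval X q)
  obtain ⟨l, rfl⟩ := exists_coe l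
  obtain ⟨j, rfl⟩ := exists_coe j
  rw [← ha] at hl1 hl2 hpq
  rw [← hb] at hpq
  have e1 : ∀ᶠ t in atTop, -l t ≤ a t := hl1
  have e2 : ∀ᶠ t in atTop, a t ≤ l t := hl2
  have e3 : ∀ᶠ t in atTop, ζ t * b t = a t := coe_eq_iff.1 hpq
  have e4 : ∀ᶠ t in atTop, k t * j t = 1 := coe_eq_iff.1 hkj
  change ∀ᶠ t in atTop, ζ t ≤ l t * j t
  filter_upwards [e1, e2, e3, e4, hkpos, hkle b hb] with t h1 h2 h3 h4 h5 h6
  have h7 : |ζ t| * k t ≤ l t := by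
    calc |ζ t| * k t ≤ |ζ t| * |b t| := by gcongr
      _ = |a t| := by rw [← abs_mul, h3]
      _ ≤ l t := abs_le.2 ⟨h1, h2⟩
  have h8 : 0 < j t := pos_of_mul_pos_right (by rw [h4]; exact one_pos) h5.le
  calc ζ t ≤ |ζ t| := le_abs_self _
    _ = |ζ t| * k t * j t := by rw [mul_assoc, h4, mul_one]
    _ ≤ l t * j t := by gcongr

theorem exists_iterate_exp_le (hexp : ExpClosed (adjoin K {X})) {h : RealGerm} (hh : h ∈ K)
    (n : ℕ) : ∃ k ∈ K, exp^[n] (X + h) ≤ k := by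
  refine exists_le_of_mem_adjoin_X hM hK hKM hexp (hexp.iterate_mem ?_ n)
  exact Subring.add_mem _ (subset_adjoin K {X} rfl) (le_adjoin K {X} hh)

end Maximal

/-! ### Comparison of cofinalities -/

theorem IsHardyField.aleph0_le_cof {K : Subring RealGerm} (hK : IsHardyField K) :
    Cardinal.aleph0 ≤ Order.cof K := by
  let _ := hK.field
  let _ := hK.linearOrder
  have := hK.isStrictOrderedRing
  exact Order.aleph0_le_cof

/-- A Hardy field that is differentially algebraic over `H` and closed under exponentiation up to
adjoining the identity has cofinality at most that of `H`. -/
theorem cof_le_of_isDAlgebraic {H E : Subring RealGerm} (hH : IsHardyField H)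
    (hE : IsHardyField E) (hHE : H ≤ E) (hd : ∀ y ∈ E, IsDAlgebraic H y)
    (hexp : ExpClosed (adjoin E {X})) : Order.cof E ≤ Order.cof H := by
  obtain ⟨M, hM, hEM⟩ := hE.exists_maximal
  obtain ⟨s, hs, hcard⟩ := Order.exists_cof_eq H
  -- For each `n` and each `h` in the cofinal subset of `H`, an element of `E` above `exp^[n] (x +
  -- h)` is chosen.
  choose e he hle using fun i : ℕ × s =>
    exists_iterate_exp_le hM hE hEM hexp (hHE i.2.1.2) i.1
  have hcof : IsCofinal (range fun i : ℕ × s => (⟨e i, he i⟩ : E)) := by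
    rintro ⟨y, hy⟩
    obtain ⟨n, h, hh, -, hyh⟩ :=
      isExpBounded_of_isDAlgebraic hM hH (hHE.trans hEM) (hEM hy) (hd y hy)
    obtain ⟨h', hh', hhh'⟩ := hs ⟨h, hh⟩
    refine ⟨_, mem_range_self (n, ⟨h', hh'⟩), ?_⟩
    change y ≤ e (n, ⟨h', hh'⟩)
    refine hyh.trans ((iterate_exp_le_iterate_exp ?_ n).trans (hle (n, ⟨h', hh'⟩)))
    exact add_le_add le_rfl hhh'
  refine (Order.cof_le hcof).trans (Cardinal.mk_range_le.trans ?_)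
  rw [Cardinal.mk_prod, Cardinal.lift_id, Cardinal.lift_id, hcard, Cardinal.mk_nat]
  exact Cardinal.mul_le_of_le hH.aleph0_le_cof hH.aleph0_le_cof le_rfl

/-- Here the bounds `exp^[n] (x + h)` are dominated by elements of `H`, so `H` is cofinal in `E`. -/
theorem cof_eq_of_isDAlgebraic {H E : Subring RealGerm} (hH : IsHardyField H)
    (hE : IsHardyField E) (hHE : H ≤ E) (hd : ∀ y ∈ E, IsDAlgebraic H y)
    (hexp : ExpClosed (adjoin H {X})) : Order.cof E = Order.cof H := by
  obtain ⟨M, hM, hEM⟩ := hE.exists_maximal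
  let _ := hH.linearOrder
  let _ := hE.linearOrder
  refine (Order.cof_congr_of_strictMono (f := Subring.inclusion hHE)
    (fun a b hab => hab) ?_).symm
  rintro ⟨y, hy⟩
  obtain ⟨n, h, hh, -, hyh⟩ :=
    isExpBounded_of_isDAlgebraic hM hH (hHE.trans hEM) (hEM hy) (hd y hy)
  obtain ⟨k, hk, hle⟩ := exists_iterate_exp_le hM hH (hHE.trans hEM) hexp hh n
  exact ⟨Subring.inclusion hHE ⟨k, hk⟩, mem_range_self _, hyh.trans hle⟩

theorem expClosed_adjoin_X {K : Subring RealGerm} (hK : IsField K) (hX : X ∈ K)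
    (hexp : ExpClosed K) : ExpClosed (adjoin K {X}) := fun f hf =>
  le_adjoin K {X} (hexp f (adjoin_le hK le_rfl (singleton_subset_iff.2 hX) hf))

/-- Differentially algebraic Hardy field extensions containing the identity and closed under
exponentiation preserve countable cofinality. -/
theorem cof_eq_aleph0 {H E : Subring RealGerm} (hH : IsHardyField H) (hE : IsHardyField E)
    (hHE : H ≤ E) (hd : ∀ y ∈ E, IsDAlgebraic H y) (hX : X ∈ E) (hexp : ExpClosed E)
    (hcof : Order.cof H = Cardinal.aleph0) : Order.cof E = Cardinal.aleph0 := by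
  refine le_antisymm ?_ hE.aleph0_le_cof
  rw [← hcof]
  exact cof_le_of_isDAlgebraic hH hE hHE hd (expClosed_adjoin_X hE.isField hX hexp)

theorem exists_eq_const_of_derivative_eq_zero {f : RealGerm} (hf : EvDiff f)
    (h : derivative f = 0) : ∃ c : ℝ, f = (fun _ => c : ℝ → ℝ) := by
  obtain ⟨φ, hφ, rfl⟩ := hf
  obtain ⟨b, hb⟩ := eventually_atTop.1 (hφ.and (coe_eq_zero_iff.1 h))
  have hb' : ∀ t > b, HasDerivAt φ 0 t := fun t ht => by
    rw [← (hb t ht.le).2]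
    exact (hb t ht.le).1.hasDerivAt
  refine ⟨φ (b + 1), coe_eq_iff.2 ?_⟩
  filter_upwards [eventually_gt_atTop b] with t ht
  exact eq_of_deriv_eq_zero hb' ht (lt_add_one b)

/-! ### Consequences of solving linear equations; the d-closure and `Li` -/

section LiouvilleClosed

variable {L : Subring RealGerm} (hL : IsHardyField L) (hc : constants ⊆ L)
  (hlin : ∀ f ∈ L, ∀ g ∈ L, ∃ y ∈ L, y ≠ 0 ∧ derivative y + f * y = g)
include hL hc hlin

/-- A solution of `y' = 1` differs from `x` by a real constant. -/
theorem X_mem_of_linear : X ∈ L := by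
  obtain ⟨y, hy, -, h⟩ := hlin 0 L.zero_mem 1 L.one_mem
  rw [zero_mul, add_zero] at h
  obtain ⟨M, hM, hLM⟩ := hL.exists_maximal
  have hXn : -X ∈ M := M.neg_mem (X_mem_of_maximal hM)
  have hdX : derivative (-X) = -1 := by
    have := derivative_add evDiff_X (hM.1.evDiff hXn)
    rw [add_neg_cancel, derivative_zero, derivative_X] at this
    linear_combination -this
  obtain ⟨c, hc'⟩ := exists_eq_const_of_derivative_eq_zero (f := y + -X)
    ((hL.evDiff hy).add (hM.1.evDiff hXn))
    (by rw [derivative_add (hL.evDiff hy) (hM.1.evDiff hXn), h, hdX, add_neg_cancel])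
  have : X = y - (fun _ => c : ℝ → ℝ) := by
    rw [← hc']
    ring
  rw [this]
  exact L.sub_mem hy (hc ⟨c, rfl⟩)

/-- A nonzero solution of `y' - f' y = 0` is a nonzero constant multiple of `exp f`. -/
theorem expClosed_of_linear : ExpClosed L := by
  intro f hf
  obtain ⟨y, hy, hy0, h⟩ := hlin (-derivative f) (L.neg_mem (hL.derivative_mem f hf)) 0 L.zero_mem
  have hn := hL.evDiff (L.neg_mem hf)
  have hf' := hL.evDiff hf
  have hyd := hL.evDiff hy
  have hdn : derivative (-f) = -derivative f := by
    have := derivative_add hf' hn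
    rw [add_neg_cancel, derivative_zero] at this
    linear_combination -this
  obtain ⟨c, hc'⟩ := exists_eq_const_of_derivative_eq_zero (f := y * exp (-f)) (hyd.mul hn.exp) (by
    rw [derivative_mul hyd hn.exp, derivative_exp hn, hdn]
    linear_combination exp (-f) * h)
  have hexp : exp f * exp (-f) = 1 := by
    obtain ⟨φ, rfl⟩ := exists_coe f
    refine coe_eq_iff.2 (Eventually.of_forall fun t => ?_)
    change Real.exp (φ t) * Real.exp (-φ t) = 1
    rw [← Real.exp_add, add_neg_cancel, Real.exp_zero]
  have hy' : y = (fun _ => c : ℝ → ℝ) * exp f := by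
    rw [← hc']
    linear_combination -y * hexp
  have hc0 : c ≠ 0 := by
    rintro rfl
    exact hy0 (hy'.trans (zero_mul _))
  have hcc : ((fun _ => c⁻¹ : ℝ → ℝ) : RealGerm) * (fun _ => c : ℝ → ℝ) = 1 :=
    coe_eq_iff.2 (Eventually.of_forall fun t => inv_mul_cancel₀ hc0)
  have : exp f = (fun _ => c⁻¹ : ℝ → ℝ) * y := by
    rw [hy', ← mul_assoc, hcc, one_mul]
  rw [this]
  exact L.mul_mem (hc ⟨_, rfl⟩) hy

end LiouvilleClosed

/-- The differential algebraic closure of `H` in a Hardy field `M`, as a ring of germs. -/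
noncomputable def dClosureSubring {H M : Subring RealGerm} (hM : IsHardyField M) (hHM : H ≤ M) :
    Subring RealGerm :=
  letI := hM.field
  letI := extensionAlgebra hHM
  haveI := faithfulSMul_extension hHM
  (diffClosure H hM.derivation).map M.subtype

section DClosure

variable {H M : Subring RealGerm}

theorem mem_dClosureSubring (hM : IsHardyField M) (hHM : H ≤ M) {y : RealGerm} :
    letI := hM.field
    letI := extensionAlgebra hHM
    haveI := faithfulSMul_extension hHM
    y ∈ dClosureSubring hM hHM ↔ ∃ hy : y ∈ M, ⟨y, hy⟩ ∈ diffClosure H hM.derivation := by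
  let _ := hM.field
  let _ := extensionAlgebra hHM
  have := faithfulSMul_extension hHM
  constructor
  · rintro ⟨z, hz, rfl⟩
    exact ⟨z.2, hz⟩
  · rintro ⟨hy, h⟩
    exact ⟨_, h, rfl⟩

theorem dClosureSubring_le (hM : IsHardyField M) (hHM : H ≤ M) : dClosureSubring hM hHM ≤ M :=
  fun _ hy => ((mem_dClosureSubring hM hHM).1 hy).1

theorem coe_dClosureSubring (hH : IsHardyField H) (hM : IsHardyField M) (hHM : H ≤ M) :
    (dClosureSubring hM hHM : Set RealGerm) = dClosure H M := by
  ext y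
  rw [SetLike.mem_coe, mem_dClosureSubring]
  constructor
  · rintro ⟨hy, h⟩
    exact ⟨hy, (isDAlgebraic_iff_isDiffFinite hH hM hHM hy).2 h⟩
  · rintro ⟨hy, h⟩
    exact ⟨hy, (isDAlgebraic_iff_isDiffFinite hH hM hHM hy).1 h⟩

theorem le_dClosureSubring (hM : IsHardyField M) (hHM : H ≤ M) : H ≤ dClosureSubring hM hHM := by
  let _ := hM.field
  let _ := extensionAlgebra hHM
  have := faithfulSMul_extension hHM
  exact fun h hh => (mem_dClosureSubring hM hHM).2
    ⟨hHM hh, algebraMap_mem_diffClosure (R := H) (F := M) ⟨h, hh⟩⟩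

theorem isHardyField_dClosureSubring (hH : IsHardyField H) (hM : IsHardyField M) (hHM : H ≤ M) :
    IsHardyField (dClosureSubring hM hHM) := by
  let _ := hM.field
  let _ := extensionAlgebra hHM
  have := faithfulSMul_extension hHM
  have := IsHardyField.charZero M
  refine ⟨fun f hf n => hM.isCn f (dClosureSubring_le hM hHM hf) n,
    isField_of_forall_exists fun f hf h0 => ?_, fun f hf => ?_⟩
  · obtain ⟨hfM, h⟩ := (mem_dClosureSubring hM hHM).1 hf
    have h1 := inv_mem_diffClosure h
    refine ⟨((⟨f, hfM⟩ : M)⁻¹ : M), (mem_dClosureSubring hM hHM).2 ⟨Subtype.property _, h1⟩, ?_⟩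
    have h2 : (⟨f, hfM⟩ : M) ≠ 0 := fun h => h0 congr(($h : RealGerm))
    exact congrArg (fun z : M => (z : RealGerm)) (mul_inv_cancel₀ h2)
  · obtain ⟨hfM, h⟩ := (mem_dClosureSubring hM hHM).1 hf
    exact (mem_dClosureSubring hM hHM).2 ⟨hM.derivative_mem f hfM,
      derivation_mem_diffClosure (derivation_algebraMap hH hM hHM) h⟩

theorem mem_dClosureSubring_of_isRoot (hM : IsHardyField M) (hHM : H ≤ M) {p : M[X]} (hp : p ≠ 0)
    (hc : ∀ i, (p.coeff i : RealGerm) ∈ dClosureSubring hM hHM) {z : M} (hz : p.eval z = 0) :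
    (z : RealGerm) ∈ dClosureSubring hM hHM := by
  let _ := hM.field
  let _ := extensionAlgebra hHM
  have := faithfulSMul_extension hHM
  exact (mem_dClosureSubring hM hHM).2 ⟨z.2, mem_diffClosure_of_isRoot hp
    (fun i => ((mem_dClosureSubring hM hHM).1 (hc i)).2) hz⟩

theorem mem_dClosureSubring_of_linear (hM : IsHardyField M) (hHM : H ≤ M) {f g y : RealGerm}
    (hf : f ∈ dClosureSubring hM hHM) (hg : g ∈ dClosureSubring hM hHM) (hy : y ∈ M)
    (h : derivative y + f * y = g) : y ∈ dClosureSubring hM hHM := by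
  let _ := hM.field
  let _ := extensionAlgebra hHM
  have := faithfulSMul_extension hHM
  obtain ⟨hfM, hf'⟩ := (mem_dClosureSubring hM hHM).1 hf
  obtain ⟨hgM, hg'⟩ := (mem_dClosureSubring hM hHM).1 hg
  exact (mem_dClosureSubring hM hHM).2 ⟨hy, mem_diffClosure_of_linear hf' hg' (Subtype.ext h)⟩

variable (hM : Maximal IsHardyField M)

theorem exists_linear_dClosureSubring (hHM : H ≤ M) :
    ∀ f ∈ dClosureSubring hM.1 hHM, ∀ g ∈ dClosureSubring hM.1 hHM,
      ∃ y ∈ dClosureSubring hM.1 hHM, y ≠ 0 ∧ derivative y + f * y = g := by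
  intro f hf g hg
  obtain ⟨y, hy, h0, h⟩ := exists_linear_of_maximal hM (dClosureSubring_le hM.1 hHM hf)
    (dClosureSubring_le hM.1 hHM hg)
  exact ⟨y, mem_dClosureSubring_of_linear hM.1 hHM hf hg hy h, h0, h⟩

theorem constants_subset_dClosureSubring (hHM : H ≤ M) :
    constants ⊆ dClosureSubring hM.1 hHM := by
  rintro _ ⟨c, rfl⟩
  exact mem_dClosureSubring_of_linear hM.1 hHM (Subring.zero_mem _) (Subring.zero_mem _)
    (const_mem_of_maximal hM c) (by rw [derivative_const, zero_mul, zero_add])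

/-- Square roots, odd degree roots and linear solutions exist in `M`; each is differentially
algebraic over the d-closure and hence belongs to it. -/
theorem isLiouvilleClosed_dClosureSubring (hH : IsHardyField H) (hHM : H ≤ M) :
    IsLiouvilleClosed (dClosureSubring hM.1 hHM) := by
  have hD := isHardyField_dClosureSubring hH hM.1 hHM
  refine ⟨⟨hD.isField, ?_⟩, exists_linear_dClosureSubring hM hHM⟩
  let _ := hD.field
  let _ := hD.linearOrder
  have := hD.isStrictOrderedRing
  have hle := dClosureSubring_le hM.1 hHM
  refine IsRealClosed.of_linearOrderedField ?_ ?_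
  · rintro ⟨f, hf⟩ h0
    obtain ⟨g, hg, hfg⟩ := exists_sqrt_of_maximal hM (hle hf) h0
    have hgD : g ∈ dClosureSubring hM.1 hHM := by
      refine mem_dClosureSubring_of_isRoot hM.1 hHM (z := ⟨g, hg⟩)
        (p := Polynomial.X ^ 2 - C ⟨f, hle hf⟩) (monic_X_pow_sub_C _ two_ne_zero).ne_zero
        (fun i => ?_) ?_
      · rw [coeff_sub, coeff_X_pow, coeff_C]
        refine Subring.sub_mem _ ?_ ?_
        · split_ifs
          · exact Subring.one_mem _
          · exact Subring.zero_mem _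
        · split_ifs
          · exact hf
          · exact Subring.zero_mem _
      · rw [eval_sub, eval_pow, eval_X, eval_C, sub_eq_zero, sq]
        exact Subtype.ext hfg.symm
    exact ⟨⟨g, hgD⟩, Subtype.ext hfg⟩
  · intro p hp
    have hinj : Function.Injective (Subring.inclusion hle) := Subring.inclusion_injective hle
    have hdeg : (p.map (Subring.inclusion hle)).natDegree = p.natDegree :=
      natDegree_map_eq_of_injective hinj p
    obtain ⟨z, hz⟩ := exists_isRoot_of_maximal hM (p := p.map (Subring.inclusion hle))
      (by rwa [hdeg])
    have hp0 : p.map (Subring.inclusion hle) ≠ 0 := by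
      intro h
      rw [h, natDegree_zero] at hdeg
      rw [← hdeg] at hp
      simp at hp
    have hzD : (z : RealGerm) ∈ dClosureSubring hM.1 hHM := by
      refine mem_dClosureSubring_of_isRoot hM.1 hHM hp0 (fun i => ?_) hz
      rw [coeff_map]
      exact (p.coeff i).2
    refine ⟨⟨z, hzD⟩, hinj ?_⟩
    have h1 : eval₂ (Subring.inclusion hle) (Subring.inclusion hle ⟨z, hzD⟩) p = 0 :=
      (eval_map _ _).symm.trans hz
    rw [map_zero, ← h1]
    exact (eval₂_at_apply _ _).symm

include hM in
theorem cof_dClosure (hH : IsHardyField H) (hHM : H ≤ M)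
    (hcof : Order.cof H = Cardinal.aleph0) : Order.cof (dClosure H M) = Cardinal.aleph0 := by
  rw [← coe_dClosureSubring hH hM.1 hHM]
  have hD := isHardyField_dClosureSubring hH hM.1 hHM
  have hc := constants_subset_dClosureSubring hM hHM
  have hlin := exists_linear_dClosureSubring hM hHM
  refine cof_eq_aleph0 hH hD (le_dClosureSubring hM.1 hHM) (fun y hy => ?_)
    (X_mem_of_linear hD hc hlin) (expClosed_of_linear hD hc hlin) hcof
  rw [← SetLike.mem_coe, coe_dClosureSubring hH hM.1 hHM] at hy
  exact hy.2

/-- The d-closure in a maximal Hardy field is one of the fields intersected, so `Li` is d-algebraic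
over `H`. Containing `x` and closure under `exp` hold in every member and so pass to the
intersection. -/
theorem cof_Li (hH : IsHardyField H) (hcof : Order.cof H = Cardinal.aleph0) :
    Order.cof (Li (adjoin H constants)) = Cardinal.aleph0 := by
  obtain ⟨M, hM, hHM⟩ := hH.exists_maximal
  have hD := isHardyField_dClosureSubring hH hM.1 hHM
  have hmem : dClosureSubring hM.1 hHM ∈
      {L | IsHardyField L ∧ IsLiouvilleClosed L ∧ adjoin H constants ≤ L} :=
    ⟨hD, isLiouvilleClosed_dClosureSubring hM hH hHM, adjoin_le hD.isField
      (le_dClosureSubring hM.1 hHM) (constants_subset_dClosureSubring hM hHM)⟩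
  have hle : Li (adjoin H constants) ≤ dClosureSubring hM.1 hHM := sInf_le hmem
  have hLi : IsHardyField (Li (adjoin H constants)) := by
    refine ⟨fun f hf n => hD.isCn f (hle hf) n, isField_sInf (fun L hL => hL.1.isField) ⟨_, hmem⟩,
      fun f hf => Subring.mem_sInf.2 fun L hL => ?_⟩
    exact hL.1.derivative_mem f (Subring.mem_sInf.1 hf L hL)
  refine cof_eq_aleph0 hH hLi ?_ ?_ ?_ ?_ hcof
  · exact fun h hh => Subring.mem_sInf.2 fun L hL => hL.2.2 (le_adjoin H constants hh)
  · intro y hy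
    have := hle hy
    rw [← SetLike.mem_coe, coe_dClosureSubring hH hM.1 hHM] at this
    exact this.2
  · exact Subring.mem_sInf.2 fun L hL =>
      X_mem_of_linear hL.1 ((subset_adjoin H constants).trans hL.2.2) hL.2.1.2
  · exact fun f hf => Subring.mem_sInf.2 fun L hL =>
      expClosed_of_linear hL.1 ((subset_adjoin H constants).trans hL.2.2) hL.2.1.2 f
        (Subring.mem_sInf.1 hf L hL)

end DClosure

end RealGerm

theorem mainTheorem11 (H : Subring RealGerm) (hH : RealGerm.IsHardyField H) :
    (∀ E : Subring RealGerm, RealGerm.IsHardyField E → H ≤ E →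
      (∀ y ∈ E, RealGerm.IsDAlgebraic H y) →
      RealGerm.ExpClosed (RealGerm.adjoin E {RealGerm.X}) →
        Order.cof E ≤ Order.cof H ∧
          (RealGerm.ExpClosed (RealGerm.adjoin H {RealGerm.X}) → Order.cof E = Order.cof H)) ∧
    (Order.cof H = Cardinal.aleph0 →
      Order.cof (RealGerm.Li (RealGerm.adjoin H RealGerm.constants)) = Cardinal.aleph0 ∧
      ∀ M : Subring RealGerm, Maximal RealGerm.IsHardyField M → H ≤ M →
        Order.cof (RealGerm.dClosure H M) = Cardinal.aleph0) :=
  ⟨fun _ hE hHE hd hexp => ⟨RealGerm.cof_le_of_isDAlgebraic hH hE hHE hd hexp,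
    fun hexpH => RealGerm.cof_eq_of_isDAlgebraic hH hE hHE hd hexpH⟩,
    fun hcof => ⟨RealGerm.cof_Li hH hcof, fun _ hM hHM => RealGerm.cof_dClosure hM hH hHM hcof⟩⟩
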